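/- Let $a>-1$. For $N\ge 1$ consider the Laguerre orthogonal ensemble ($\beta=1$) with eigenvalue probability density proportional to $$\prod_{l=1}^N x_l^{(a-1)/2}e^{-x_l}\mathbb 1_{x_l>0}\prod_{1\le j<k\le N}|x_k-x_j|,$$ let $\rho_N(x)$ denote its one-point density ($N$ times the marginal density of one eigenvalue), put $\hat N=N+\frac{a-1}{2}$, and let $$\rho_N^{\rm h}(y)=\frac1{4\hat N}\,\rho_N\!\Big(\frac{y}{4\hat N}\Big)\qquad(y>0)$$ be the hard edge scaled density. With $J_a$ the Bessel function of the first kind and ${\rm JI}_a(x)=\int_x^\infty J_a(t)\,dt$ (a convergent improper integral for $x>0$), define $$b_1(y)=\tfrac1y J_a(\sqrt y)^2,\quad b_2(y)=J_a'(\sqrt y)^2,\quad b_3(y)=\tfrac1{\sqrt y}J_a(\sqrt y)J_a'(\sqrt y),$$ $$b_4(y)=\tfrac1{\sqrt y}J_a(\sqrt y)\,{\rm JI}_a(\sqrt y),\quad b_5(y)=J_a'(\sqrt y)\,{\rm JI}_a(\sqrt y).$$ Then there are functions $r_0,r_1$ on $(0,\infty)$, necessarily unique, such that for each fixed $y>0$,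 as $N\to\infty$, $$\rho_N^{\rm h}(y)=r_0(y)+\frac{1}{(2\hat N)^2}\,r_1(y)+O\big(\hat N^{-4}\big).$$ They are given for $y>0$ by $$r_0(y/2)=\frac{y-a^2}{2}\,b_1(y)+\frac12\,b_2(y)+\frac12\,b_4(y),$$ $$r_1(y/2)=\frac{2y-y^2}{16}\,b_1(y)-\frac{y}{24}\,b_2(y)-\frac{y}{12}\,b_3(y)+\frac{y-6a^2+6}{48}\,b_4(y)-\frac{y+2a^2-2}{48}\,b_5(y).$$ Equivalently $r_1(y/2)=C\,r_0(y/2)+P(y/2)$ with $C=\frac{1-a^2}{4}$ and $$P(y/2)=-\frac{(y-a^2)^2+a^4-2a^2}{16}\,b_1(y)-\frac{y-3a^2+3}{24}\,b_2(y)-\frac{y}{12}\,b_3(y)+\frac{y}{48}\,b_4(y)-\frac{y+2a^2-2}{48}\,b_5(y).$$ Moreover, with $\tilde a=a^2-1$ and the differential operators $$\begin{aligned}\mathcal D_0={}&\tilde a^2-(4+3\tilde a)y+2y^2+\big(4y^2-4(\tilde a-3)y-16-14\tilde a+\tilde a^2\big)y\tfrac{d}{dy}+(38y+16-22\tilde a)y^2\tfrac{d^2}{dy^2}\\&+(10y+88-5\tilde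 a)y^3\tfrac{d^3}{dy^3}+40y^4\tfrac{d^4}{dy^4}+4y^5\tfrac{d^5}{dy^5},\\ \mathcal D_1={}&y^2\Big(\tilde a-y+2(-2+\tilde a-2y)y\tfrac{d}{dy}-16y^2\tfrac{d^2}{dy^2}-5y^3\tfrac{d^3}{dy^3}\Big),\end{aligned}$$ one has on $(0,\infty)$ that $\mathcal D_0r_0=0$, $\mathcal D_0P=-\mathcal D_1r_0$ and $\mathcal D_0r_1=-\mathcal D_1r_0$. Thus $r_1$ is the particular solution $P$ of the inhomogeneous equation plus the contribution $C\,r_0$ of the homogeneous solution; if $a\neq1$, then $C\ne0$ and $C\,r_0$ is not identically zero. -/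

import Mathlib

open Filter Topology Asymptotics MeasureTheory

noncomputable section

/-- The Laguerre weight `x ^ ((a - 1) / 2) * exp (-x)` on the half line `x > 0`. -/
def loeWeight (a x : ℝ) : ℝ :=
  if 0 < x then x ^ ((a - 1) / 2) * Real.exp (-x) else 0

/-- The unnormalised eigenvalue density of the Laguerre orthogonal ensemble (Dyson index one). -/
def loeJoint (a : ℝ) {N : ℕ} (x : Fin N → ℝ) : ℝ :=
  (∏ i, loeWeight a (x i)) * ∏ i, ∏ j ∈ Finset.Ioi i, |x j - x i|

/-- The normalisation (partition function). -/
def loeZ (a : ℝ) (N : ℕ) : ℝ :=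
  ∫ x : Fin N → ℝ, loeJoint a x

/-- The one-point density: `N` times the first marginal of the normalised joint density. -/
def loeDensity (a : ℝ) : ℕ → ℝ → ℝ
  | 0, _ => 0
  | n + 1, x => ((n : ℝ) + 1) *
      ((∫ z : Fin n → ℝ, loeJoint a (Fin.cons x z : Fin (n + 1) → ℝ)) / loeZ a (n + 1))

/-- The shifted size `N + (a - 1) / 2`. -/
def Nhat (a : ℝ) (N : ℕ) : ℝ := (N : ℝ) + (a - 1) / 2

/-- The density in the hard edge variable `y`, where `x = y / (4 * Nhat a N)`. -/
def loeHardDensity (a : ℝ) (N : ℕ) (y : ℝ) : ℝ :=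
  1 / (4 * Nhat a N) * loeDensity a N (y / (4 * Nhat a N))

/-- `r₀` and `r₁` are the first two coefficients of the large `N` expansion of the hard edge
density in powers of `(2 * Nhat a N) ^ (-2)`, at each fixed `y > 0`. -/
def HasHardEdgeExpansion (a : ℝ) (r₀ r₁ : ℝ → ℝ) : Prop :=
  ∀ y : ℝ, 0 < y →
    (fun N : ℕ => loeHardDensity a N y - (r₀ y + 1 / (2 * Nhat a N) ^ 2 * r₁ y))
      =O[atTop] (fun N : ℕ => 1 / (2 * Nhat a N) ^ 4)

/-- The Bessel function of the first kind of real order `a`, for arguments `x > 0`.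
`Real.Gamma` is `0` at its poles, so the coefficients are `1 / Γ = 0` there, as they should be. -/
def besselJ (a x : ℝ) : ℝ :=
  ∑' k : ℕ, (-1) ^ k / ((k.factorial : ℝ) * Real.Gamma ((k : ℝ) + a + 1))
    * (x / 2) ^ (2 * (k : ℝ) + a)

/-- The improper integral of `besselJ a` over `(x, ∞)`. -/
def besselJI (a x : ℝ) : ℝ :=
  limUnder atTop (fun R : ℝ => ∫ t in x..R, besselJ a t)

def basis₁ (a y : ℝ) : ℝ := 1 / y * besselJ a (√y) ^ 2

def basis₂ (a y : ℝ) : ℝ := deriv (besselJ a) (√y) ^ 2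

def basis₃ (a y : ℝ) : ℝ := 1 / √y * besselJ a (√y) * deriv (besselJ a) (√y)

def basis₄ (a y : ℝ) : ℝ := 1 / √y * besselJ a (√y) * besselJI a (√y)

def basis₅ (a y : ℝ) : ℝ := deriv (besselJ a) (√y) * besselJI a (√y)

/-- The combination of the five basis functions with the given polynomial coefficients. -/
def besselForm (a : ℝ) (α β γ ξ η : Polynomial ℝ) (y : ℝ) : ℝ :=
  α.eval y * basis₁ a y + β.eval y * basis₂ a y + γ.eval y * basis₃ a y
    + ξ.eval y * basis₄ a y + η.eval y * basis₅ a y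

/-- The leading operator of the hard edge differential equation, with `c = a ^ 2 - 1`. -/
def hardD₀ (a : ℝ) (f : ℝ → ℝ) (y : ℝ) : ℝ :=
  let c := a ^ 2 - 1
  (c ^ 2 - (4 + 3 * c) * y + 2 * y ^ 2) * f y
    + (4 * y ^ 2 - 4 * (-3 + c) * y - 16 - 14 * c + c ^ 2) * y * iteratedDeriv 1 f y
    + (38 * y + 16 - 22 * c) * y ^ 2 * iteratedDeriv 2 f y
    + (10 * y + 88 - 5 * c) * y ^ 3 * iteratedDeriv 3 f y
    + 40 * y ^ 4 * iteratedDeriv 4 f y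
    + 4 * y ^ 5 * iteratedDeriv 5 f y

/-- The operator at order `(2 * Nhat a N) ^ (-2)` of the hard edge differential equation. -/
def hardD₁ (a : ℝ) (f : ℝ → ℝ) (y : ℝ) : ℝ :=
  let c := a ^ 2 - 1
  y ^ 2 * ((c - y) * f y
    + 2 * (-2 + c - 2 * y) * y * iteratedDeriv 1 f y
    - 16 * y ^ 2 * iteratedDeriv 2 f y
    - 5 * y ^ 3 * iteratedDeriv 3 f y)

end

open Polynomial

/-! The density is first computed exactly at finite N in terms of a single Laguerre polynomial, and
what remains is an expansion of analytic functions of the small parameter ε = 1/N̂².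

Finite N follows de Bruijn. The absolute Vandermonde determinant is a constant times the
symmetrisation of a product of signs, one for each pair of coordinates, times a Slater determinant
(`exists_sum_blockKernel_mul_slaterDet`). After integration each permutation contributes a product
of skew products; for a skew-orthogonal basis only the permutations respecting the pairs survive,
and they all contribute equally. Freezing one coordinate by a Dirac mass changes one factor, so the
density is the diagonal of an explicit kernel (`loeDensity_eq_skewDensity`). Odd N is covered by one
unpaired index.

The basis is explicit. With D f = x f' + ((a+1)/2 - x) f and w the weight, w · D f = (x w f)', so
the skew product of D f and g is twice their inner product for x^a e^(-2x) (`skewProd_skewOp_left`).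
The Laguerre polynomials L_k in the variable 2x, paired with D L_k for k of one parity, are
therefore skew-orthogonal. The kernel telescopes to one formula valid for both parities of N
(`loeDensity_succ`), and the Christoffel-Darboux sum reduces it to L_n, L_n' and an incomplete
integral, n = N - 1.

Under x = s²/(8N̂), the function s^a e^(-x) L_n(x) is a multiple of the regular solution of (s
d/ds)² V + (s² - a² - ε s⁴/16) V = 0. Hence N enters only through ε and two Gamma quotients
(`loeHardDensity_succ`). The solution is J_a + ε·`besselOne` + O(ε²), where `besselOne` is
elementary in J_a and s J_a'; the Gamma quotients are 1 + cε + O(ε²) because N̂ centres their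
arguments (`isBigO_gammaRatio`). The leading constant 1 minus ∫₀ˢ J_a becomes JI_a(s), by decay of
J_a and ∫₀^∞ J_a = 1 (`tendsto_besselPrimitive`). Collecting terms is `loeHardDensity_firstOrder`;
uniqueness of coefficients is the usual limit argument.

For the differential equations, Bessel's equation makes the span of the five functions over
polynomials stable under y d/dy (`hasDerivAt_basis`). Derivatives up to order five are tabulated in
that span, and each equation becomes a polynomial identity. Finally r₀ is not identically zero
because s^(1-a) r₀(s²/2) has a nonzero limit at 0. -/

/-! ### Permutations that respect a decomposition into pairs -/

section BlockPerm

variable {β T : Type*}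

/-- The involution exchanging the two members of each pair and fixing the unpaired indices. -/
def blockFlip : (β × Bool) ⊕ T → (β × Bool) ⊕ T :=
  Sum.map (fun p => (p.1, !p.2)) id

@[simp] lemma blockFlip_inl (b : β) (i : Bool) :
    blockFlip (Sum.inl (b, i) : (β × Bool) ⊕ T) = Sum.inl (b, !i) := rfl

@[simp] lemma blockFlip_inr (t : T) : blockFlip (Sum.inr t : (β × Bool) ⊕ T) = Sum.inr t := rfl

@[simp] lemma blockFlip_blockFlip (q : (β × Bool) ⊕ T) : blockFlip (blockFlip q) = q := by
  rcases q with ⟨b, i⟩ | t <;> simp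

lemma blockFlip_inl_ne (p : β × Bool) : blockFlip (Sum.inl p : (β × Bool) ⊕ T) ≠ Sum.inl p := by
  obtain ⟨b, i⟩ := p
  cases i <;> simp

lemma exists_inr_of_blockFlip_eq {q : (β × Bool) ⊕ T} (h : blockFlip q = q) :
    ∃ t, q = Sum.inr t := by
  rcases q with p | t
  · exact absurd h (blockFlip_inl_ne p)
  · exact ⟨t, rfl⟩

/-- A permutation that respects the pairs everywhere except possibly on the pair of `p` respects
all pairs. -/
lemma commute_blockFlip_of_forall_ne [Subsingleton T] (σ : Equiv.Perm ((β × Bool) ⊕ T))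
    (p : (β × Bool) ⊕ T)
    (h : ∀ q, q ≠ p → q ≠ blockFlip p → σ (blockFlip q) = blockFlip (σ q)) :
    ∀ q, σ (blockFlip q) = blockFlip (σ q) := by
  -- Look at the preimage `q'` of the flipped image of `q`. Either it lies in the pair of `p`, so it
  -- is `q` or its partner, or the hypothesis applies to `q'` and injectivity makes it the partner
  -- of `q`.
  have key : ∀ q, (q = p ∨ q = blockFlip p) → blockFlip (σ q) = σ q ∨
      blockFlip (σ q) = σ (blockFlip q) := by
    intro q hq
    obtain ⟨q', hq'⟩ := σ.surjective (blockFlip (σ q))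
    by_cases h1 : q' = p ∨ q' = blockFlip p
    · rw [← hq']
      rcases hq with rfl | rfl <;> rcases h1 with rfl | rfl <;> simp
    · push Not at h1
      have h2 := h q' h1.1 h1.2
      rw [hq', blockFlip_blockFlip] at h2
      have h3 := σ.injective h2
      have h4 : q' = blockFlip q := by rw [← h3, blockFlip_blockFlip]
      rw [← hq', h4]
      simp
  intro q
  by_cases hq : q = p ∨ q = blockFlip p
  · rcases key q hq with h1 | h1
    · obtain ⟨t, ht⟩ := exists_inr_of_blockFlip_eq h1
      rcases q with q | t'
      -- A paired index cannot land on the unpaired index `t`: since `t` is outside the pair of `p`,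
      -- its own image is fixed by the flip, hence is `t` again as `T` is a subsingleton, against
      -- injectivity.
      · exfalso
        have hne : ∀ r, r = p ∨ r = blockFlip p → r ≠ Sum.inr t := by
          intro r hr hrt
          subst hrt
          rcases hr with hr | hr
          · rw [← hr] at hq; simp at hq
          · have : p = Sum.inr t := by rw [← blockFlip_blockFlip p, ← hr]; rfl
            rw [this] at hq; simp at hq
        have h5 : σ (Sum.inr t) = blockFlip (σ (Sum.inr t)) := by
          have := h (Sum.inr t) (fun e => hne p (Or.inl rfl) e.symm)
            (fun e => hne (blockFlip p) (Or.inr rfl) e.symm)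
          simpa using this
        obtain ⟨t2, ht2⟩ := exists_inr_of_blockFlip_eq h5.symm
        rw [Subsingleton.elim t2 t] at ht2
        exact absurd (σ.injective (ht2.trans ht.symm)) (by simp)
      · simp [h1]
    · exact h1.symm
  · push Not at hq
    exact h q hq.1 hq.2

variable [Fintype β] [DecidableEq β] [Fintype T] [DecidableEq T]

/-- The flip fixes exactly the unpaired indices, so `σ` preserves the paired ones and splits into
permutations inside the pairs and a permutation `π` of the pairs. Since `π` moves both members of
each pair, its sign enters twice and drops out. -/
lemma exists_blockPerm [Subsingleton T] (σ : Equiv.Perm ((β × Bool) ⊕ T))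
    (h : ∀ q, σ (blockFlip q) = blockFlip (σ q)) :
    ∃ (π : Equiv.Perm β) (s : β → Equiv.Perm Bool),
      (∀ b i, σ (Sum.inl (b, i)) = Sum.inl (π b, s b i)) ∧ (∀ t, σ (Sum.inr t) = Sum.inr t) ∧
      Equiv.Perm.sign σ = ∏ b, Equiv.Perm.sign (s b) := by
  have hinl : Set.MapsTo σ (Set.range Sum.inl) (Set.range Sum.inl) := by
    rintro _ ⟨q, rfl⟩
    rcases hσ : σ (Sum.inl q) with q' | t
    · exact ⟨q', rfl⟩
    · have h1 := h (Sum.inl q)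
      rw [hσ, blockFlip_inr, ← hσ] at h1
      exact absurd (σ.injective h1) (blockFlip_inl_ne q)
  obtain ⟨⟨σ₁, σ₂⟩, rfl⟩ := Equiv.Perm.mem_sumCongrHom_range_of_perm_mapsTo_inl hinl
  have hσ₂ : σ₂ = 1 := Equiv.ext fun t => Subsingleton.elim _ _
  subst hσ₂
  have h1 : ∀ b i, σ₁ (b, !i) = ((σ₁ (b, i)).1, !(σ₁ (b, i)).2) := by
    intro b i
    have := h (Sum.inl (b, i))
    rcases hh : σ₁ (b, i) with ⟨c, j⟩
    simpa [hh] using this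
  have hinj : Function.Injective fun b => (σ₁ (b, false)).1 := by
    intro b b' hb
    have hb : (σ₁ (b, false)).1 = (σ₁ (b', false)).1 := hb
    by_cases h2 : (σ₁ (b, false)).2 = (σ₁ (b', false)).2
    · exact congrArg Prod.fst (σ₁.injective (Prod.ext hb h2))
    · have h3 : σ₁ (b, true) = σ₁ (b', false) := by
        rw [show true = !false from rfl, h1]
        refine Prod.ext hb ?_
        revert h2
        cases (σ₁ (b, false)).2 <;> cases (σ₁ (b', false)).2 <;> simp
      have := σ₁.injective h3
      simp at this
  let π : Equiv.Perm β := Equiv.ofBijective _ (Finite.injective_iff_bijective.mp hinj)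
  let s : β → Equiv.Perm Bool := fun b =>
    if (σ₁ (b, false)).2 = false then 1 else Equiv.swap false true
  have hform : ∀ b i, σ₁ (b, i) = (π b, s b i) := by
    intro b i
    have hπ : π b = (σ₁ (b, false)).1 := rfl
    have h0 : σ₁ (b, false) = (π b, s b false) := by
      refine Prod.ext hπ.symm ?_
      rcases h2 : (σ₁ (b, false)).2 <;> simp [s, h2]
    cases i
    · exact h0
    · rw [show true = !false from rfl, h1, h0]
      refine Prod.ext rfl ?_
      rcases h2 : (σ₁ (b, false)).2 <;> simp [s, h2]
  refine ⟨π, s, fun b i => by simp [hform], fun t => by simp, ?_⟩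
  have hprod : σ₁ = Equiv.prodCongrLeft (fun _ : Bool => π) * Equiv.prodCongrRight s := by
    ext ⟨b, i⟩ <;> simp [hform]
  rw [Equiv.Perm.sumCongrHom_apply]
  simp only [Equiv.Perm.sign_sumCongr, map_one, mul_one]
  rw [hprod, Equiv.Perm.sign_mul, Equiv.Perm.sign_prodCongrLeft, Equiv.Perm.sign_prodCongrRight]
  simp

/-- The contribution of a permutation respecting the pairs does not depend on the sign
conventions inside the pairs. -/
lemma sign_mul_prod_blocks [Subsingleton T] (σ : Equiv.Perm ((β × Bool) ⊕ T))
    (π : Equiv.Perm β) (s : β → Equiv.Perm Bool)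
    (h₁ : ∀ b i, σ (Sum.inl (b, i)) = Sum.inl (π b, s b i))
    (h₃ : Equiv.Perm.sign σ = ∏ b, Equiv.Perm.sign (s b))
    (F : β → (β × Bool) ⊕ T → (β × Bool) ⊕ T → ℝ) (hF : ∀ b j k, F b j k = -F b k j) :
    ((Equiv.Perm.sign σ : ℤ) : ℝ) *
        ∏ b, F b (σ (Sum.inl (b, false))) (σ (Sum.inl (b, true))) =
      ∏ b, F b (Sum.inl (π b, false)) (Sum.inl (π b, true)) := by
  rw [h₃]
  push_cast
  rw [← Finset.prod_mul_distrib]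
  refine Finset.prod_congr rfl fun b _ => ?_
  rw [h₁, h₁]
  have hs : s b = 1 ∨ s b = Equiv.swap false true := by
    generalize s b = e
    revert e
    decide
  rcases hs with hs | hs
  · simp [hs]
  · rw [hs, Equiv.Perm.sign_swap (by simp)]
    simp only [Equiv.swap_apply_left, Equiv.swap_apply_right]
    rw [hF]
    simp

end BlockPerm

/-! ### The skew product with kernel sign(v - u) -/

section Pairing

lemma measurable_real_sign : Measurable Real.sign := by
  unfold Real.sign
  exact Measurable.ite measurableSet_Iio measurable_const
    (Measurable.ite measurableSet_Ioi measurable_const measurable_const)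

lemma abs_real_sign_le_one (r : ℝ) : |Real.sign r| ≤ 1 := by
  rcases Real.sign_apply_eq r with h | h | h <;> simp [h]

/-- The skew pairing of two functions, each integrated against its own measure. -/
noncomputable def skewPairing (μ ν : Measure ℝ) (f g : ℝ → ℝ) : ℝ :=
  ∫ z : ℝ × ℝ, Real.sign (z.2 - z.1) * (f z.1 * g z.2) ∂(μ.prod ν)

lemma measurable_sign_sub : Measurable fun z : ℝ × ℝ => Real.sign (z.2 - z.1) :=
  measurable_real_sign.comp (measurable_snd.sub measurable_fst)

lemma integrable_sign_mul {μ ν : Measure ℝ} [SFinite μ] [SFinite ν] {f g : ℝ → ℝ}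
    (hf : Integrable f μ) (hg : Integrable g ν) :
    Integrable (fun z : ℝ × ℝ => Real.sign (z.2 - z.1) * (f z.1 * g z.2)) (μ.prod ν) :=
  (hf.mul_prod hg).bdd_mul (c := 1) measurable_sign_sub.aestronglyMeasurable
    (ae_of_all _ fun z => by simpa using abs_real_sign_le_one (z.2 - z.1))

lemma skewPairing_antisymm {μ : Measure ℝ} [SFinite μ] (f g : ℝ → ℝ) :
    skewPairing μ μ f g = -skewPairing μ μ g f := by
  unfold skewPairing
  rw [← integral_prod_swap, ← integral_neg]
  refine integral_congr_ae (ae_of_all _ fun z => ?_)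
  simp only [Prod.fst_swap, Prod.snd_swap]
  rw [← neg_sub z.2 z.1, Real.sign_neg]
  ring

lemma skewPairing_eq_integral {μ ν : Measure ℝ} [SFinite μ] [SFinite ν] {f g : ℝ → ℝ}
    (hf : Integrable f μ) (hg : Integrable g ν) :
    skewPairing μ ν f g = ∫ u, f u * ∫ v, Real.sign (v - u) * g v ∂ν ∂μ := by
  unfold skewPairing
  rw [integral_prod _ (integrable_sign_mul hf hg)]
  refine integral_congr_ae (ae_of_all _ fun u => ?_)
  simp only
  rw [← integral_const_mul]
  refine integral_congr_ae (ae_of_all _ fun v => ?_)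
  simp only
  ring

/-- Freezing one coordinate of a pair collapses the double integral to a value times the sign
transform of the partner. The two choices of frozen coordinate differ in sign, which later produces
the antisymmetric numerator of the kernel. -/
lemma skewPairing_dirac_left (x : ℝ) {ν : Measure ℝ} [SFinite ν] {f g : ℝ → ℝ}
    (hg : Integrable g ν) :
    skewPairing (Measure.dirac x) ν f g = f x * ∫ v, Real.sign (v - x) * g v ∂ν := by
  rw [skewPairing_eq_integral _ hg, integral_dirac]
  exact integrable_dirac (by simp)

lemma skewPairing_dirac_right (x : ℝ) {μ : Measure ℝ} [SFinite μ] {f g : ℝ → ℝ}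
    (hf : Integrable f μ) :
    skewPairing μ (Measure.dirac x) f g = -(g x * ∫ v, Real.sign (v - x) * f v ∂μ) := by
  rw [skewPairing_eq_integral hf (integrable_dirac (by simp))]
  simp only [integral_dirac]
  rw [← integral_const_mul, ← integral_neg]
  refine integral_congr_ae (ae_of_all _ fun v => ?_)
  simp only
  rw [← neg_sub v x, Real.sign_neg]
  ring

end Pairing

/-! ### Factorisation of integrals over the pairs -/

section Fubini

variable {β T : Type*} [Fintype β]

/-- The product of the signs attached to the pairs. -/
noncomputable def blockKernel (x : (β × Bool) ⊕ T → ℝ) : ℝ :=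
  ∏ b, Real.sign (x (Sum.inl (b, true)) - x (Sum.inl (b, false)))

lemma measurable_blockKernel : Measurable (blockKernel : ((β × Bool) ⊕ T → ℝ) → ℝ) := by
  unfold blockKernel
  refine Finset.measurable_prod _ fun b _ => measurable_real_sign.comp ?_
  exact (measurable_pi_apply _).sub (measurable_pi_apply _)

lemma abs_blockKernel_le_one (x : (β × Bool) ⊕ T → ℝ) : |blockKernel x| ≤ 1 := by
  unfold blockKernel
  rw [Finset.abs_prod]
  exact Finset.prod_le_one (fun _ _ => abs_nonneg _) fun _ _ => abs_real_sign_le_one _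

/-- Assembles a point from its pairs of coordinates and its unpaired coordinates. -/
def blockAssemble (z : (β → ℝ × ℝ) × (T → ℝ)) : (β × Bool) ⊕ T → ℝ :=
  Sum.elim (fun p => if p.2 then (z.1 p.1).2 else (z.1 p.1).1) z.2

variable [Fintype T]

lemma measurePreserving_blockAssemble (μ : (β × Bool) ⊕ T → Measure ℝ)
    [∀ q, SigmaFinite (μ q)] :
    MeasurePreserving (blockAssemble (β := β) (T := T))
      ((Measure.pi fun b => (μ (Sum.inl (b, false))).prod (μ (Sum.inl (b, true)))).prod
        (Measure.pi fun t => μ (Sum.inr t))) (Measure.pi μ) := by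
  have hmeas : Measurable (blockAssemble (β := β) (T := T)) := by
    refine measurable_pi_lambda _ fun q => ?_
    rcases q with ⟨b, i⟩ | t
    · cases i
      · exact measurable_fst.comp ((measurable_pi_apply b).comp measurable_fst)
      · exact measurable_snd.comp ((measurable_pi_apply b).comp measurable_fst)
    · exact (measurable_pi_apply t).comp measurable_snd
  refine ⟨hmeas, (Measure.pi_eq fun s hs => ?_).symm⟩
  rw [Measure.map_apply hmeas (MeasurableSet.univ_pi hs)]
  have hpre : blockAssemble (β := β) (T := T) ⁻¹' Set.univ.pi s =
      (Set.univ.pi fun b => s (Sum.inl (b, false)) ×ˢ s (Sum.inl (b, true))) ×ˢ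
        (Set.univ.pi fun t => s (Sum.inr t)) := by
    ext z
    simp [blockAssemble, Set.mem_pi, forall_and]
  rw [hpre, Measure.prod_prod, Measure.pi_pi, Measure.pi_pi]
  simp only [Measure.prod_prod]
  rw [Fintype.prod_sum_type, Fintype.prod_prod_type]
  simp [mul_comm]

/-- The sign kernel couples only the two coordinates of a pair, so the integral factorises over
pairs and unpaired coordinates. Measurability is needed only for the change of variables; the
product formulas hold without integrability. -/
lemma integral_blockKernel_mul_prod (μ : (β × Bool) ⊕ T → Measure ℝ) [∀ q, SigmaFinite (μ q)]
    (h : (β × Bool) ⊕ T → ℝ → ℝ) (hh : ∀ q, Measurable (h q)) :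
    ∫ x, blockKernel x * ∏ q, h q (x q) ∂Measure.pi μ =
      (∏ b, skewPairing (μ (Sum.inl (b, false))) (μ (Sum.inl (b, true)))
        (h (Sum.inl (b, false))) (h (Sum.inl (b, true)))) *
      ∏ t, ∫ u, h (Sum.inr t) u ∂μ (Sum.inr t) := by
  have hmp := measurePreserving_blockAssemble μ
  rw [← hmp.map_eq, integral_map hmp.measurable.aemeasurable]
  · unfold skewPairing
    rw [← integral_fintype_prod_eq_prod (fun (b : β) (z : ℝ × ℝ) =>
      Real.sign (z.2 - z.1) * (h (Sum.inl (b, false)) z.1 * h (Sum.inl (b, true)) z.2)),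
      ← integral_fintype_prod_eq_prod (fun (t : T) (u : ℝ) => h (Sum.inr t) u),
      ← integral_prod_mul]
    refine integral_congr_ae (ae_of_all _ fun z => ?_)
    simp only [blockKernel, blockAssemble, Fintype.prod_sum_type, Fintype.prod_prod_type,
      Fintype.prod_bool, Sum.elim_inl, Sum.elim_inr, Finset.prod_mul_distrib]
    simp only [Bool.false_eq_true, if_true, if_false]
    ring
  · refine (measurable_blockKernel.mul ?_).aestronglyMeasurable
    exact Finset.measurable_prod _ fun q _ => (hh q).comp (measurable_pi_apply q)

end Fubini

/-! ### Relabelling coordinates, and measures with one frozen coordinate -/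

section PermInvariance

variable {ι : Type*}

lemma integral_comp_equiv {ι' : Type*} [Fintype ι] [Fintype ι'] (μ : ι' → Measure ℝ)
    [∀ q, SigmaFinite (μ q)] (τ : ι ≃ ι') (f : (ι → ℝ) → ℝ) :
    ∫ x, f (x ∘ τ) ∂Measure.pi μ = ∫ x, f x ∂Measure.pi fun q => μ (τ q) := by
  have h := (measurePreserving_piCongrLeft μ τ).integral_comp' (fun x => f (x ∘ τ))
  rw [← h]
  refine integral_congr_ae (ae_of_all _ fun x => ?_)
  simp only
  congr 1
  ext q
  simp [MeasurableEquiv.coe_piCongrLeft, Equiv.piCongrLeft_apply_apply]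

/-- Lebesgue measure in every coordinate but `p`, which is frozen at `x`. -/
noncomputable def frozenMeasure [DecidableEq ι] (p : ι) (x : ℝ) (q : ι) : Measure ℝ :=
  if q = p then Measure.dirac x else volume

instance [DecidableEq ι] (p : ι) (x : ℝ) (q : ι) : SigmaFinite (frozenMeasure p x q) := by
  unfold frozenMeasure
  split_ifs <;> infer_instance

lemma frozenMeasure_perm [DecidableEq ι] (p : ι) (x : ℝ) (τ : Equiv.Perm ι) (q : ι) :
    frozenMeasure p x (τ q) = frozenMeasure (τ.symm p) x q := by
  unfold frozenMeasure
  have : τ q = p ↔ q = τ.symm p := by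
    rw [Equiv.eq_symm_apply]
  simp [this]

end PermInvariance

/-- Sorting moves any point with distinct coordinates into the ordered chamber, so an identity
between symmetric functions needs to be checked only there and on the diagonals. -/
lemma exists_perm_strictMono {ι : Type*} {N : ℕ} (e : ι ≃ Fin N) {x : ι → ℝ} (hx : Function.Injective x) :
    ∃ τ : Equiv.Perm ι, ∀ q q', e q < e q' → x (τ q) < x (τ q') := by
  let y := x ∘ e.symm
  let ρ := Tuple.sort y
  have hmono : StrictMono (y ∘ ρ) := (Tuple.monotone_sort y).strictMono_of_injective
    ((hx.comp e.symm.injective).comp ρ.injective)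
  refine ⟨(e.trans ρ).trans e.symm, fun q q' h => ?_⟩
  exact hmono h

/-! ### Vandermonde and Slater determinants -/

section Alternating

variable {ι : Type*} [Fintype ι] [DecidableEq ι] {N : ℕ} (e : ι ≃ Fin N)

/-- The Vandermonde determinant with rows and columns indexed by `ι`. -/
noncomputable def vandermondeDet (x : ι → ℝ) : ℝ :=
  (Matrix.of fun i j : ι => x i ^ (e j : ℕ)).det

lemma vandermondeDet_eq_prod (x : ι → ℝ) :
    vandermondeDet e x = ∏ i, ∏ j ∈ Finset.Ioi i, (x (e.symm j) - x (e.symm i)) := by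
  rw [← Matrix.det_vandermonde, vandermondeDet, ← Matrix.det_reindex_self e]
  congr 1
  ext i j
  simp [Matrix.vandermonde_apply]

lemma vandermondeDet_comp_perm (x : ι → ℝ) (τ : Equiv.Perm ι) :
    vandermondeDet e (x ∘ τ) = (Equiv.Perm.sign τ : ℤ) * vandermondeDet e x := by
  unfold vandermondeDet
  rw [← Matrix.det_permute]
  rfl

lemma abs_vandermondeDet_comp_perm (x : ι → ℝ) (τ : Equiv.Perm ι) :
    |vandermondeDet e (x ∘ τ)| = |vandermondeDet e x| := by
  rw [vandermondeDet_comp_perm, abs_mul]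
  rcases Int.units_eq_one_or (Equiv.Perm.sign τ) with h | h <;> simp [h]

/-- The determinant of the functions `w * q j` at the points `x i`. -/
noncomputable def slaterDet (φ : ι → ℝ → ℝ) (x : ι → ℝ) : ℝ :=
  (Matrix.of fun i j : ι => φ i (x j)).det

lemma slaterDet_eq_sum (φ : ι → ℝ → ℝ) (x : ι → ℝ) :
    slaterDet φ x = ∑ σ : Equiv.Perm ι, ((Equiv.Perm.sign σ : ℤ) : ℝ) * ∏ q, φ (σ q) (x q) := by
  simp [slaterDet, Matrix.det_apply']

lemma slaterDet_comp_perm (φ : ι → ℝ → ℝ) (x : ι → ℝ) (τ : Equiv.Perm ι) :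
    slaterDet φ (x ∘ τ) = (Equiv.Perm.sign τ : ℤ) * slaterDet φ x := by
  unfold slaterDet
  rw [← Matrix.det_permute']
  rfl

/-- A Slater determinant of weighted polynomials of degree less than the number of points is a
multiple of the Vandermonde determinant. -/
lemma slaterDet_polynomial (w : ℝ → ℝ) (p : ι → ℝ[X]) (hp : ∀ j, (p j).natDegree < N)
    (x : ι → ℝ) :
    slaterDet (fun j u => w u * (p j).eval u) x =
      (Matrix.of fun i j : ι => (p i).coeff (e j)).det * ((∏ i, w (x i)) * vandermondeDet e x) := by
  have h : (Matrix.of fun i j : ι => w (x j) * (p i).eval (x j)) =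
      (Matrix.of fun i j : ι => (p i).coeff (e j)) *
        (Matrix.of fun i j : ι => x i ^ (e j : ℕ)).transpose * Matrix.diagonal fun i => w (x i) := by
    ext i j
    rw [Matrix.mul_diagonal, Matrix.mul_apply]
    simp only [Matrix.of_apply, Matrix.transpose_apply]
    rw [eval_eq_sum_range' (hp i), mul_comm, ← Fin.sum_univ_eq_sum_range
      (fun k => (p i).coeff k * x j ^ k), ← e.sum_comp]
  rw [slaterDet, h, Matrix.det_mul, Matrix.det_mul, Matrix.det_transpose, Matrix.det_diagonal,
    vandermondeDet]
  ring

end Alternating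

/-! ### The absolute Vandermonde determinant as a symmetrisation -/

section Symmetrisation

variable {β T : Type*} [Fintype β] [DecidableEq β] [Fintype T] [DecidableEq T] {N : ℕ}
  (e : (β × Bool) ⊕ T ≃ Fin N)

/-- Symmetrising the block kernel times the Slater determinant produces the absolute value of the
Vandermonde determinant, up to a constant. -/
lemma exists_sum_blockKernel_mul_slaterDet (w : ℝ → ℝ) (p : (β × Bool) ⊕ T → ℝ[X])
    (hp : ∀ j, (p j).natDegree < N) :
    ∃ c : ℝ, ∀ x : (β × Bool) ⊕ T → ℝ,
      ∑ τ : Equiv.Perm ((β × Bool) ⊕ T),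
        blockKernel (x ∘ τ) * slaterDet (fun j u => w u * (p j).eval u) (x ∘ τ) =
      c * ((∏ i, w (x i)) * |vandermondeDet e x|) := by
  set c₀ := (Matrix.of fun i j : (β × Bool) ⊕ T => (p i).coeff (e j)).det with hc₀
  set F : ((β × Bool) ⊕ T → ℝ) → ℝ := fun x =>
    ∑ τ : Equiv.Perm ((β × Bool) ⊕ T), ((Equiv.Perm.sign τ : ℤ) : ℝ) * blockKernel (x ∘ τ) with hF
  have hsum : ∀ x, ∑ τ : Equiv.Perm ((β × Bool) ⊕ T),
      blockKernel (x ∘ τ) * slaterDet (fun j u => w u * (p j).eval u) (x ∘ τ) =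
      c₀ * (∏ i, w (x i)) * (F x * vandermondeDet e x) := by
    intro x
    simp only [hF]
    rw [Finset.sum_mul, Finset.mul_sum]
    refine Finset.sum_congr rfl fun τ _ => ?_
    rw [slaterDet_comp_perm, slaterDet_polynomial e w p hp, ← hc₀]
    ring
  have hFperm : ∀ x (ρ : Equiv.Perm ((β × Bool) ⊕ T)),
      F (x ∘ ρ) = (Equiv.Perm.sign ρ : ℤ) * F x := by
    intro x ρ
    simp only [hF]
    rw [← Equiv.sum_comp (Equiv.mulLeft ρ) fun τ : Equiv.Perm ((β × Bool) ⊕ T) =>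
      ((Equiv.Perm.sign τ : ℤ) : ℝ) * blockKernel (x ∘ τ), Finset.mul_sum]
    refine Finset.sum_congr rfl fun τ _ => ?_
    simp only [Equiv.coe_mulLeft, Equiv.Perm.sign_mul, Equiv.Perm.coe_mul, Function.comp_assoc]
    rcases Int.units_eq_one_or (Equiv.Perm.sign ρ) with h | h <;> simp [h]
  -- `F` is alternating and depends only on the relative order of the coordinates, so on the ordered
  -- chamber it is constant; the point with coordinates `e q` serves as a representative. The
  -- product of `F` with the Vandermonde determinant is symmetric, which extends the identity to all
  -- injective `x`; otherwise both sides vanish.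
  refine ⟨c₀ * F fun q => (e q : ℝ), fun x => ?_⟩
  rw [hsum]
  by_cases hx : Function.Injective x
  · obtain ⟨τ, hτ⟩ := exists_perm_strictMono e hx
    have hsgn : ∀ q q', Real.sign (x (τ q) - x (τ q')) = Real.sign ((e q : ℝ) - (e q' : ℝ)) := by
      intro q q'
      rcases lt_trichotomy (e q) (e q') with h | h | h
      · have h' : ((e q : ℕ) : ℝ) < (e q' : ℕ) := by exact_mod_cast h
        rw [Real.sign_of_neg (by linarith [hτ _ _ h]), Real.sign_of_neg (by linarith)]
      · rw [e.injective h]; simp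
      · have h' : ((e q' : ℕ) : ℝ) < (e q : ℕ) := by exact_mod_cast h
        rw [Real.sign_of_pos (by linarith [hτ _ _ h]), Real.sign_of_pos (by linarith)]
    have h1 : F (x ∘ τ) = F fun q => (e q : ℝ) := by
      simp only [hF]
      refine Finset.sum_congr rfl fun ρ _ => ?_
      simp only [blockKernel, Function.comp_apply, hsgn]
    have h2 : 0 ≤ vandermondeDet e (x ∘ τ) := by
      rw [vandermondeDet_eq_prod]
      refine Finset.prod_nonneg fun i _ => Finset.prod_nonneg fun j hj => ?_
      have := hτ (e.symm i) (e.symm j) (by simpa using hj)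
      simp only [Function.comp_apply]
      linarith
    have h3 : F x * vandermondeDet e x = F (x ∘ τ) * vandermondeDet e (x ∘ τ) := by
      rw [hFperm, vandermondeDet_comp_perm]
      rcases Int.units_eq_one_or (Equiv.Perm.sign τ) with h | h <;> simp [h]
    rw [h3, h1, ← abs_vandermondeDet_comp_perm e x τ, abs_of_nonneg h2]
    ring
  · have h0 : vandermondeDet e x = 0 := by
      rw [Function.not_injective_iff] at hx
      obtain ⟨i, j, hij, hne⟩ := hx
      exact Matrix.det_zero_of_row_eq hne (by ext k; simp [hij])
    simp [h0]

end Symmetrisation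

set_option linter.unusedSectionVars false

/-! ### Expansion over permutations for a skew-orthogonal family -/

section BlockExpansion

lemma Fintype.prod_ite_eq_mul_div {α : Type*} [Fintype α] [DecidableEq α] (A X : α → ℝ) (b : α)
    (h : A b ≠ 0) : ∏ c, (if c = b then X c else A c) = (∏ c, A c) * (X b / A b) := by
  rw [← Finset.mul_prod_erase Finset.univ _ (Finset.mem_univ b),
    ← Finset.mul_prod_erase Finset.univ A (Finset.mem_univ b)]
  have : ∏ c ∈ Finset.univ.erase b, (if c = b then X c else A c) =
      ∏ c ∈ Finset.univ.erase b, A c :=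
    Finset.prod_congr rfl fun c hc => if_neg (Finset.ne_of_mem_erase hc)
  rw [this]
  simp only [if_true]
  field_simp

variable {β T : Type*} [Fintype β] [DecidableEq β] [Fintype T] [DecidableEq T]

/-- The contribution of one permutation to the integral of the block kernel times a Slater
determinant. -/
noncomputable def blockTerm (φ : (β × Bool) ⊕ T → ℝ → ℝ) (μ : (β × Bool) ⊕ T → Measure ℝ)
    (σ : Equiv.Perm ((β × Bool) ⊕ T)) : ℝ :=
  ((Equiv.Perm.sign σ : ℤ) : ℝ) *
    ((∏ b, skewPairing (μ (Sum.inl (b, false))) (μ (Sum.inl (b, true)))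
      (φ (σ (Sum.inl (b, false)))) (φ (σ (Sum.inl (b, true))))) *
    ∏ t, ∫ u, φ (σ (Sum.inr t)) u ∂μ (Sum.inr t))

variable {φ : (β × Bool) ⊕ T → ℝ → ℝ}

lemma integrable_blockKernel_mul {μ : (β × Bool) ⊕ T → Measure ℝ} [∀ q, SigmaFinite (μ q)]
    (hintg : ∀ j q, Integrable (φ j) (μ q)) (σ : Equiv.Perm ((β × Bool) ⊕ T)) :
    Integrable (fun x => blockKernel x * ∏ q, φ (σ q) (x q)) (Measure.pi μ) :=
  (Integrable.fintype_prod fun q => hintg (σ q) q).bdd_mul (c := 1)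
    measurable_blockKernel.aestronglyMeasurable
    (ae_of_all _ fun x => by simpa using abs_blockKernel_le_one x)

lemma blockKernel_mul_slaterDet (x : (β × Bool) ⊕ T → ℝ) :
    blockKernel x * slaterDet φ x = ∑ σ : Equiv.Perm ((β × Bool) ⊕ T),
      ((Equiv.Perm.sign σ : ℤ) : ℝ) * (blockKernel x * ∏ q, φ (σ q) (x q)) := by
  rw [slaterDet_eq_sum, Finset.mul_sum]
  exact Finset.sum_congr rfl fun σ _ => by ring

lemma integrable_blockKernel_mul_slaterDet {μ : (β × Bool) ⊕ T → Measure ℝ}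
    [∀ q, SigmaFinite (μ q)] (hintg : ∀ j q, Integrable (φ j) (μ q)) :
    Integrable (fun x => blockKernel x * slaterDet φ x) (Measure.pi μ) := by
  simp only [blockKernel_mul_slaterDet]
  exact integrable_finsetSum _ fun σ _ => (integrable_blockKernel_mul hintg σ).const_mul _

lemma integral_blockKernel_mul_slaterDet {μ : (β × Bool) ⊕ T → Measure ℝ}
    [∀ q, SigmaFinite (μ q)] (hφ : ∀ j, Measurable (φ j)) (hintg : ∀ j q, Integrable (φ j) (μ q)) :
    ∫ x, blockKernel x * slaterDet φ x ∂Measure.pi μ = ∑ σ, blockTerm φ μ σ := by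
  simp only [blockKernel_mul_slaterDet]
  rw [integral_finsetSum _ fun σ _ => (integrable_blockKernel_mul hintg σ).const_mul _]
  refine Finset.sum_congr rfl fun σ _ => ?_
  rw [integral_const_mul, integral_blockKernel_mul_prod _ _ fun q => hφ (σ q), blockTerm]

/-- Skew-orthogonality of a family of functions indexed by pairs and unpaired indices. -/
structure IsSkewOrthogonal (φ : (β × Bool) ⊕ T → ℝ → ℝ) : Prop where
  measurable : ∀ j, Measurable (φ j)
  integrable : ∀ j, Integrable (φ j)
  pairing_eq_zero : ∀ j k, j ≠ k → k ≠ blockFlip j → skewPairing volume volume (φ j) (φ k) = 0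
  -- The quantifier over `T` makes this vacuous when no index is unpaired, as happens for an even
  -- number of points.
  integral_eq_zero : ∀ (_ : T) (q : β × Bool), ∫ u, φ (Sum.inl q) u = 0
  pairing_ne_zero : ∀ b, skewPairing volume volume (φ (Sum.inl (b, false)))
    (φ (Sum.inl (b, true))) ≠ 0
  integral_ne_zero : ∀ t, ∫ u, φ (Sum.inr t) u ≠ 0

/-- The diagonal of the kernel of a skew-orthogonal family. -/
noncomputable def skewDensity (φ : (β × Bool) ⊕ T → ℝ → ℝ) (x : ℝ) : ℝ :=
  (∑ b, (φ (Sum.inl (b, false)) x * (∫ v, Real.sign (v - x) * φ (Sum.inl (b, true)) v) -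
      φ (Sum.inl (b, true)) x * (∫ v, Real.sign (v - x) * φ (Sum.inl (b, false)) v)) /
      skewPairing volume volume (φ (Sum.inl (b, false))) (φ (Sum.inl (b, true)))) +
    ∑ t, φ (Sum.inr t) x / ∫ u, φ (Sum.inr t) u

namespace IsSkewOrthogonal

variable [Subsingleton T]

/-- If a permutation does not respect the pairs, then some factor away from `p` vanishes. -/
lemma blockTerm_eq_zero (h : IsSkewOrthogonal φ) (μ : (β × Bool) ⊕ T → Measure ℝ)
    (σ : Equiv.Perm ((β × Bool) ⊕ T)) (p : (β × Bool) ⊕ T)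
    (hμ : ∀ q, q ≠ p → μ q = volume) (hσ : ¬ ∀ q, σ (blockFlip q) = blockFlip (σ q)) :
    blockTerm φ μ σ = 0 := by
  -- The failure can be located away from the pair of `p`, where the coordinates carry Lebesgue
  -- measure and skew-orthogonality applies.
  have hex : ∃ q, q ≠ p ∧ q ≠ blockFlip p ∧ σ (blockFlip q) ≠ blockFlip (σ q) := by
    by_contra hcon
    push Not at hcon
    exact hσ (commute_blockFlip_of_forall_ne σ p hcon)
  obtain ⟨q, hqp, hqp', hq⟩ := hex
  have hqp'' : blockFlip q ≠ p := by
    rintro rfl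
    simp at hqp'
  unfold blockTerm
  rcases q with ⟨b, i⟩ | t
  · have h1 : μ (Sum.inl (b, false)) = volume ∧ μ (Sum.inl (b, true)) = volume := by
      cases i
      · exact ⟨hμ _ hqp, hμ _ hqp''⟩
      · exact ⟨hμ _ hqp'', hμ _ hqp⟩
    have h2 : σ (Sum.inl (b, true)) ≠ blockFlip (σ (Sum.inl (b, false))) := by
      cases i
      · exact hq
      · intro hcon
        apply hq
        rw [hcon, blockFlip_blockFlip]
        rfl
    have h3 : skewPairing (μ (Sum.inl (b, false))) (μ (Sum.inl (b, true)))
        (φ (σ (Sum.inl (b, false)))) (φ (σ (Sum.inl (b, true)))) = 0 := by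
      rw [h1.1, h1.2]
      exact h.pairing_eq_zero _ _ (fun hcon => by simpa using σ.injective hcon) h2
    rw [Finset.prod_eq_zero (Finset.mem_univ b) h3]
    simp
  · have h3 : ∫ u, φ (σ (Sum.inr t)) u ∂μ (Sum.inr t) = 0 := by
      rw [hμ _ hqp]
      rcases hσt : σ (Sum.inr t) with q | t'
      · exact h.integral_eq_zero t q
      · simp [hσt] at hq
    rw [Finset.prod_eq_zero (Finset.mem_univ t) h3]
    simp

/-- The value of the terms that do not vanish. -/
noncomputable def blockConst (φ : (β × Bool) ⊕ T → ℝ → ℝ) : ℝ :=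
  (∏ b, skewPairing volume volume (φ (Sum.inl (b, false))) (φ (Sum.inl (b, true)))) *
    ∏ t, ∫ u, φ (Sum.inr t) u

lemma blockConst_ne_zero (h : IsSkewOrthogonal φ) : blockConst φ ≠ 0 :=
  mul_ne_zero (Finset.prod_ne_zero_iff.mpr fun b _ => h.pairing_ne_zero b)
    (Finset.prod_ne_zero_iff.mpr fun t _ => h.integral_ne_zero t)

/-- Such a permutation only reorders the pairs and swaps members inside some of them. Each swap
reverses one antisymmetric factor, and the sign of `σ` undoes exactly these reversals. -/
lemma blockTerm_volume (σ : Equiv.Perm ((β × Bool) ⊕ T))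
    (hσ : ∀ q, σ (blockFlip q) = blockFlip (σ q)) :
    blockTerm φ (fun _ => volume) σ = blockConst φ := by
  obtain ⟨π, s, h1, h2, h3⟩ := exists_blockPerm σ hσ
  unfold blockTerm blockConst
  rw [← mul_assoc, sign_mul_prod_blocks σ π s h1 h3
    (fun _ j k => skewPairing volume volume (φ j) (φ k)) fun _ j k => skewPairing_antisymm _ _]
  simp only [h2]
  rw [Equiv.prod_comp π fun b =>
    skewPairing volume volume (φ (Sum.inl (b, false))) (φ (Sum.inl (b, true)))]

/-- Freezing a coordinate replaces exactly one factor of the constant product. The two members of a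
pair together give an antisymmetric numerator, and its ratio to the original factor does not see a
swap inside the pair; summing over all pairs then absorbs `π`. -/
lemma sum_blockTerm_frozen (h : IsSkewOrthogonal φ) (x : ℝ) (σ : Equiv.Perm ((β × Bool) ⊕ T))
    (hσ : ∀ q, σ (blockFlip q) = blockFlip (σ q)) :
    ∑ p, blockTerm φ (frozenMeasure p x) σ = blockConst φ * skewDensity φ x := by
  obtain ⟨π, s, h1, h2, h3⟩ := exists_blockPerm σ hσ
  set A : (β × Bool) ⊕ T → (β × Bool) ⊕ T → ℝ := fun j k => skewPairing volume volume (φ j) (φ k)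
    with hA
  set ψ : (β × Bool) ⊕ T → ℝ := fun j => ∫ v, Real.sign (v - x) * φ j v with hψ
  have hAanti : ∀ j k, A j k = -A k j := fun j k => skewPairing_antisymm _ _
  have hs : ∀ b, s b = 1 ∨ s b = Equiv.swap false true := by
    intro b
    generalize s b = e
    revert e
    decide
  have hAσ : ∀ b, A (σ (Sum.inl (b, false))) (σ (Sum.inl (b, true))) ≠ 0 := by
    intro b
    rw [h1, h1]
    rcases hs b with hb | hb
    · simpa [hb] using h.pairing_ne_zero (π b)
    · rw [hb, hAanti]
      simpa using h.pairing_ne_zero (π b)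
  have hvol := blockTerm_volume (φ := φ) σ hσ
  have hinl : ∀ b, ∑ i, blockTerm φ (frozenMeasure (Sum.inl (b, i)) x) σ = blockConst φ *
      ((φ (Sum.inl (π b, false)) x * ψ (Sum.inl (π b, true)) -
        φ (Sum.inl (π b, true)) x * ψ (Sum.inl (π b, false))) /
        A (Sum.inl (π b, false)) (Sum.inl (π b, true))) := by
    intro b
    have hX : ∀ i, blockTerm φ (frozenMeasure (Sum.inl (b, i)) x) σ = blockConst φ *
        ((if i then -(φ (σ (Sum.inl (b, true))) x * ψ (σ (Sum.inl (b, false)))) else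
          φ (σ (Sum.inl (b, false))) x * ψ (σ (Sum.inl (b, true)))) /
          A (σ (Sum.inl (b, false))) (σ (Sum.inl (b, true)))) := by
      intro i
      rw [← hvol]
      unfold blockTerm
      have hprod : ∏ c, skewPairing (frozenMeasure (Sum.inl (b, i) : (β × Bool) ⊕ T) x (Sum.inl (c, false)))
          (frozenMeasure (Sum.inl (b, i) : (β × Bool) ⊕ T) x (Sum.inl (c, true)))
          (φ (σ (Sum.inl (c, false)))) (φ (σ (Sum.inl (c, true)))) =
          ∏ c, (if c = b then
            (if i then -(φ (σ (Sum.inl (c, true))) x * ψ (σ (Sum.inl (c, false)))) else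
              φ (σ (Sum.inl (c, false))) x * ψ (σ (Sum.inl (c, true))))
            else A (σ (Sum.inl (c, false))) (σ (Sum.inl (c, true)))) := by
        refine Finset.prod_congr rfl fun c _ => ?_
        by_cases hc : c = b
        · subst hc
          cases i
          · simp only [frozenMeasure, if_true]
            simpa using skewPairing_dirac_left x (h.integrable _)
          · simp only [frozenMeasure, if_true]
            simpa using skewPairing_dirac_right x (h.integrable _)
        · simp [frozenMeasure, hc, hA]
      rw [hprod, Fintype.prod_ite_eq_mul_div (fun c => A (σ (Sum.inl (c, false)))
        (σ (Sum.inl (c, true)))) (fun c =>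
            (if i then -(φ (σ (Sum.inl (c, true))) x * ψ (σ (Sum.inl (c, false)))) else
              φ (σ (Sum.inl (c, false))) x * ψ (σ (Sum.inl (c, true))))) b (hAσ b)]
      simp [frozenMeasure, hA]
      ring
    simp only [hX]
    rw [Fintype.sum_bool, ← mul_add, ← add_div]
    congr 1
    simp only [if_true, Bool.false_eq_true, if_false]
    rw [h1, h1]
    rcases hs b with hb | hb
    · simp only [hb, Equiv.Perm.one_apply]
      ring
    · rw [hb, hAanti]
      simp only [Equiv.swap_apply_left, Equiv.swap_apply_right]
      rw [div_neg, ← neg_div]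
      ring
  have hinr : ∀ t, blockTerm φ (frozenMeasure (Sum.inr t) x) σ = blockConst φ *
      (φ (Sum.inr t) x / ∫ u, φ (Sum.inr t) u) := by
    intro t
    rw [← hvol]
    unfold blockTerm
    have hprod : ∏ t', ∫ u, φ (σ (Sum.inr t')) u ∂(frozenMeasure (Sum.inr t : (β × Bool) ⊕ T) x
        (Sum.inr t')) =
        ∏ t', (if t' = t then φ (Sum.inr t') x else ∫ u, φ (Sum.inr t') u) := by
      refine Finset.prod_congr rfl fun t' _ => ?_
      rw [h2]
      by_cases ht : t' = t
      · simp [frozenMeasure, ht]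
      · simp [frozenMeasure, ht]
    rw [hprod, Fintype.prod_ite_eq_mul_div (fun t' => ∫ u, φ (Sum.inr t') u)
      (fun t' => φ (Sum.inr t') x) t (h.integral_ne_zero t)]
    simp only [h2]
    simp [frozenMeasure]
    ring
  rw [Fintype.sum_sum_type, Fintype.sum_prod_type]
  simp only [hinl, hinr]
  rw [← Finset.mul_sum, ← Finset.mul_sum, ← mul_add, skewDensity]
  congr 2
  exact Equiv.sum_comp π fun b => (φ (Sum.inl (b, false)) x * ψ (Sum.inl (b, true)) -
        φ (Sum.inl (b, true)) x * ψ (Sum.inl (b, false))) /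
        A (Sum.inl (b, false)) (Sum.inl (b, true))

/-- All surviving terms are equal and nonzero and the identity is among them, so there is no
cancellation. -/
lemma integral_volume_ne_zero (h : IsSkewOrthogonal φ) :
    ∫ x, blockKernel x * slaterDet φ x ≠ 0 := by
  rw [volume_pi, integral_blockKernel_mul_slaterDet h.measurable fun j _ => h.integrable j]
  classical
  have h1 : ∀ σ, blockTerm φ (fun _ => volume) σ =
      if ∀ q, σ (blockFlip q) = blockFlip (σ q) then blockConst φ else 0 := by
    intro σ
    split_ifs with hσ
    · exact blockTerm_volume σ hσ
    · unfold blockTerm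
      by_contra hne
      -- With no indices every permutation respects the pairs vacuously. Otherwise any index can be
      -- the exempt one, since no coordinate is frozen.
      have : ¬ IsEmpty ((β × Bool) ⊕ T) := fun he => hσ fun q => he.elim q
      rw [not_isEmpty_iff] at this
      obtain ⟨p⟩ := this
      exact hne (h.blockTerm_eq_zero (fun _ => volume) σ p (fun _ _ => rfl) hσ)
  simp only [h1]
  rw [← Finset.sum_filter, Finset.sum_const, nsmul_eq_mul]
  refine mul_ne_zero (Nat.cast_ne_zero.mpr (Finset.card_pos.mpr ⟨1, by simp⟩).ne')
    h.blockConst_ne_zero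

/-- For each permutation respecting the pairs, the frozen terms sum to `skewDensity φ x` times the
unfrozen term; for every other permutation both sides vanish. The common ratio therefore passes to
the sum. -/
lemma sum_integral_frozen (h : IsSkewOrthogonal φ) (x : ℝ) :
    ∑ p : (β × Bool) ⊕ T, ∫ z, blockKernel z * slaterDet φ z ∂Measure.pi (frozenMeasure p x) =
      skewDensity φ x * ∫ z, blockKernel z * slaterDet φ z := by
  have hintg : ∀ (p : (β × Bool) ⊕ T) j q, Integrable (φ j) (frozenMeasure p x q) := by
    intro p j q
    unfold frozenMeasure
    split_ifs
    · exact integrable_dirac (by simp)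
    · exact h.integrable j
  rw [volume_pi, integral_blockKernel_mul_slaterDet h.measurable fun j _ => h.integrable j]
  simp only [integral_blockKernel_mul_slaterDet h.measurable (hintg _)]
  rw [Finset.sum_comm, Finset.mul_sum]
  refine Finset.sum_congr rfl fun σ _ => ?_
  by_cases hσ : ∀ q, σ (blockFlip q) = blockFlip (σ q)
  · rw [h.sum_blockTerm_frozen x σ hσ, blockTerm_volume σ hσ, mul_comm]
  · have hne : ∀ p, blockTerm φ (frozenMeasure p x) σ = 0 := fun p =>
      h.blockTerm_eq_zero _ σ p (fun q hq => by simp [frozenMeasure, hq]) hσ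
    have hne' : ∀ p : (β × Bool) ⊕ T, blockTerm φ (fun _ => volume) σ = 0 := fun p =>
      h.blockTerm_eq_zero _ σ p (fun q hq => rfl) hσ
    push Not at hσ
    obtain ⟨p, -⟩ := hσ
    simp [hne, hne' p]

end IsSkewOrthogonal

end BlockExpansion

/-! ### From the joint density to the skew kernel -/

section LoeDensity

lemma measurable_loeWeight (a : ℝ) : Measurable (loeWeight a) := by
  unfold loeWeight
  exact Measurable.ite measurableSet_Ioi (by fun_prop) measurable_const

lemma measurable_loeJoint (a : ℝ) {N : ℕ} :
    Measurable fun x : Fin N → ℝ => loeJoint a x := by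
  unfold loeJoint
  refine Measurable.mul ?_ ?_
  · exact Finset.measurable_prod _ fun i _ => (measurable_loeWeight a).comp (measurable_pi_apply i)
  · exact Finset.measurable_prod _ fun i _ => Finset.measurable_prod _ fun j _ =>
      ((measurable_pi_apply j).sub (measurable_pi_apply i)).abs

/-- A Dirac mass in the first coordinate writes the marginal as an integral over all coordinates
against a product measure, the form required by the block expansion. -/
lemma integral_loeJoint_cons (a x : ℝ) (n : ℕ) :
    ∫ z : Fin n → ℝ, loeJoint a (Fin.cons x z : Fin (n + 1) → ℝ) =
      ∫ y : Fin (n + 1) → ℝ, loeJoint a y ∂Measure.pi (frozenMeasure 0 x) := by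
  have h0 : frozenMeasure (0 : Fin (n + 1)) x 0 = Measure.dirac x := by simp [frozenMeasure]
  have hs : (fun j : Fin n => frozenMeasure (0 : Fin (n + 1)) x (Fin.succAbove 0 j)) =
      fun _ => volume := by
    ext1 j
    simp [frozenMeasure, Fin.succ_ne_zero]
  rw [← ((measurePreserving_piFinSuccAbove (frozenMeasure (0 : Fin (n + 1)) x) 0).symm).integral_comp',
    h0, hs, Measure.dirac_prod, integral_map (by fun_prop), volume_pi]
  · refine integral_congr_ae (ae_of_all _ fun z => ?_)
    simp [MeasurableEquiv.piFinSuccAbove_symm_apply, Fin.insertNthEquiv]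
  · exact ((measurable_loeJoint a).comp (MeasurableEquiv.measurable _)).aestronglyMeasurable

variable {β T : Type*} [Fintype β] [DecidableEq β] [Fintype T] [DecidableEq T] [Subsingleton T]

/-- The one-point density in terms of any skew-orthogonal basis of weighted polynomials. -/
theorem loeDensity_eq_skewDensity {a : ℝ} {n : ℕ} (e : (β × Bool) ⊕ T ≃ Fin (n + 1))
    (p : (β × Bool) ⊕ T → ℝ[X]) (hp : ∀ j, (p j).natDegree < n + 1)
    (h : IsSkewOrthogonal fun j u => loeWeight a u * (p j).eval u) (x : ℝ) :
    loeDensity a (n + 1) x = skewDensity (fun j u => loeWeight a u * (p j).eval u) x := by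
  set φ : (β × Bool) ⊕ T → ℝ → ℝ := fun j u => loeWeight a u * (p j).eval u with hφ
  set G : ((β × Bool) ⊕ T → ℝ) → ℝ := fun z => (∏ i, loeWeight a (z i)) * |vandermondeDet e z|
    with hG
  have hGjoint : ∀ y : Fin (n + 1) → ℝ, loeJoint a y = G (y ∘ e) := by
    intro y
    simp only [hG, loeJoint, vandermondeDet_eq_prod, Finset.abs_prod]
    rw [← e.prod_comp]
    simp
  have hGperm : ∀ z (τ : Equiv.Perm ((β × Bool) ⊕ T)), G (z ∘ τ) = G z := by
    intro z τ
    simp only [hG, abs_vandermondeDet_comp_perm]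
    congr 1
    exact Equiv.prod_comp τ fun i => loeWeight a (z i)
  obtain ⟨c, hc⟩ := exists_sum_blockKernel_mul_slaterDet e (loeWeight a) p hp
  -- Integrating the symmetrisation identity moves each permutation from the integrand onto the
  -- measure. This one formula is used both for Lebesgue measure and for the frozen measures.
  have hintg : ∀ (μ : (β × Bool) ⊕ T → Measure ℝ) [∀ q, SigmaFinite (μ q)],
      (∀ j q, Integrable (φ j) (μ q)) →
      c * ∫ z, G z ∂Measure.pi μ = ∑ τ : Equiv.Perm ((β × Bool) ⊕ T),
        ∫ z, blockKernel z * slaterDet φ z ∂Measure.pi fun q => μ (τ q) := by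
    intro μ _ hμ
    rw [← integral_const_mul]
    simp only [hG, ← hc]
    have hi : ∀ τ : Equiv.Perm ((β × Bool) ⊕ T), Integrable
        (fun z => blockKernel (z ∘ τ) * slaterDet φ (z ∘ τ)) (Measure.pi μ) := by
      intro τ
      have h1 : Integrable (fun z => blockKernel z * slaterDet φ z) (Measure.pi fun q => μ (τ q)) :=
        integrable_blockKernel_mul_slaterDet fun j q => hμ j (τ q)
      have h2 := (measurePreserving_piCongrLeft μ τ).symm.integrable_comp_emb
        (MeasurableEquiv.measurableEmbedding _) (g := fun z => blockKernel z * slaterDet φ z)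
      have h3 := h2.mpr h1
      refine h3.congr (ae_of_all _ fun z => ?_)
      rfl
    rw [integral_finsetSum _ fun τ _ => hi τ]
    refine Finset.sum_congr rfl fun τ _ => ?_
    exact integral_comp_equiv μ τ fun z => blockKernel z * slaterDet φ z
  have hZ : loeZ a (n + 1) = ∫ z, G z := by
    unfold loeZ
    simp only [hGjoint, volume_pi]
    exact integral_comp_equiv (fun _ => volume) e G
  -- By symmetry of `G` the marginal is the same whichever coordinate is frozen.
  have hM : ∀ q, ∫ z, G z ∂Measure.pi (frozenMeasure q x) =
      ∫ z : Fin n → ℝ, loeJoint a (Fin.cons x z : Fin (n + 1) → ℝ) := by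
    intro q
    rw [integral_loeJoint_cons]
    simp only [hGjoint]
    rw [integral_comp_equiv _ e G]
    have h1 : (fun r => frozenMeasure (0 : Fin (n + 1)) x (e r)) = frozenMeasure (e.symm 0) x := by
      ext1 r
      simp [frozenMeasure, Equiv.eq_symm_apply]
    rw [h1]
    have h2 := integral_comp_equiv (frozenMeasure (e.symm 0) x) (Equiv.swap q (e.symm 0)) G
    simp only [hGperm] at h2
    rw [h2]
    congr 2
    ext1 r
    rw [frozenMeasure_perm]
    simp
  set S := ∫ z, blockKernel z * slaterDet φ z with hS
  have hS0 : S ≠ 0 := h.integral_volume_ne_zero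
  set F : ℝ := (Fintype.card (Equiv.Perm ((β × Bool) ⊕ T)) : ℝ) with hF
  have hF0 : F ≠ 0 := Nat.cast_ne_zero.mpr Fintype.card_ne_zero
  have e1 : c * loeZ a (n + 1) = F * S := by
    rw [hZ, volume_pi, hintg (fun _ => volume) fun j _ => h.integrable j]
    simp [hF, hS, volume_pi]
  -- The factor `n + 1` in the one-point density counts the coordinates, turning the marginal into
  -- the sum over frozen coordinates.
  have e2 : c * (((n : ℝ) + 1) *
      ∫ z : Fin n → ℝ, loeJoint a (Fin.cons x z : Fin (n + 1) → ℝ)) = F * (skewDensity φ x * S) := by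
    have hcard : ((n : ℝ) + 1) * ∫ z : Fin n → ℝ, loeJoint a (Fin.cons x z : Fin (n + 1) → ℝ) =
        ∑ q : (β × Bool) ⊕ T, ∫ z, G z ∂Measure.pi (frozenMeasure q x) := by
      simp only [hM, Finset.sum_const, Finset.card_univ, Fintype.card_congr e, Fintype.card_fin,
        nsmul_eq_mul]
      push_cast
      ring
    have hi : ∀ (q : (β × Bool) ⊕ T) j r, Integrable (φ j) (frozenMeasure q x r) := by
      intro q j r
      unfold frozenMeasure
      split_ifs
      · exact integrable_dirac (by simp)
      · exact h.integrable j
    rw [hcard, Finset.mul_sum]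
    simp only [hintg _ (hi _), frozenMeasure_perm]
    rw [Finset.sum_comm]
    have h1 : ∀ τ : Equiv.Perm ((β × Bool) ⊕ T), ∑ q : (β × Bool) ⊕ T,
        ∫ z, blockKernel z * slaterDet φ z ∂Measure.pi (fun r => frozenMeasure (τ.symm q) x r) =
        skewDensity φ x * S := by
      intro τ
      rw [Equiv.sum_comp τ.symm fun q =>
        ∫ z, blockKernel z * slaterDet φ z ∂Measure.pi (fun r => frozenMeasure q x r)]
      exact h.sum_integral_frozen x
    simp only [h1, Finset.sum_const, Finset.card_univ, nsmul_eq_mul, hF]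
  -- The nonvanishing of the symmetrisation constant and of the partition function both come from
  -- the nonzero integral `S`.
  have hc0 : c ≠ 0 := by
    rintro rfl
    rw [zero_mul] at e1
    exact mul_ne_zero hF0 hS0 e1.symm
  have hZ0 : loeZ a (n + 1) ≠ 0 := by
    intro h0
    rw [h0, mul_zero] at e1
    exact mul_ne_zero hF0 hS0 e1.symm
  have e3 : ((n : ℝ) + 1) * (∫ z : Fin n → ℝ, loeJoint a (Fin.cons x z : Fin (n + 1) → ℝ)) =
      skewDensity φ x * loeZ a (n + 1) := by
    apply mul_left_cancel₀ hc0
    rw [e2]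
    linear_combination (-skewDensity φ x) * e1
  rw [loeDensity, ← mul_div_assoc, e3, mul_div_assoc, div_self hZ0, mul_one]

end LoeDensity

/-! ### Laguerre polynomials in the variable 2x and their ladder relations -/

section LaguerrePolynomials

/-- Coefficients of the Laguerre polynomial with parameter `a` in the variable `2 x`. -/
noncomputable def laguerreCoeff (a : ℝ) (k j : ℕ) : ℝ :=
  (-2) ^ j * (Real.Gamma (k + a + 1) / k.factorial) * k.choose j / Real.Gamma (j + a + 1)

/-- The Laguerre polynomial with parameter `a` in the variable `2 x`. -/
noncomputable def laguerrePoly (a : ℝ) (k : ℕ) : ℝ[X] :=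
  ∑ j ∈ Finset.range (k + 1), monomial j (laguerreCoeff a k j)

lemma laguerrePoly_coeff (a : ℝ) (k j : ℕ) :
    (laguerrePoly a k).coeff j = laguerreCoeff a k j := by
  simp only [laguerrePoly, finsetSum_coeff, coeff_monomial]
  rw [Finset.sum_ite_eq' (Finset.range (k + 1)) j]
  split_ifs with h
  · rfl
  · rw [Finset.mem_range, not_lt] at h
    simp [laguerreCoeff, Nat.choose_eq_zero_of_lt (show k < j by omega)]

lemma natDegree_laguerrePoly_le (a : ℝ) (k : ℕ) : (laguerrePoly a k).natDegree ≤ k := by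
  refine natDegree_sum_le_of_forall_le _ _ fun j hj => (natDegree_monomial_le _).trans ?_
  rw [Finset.mem_range] at hj
  omega

variable {a : ℝ}

lemma Gamma_nat_add_ne_zero (ha : -1 < a) (j : ℕ) : Real.Gamma (j + a + 1) ≠ 0 :=
  (Real.Gamma_pos_of_pos (by have : (0 : ℝ) ≤ j := j.cast_nonneg; linarith)).ne'

lemma Gamma_nat_succ_add (ha : -1 < a) (j : ℕ) :
    Real.Gamma ((j + 1 : ℕ) + a + 1) = (j + a + 1) * Real.Gamma (j + a + 1) := by
  have h : (j : ℝ) + a + 1 ≠ 0 := by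
    have : (0 : ℝ) ≤ j := j.cast_nonneg
    linarith
  rw [← Real.Gamma_add_one h]
  push_cast
  ring_nf

lemma laguerrePoly_zero (ha : -1 < a) : laguerrePoly a 0 = 1 := by
  have h := Gamma_nat_add_ne_zero ha 0
  simp only [Nat.cast_zero] at h
  rw [zero_add] at h
  simp [laguerrePoly, laguerreCoeff, div_self h]

/-- Lowering relation. -/
lemma laguerrePoly_lower (ha : -1 < a) (k : ℕ) :
    X * derivative (laguerrePoly a (k + 1)) =
      C ((k : ℝ) + 1) * laguerrePoly a (k + 1) - C ((k : ℝ) + 1 + a) * laguerrePoly a k := by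
  have hk := Gamma_nat_succ_add ha k
  have hf : ((k + 1).factorial : ℝ) = (k + 1) * k.factorial := by push_cast [Nat.factorial_succ]; ring
  have hf0 : (k.factorial : ℝ) ≠ 0 := Nat.cast_ne_zero.mpr k.factorial_ne_zero
  have hk0 : (k : ℝ) + 1 ≠ 0 := by positivity
  ext j
  rcases j with _ | j
  · simp only [mul_coeff_zero, coeff_X_zero, zero_mul, coeff_sub, laguerrePoly_coeff,
      laguerreCoeff, coeff_C_zero]
    rw [hk, hf]
    simp only [Nat.choose_zero_right]
    field_simp
    ring
  · have hj := Gamma_nat_add_ne_zero ha (j + 1)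
    have hch : ((k + 1).choose (j + 1) : ℝ) * ((k : ℝ) - j) = (k + 1) * k.choose (j + 1) := by
      by_cases hjk : j ≤ k
      · have h1 := Nat.choose_mul_succ_eq k (j + 1)
        have h2 : k + 1 - (j + 1) = k - j := by omega
        rw [h2] at h1
        have h3 : ((k - j : ℕ) : ℝ) = (k : ℝ) - j := Nat.cast_sub hjk
        rw [← h3]
        have h4 : (k.choose (j + 1) : ℝ) * ((k + 1 : ℕ) : ℝ) =
          ((k + 1).choose (j + 1) : ℝ) * ((k - j : ℕ) : ℝ) := by exact_mod_cast h1
        rw [← h4]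
        push_cast
        ring
      · rw [Nat.choose_eq_zero_of_lt (by omega), Nat.choose_eq_zero_of_lt (by omega)]
        simp
    simp only [coeff_X_mul, coeff_derivative, coeff_sub, coeff_C_mul, laguerrePoly_coeff,
      laguerreCoeff]
    rw [hk, hf]
    field_simp
    linear_combination (-((k : ℝ) + a + 1) * Real.Gamma (k + a + 1)) * hch

/-- Raising relation. -/
lemma laguerrePoly_raise (ha : -1 < a) (k : ℕ) :
    C ((k : ℝ) + 1) * laguerrePoly a (k + 1) = X * derivative (laguerrePoly a k) +
      (C ((k : ℝ) + a + 1) - 2 * X) * laguerrePoly a k := by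
  have hk := Gamma_nat_succ_add ha k
  have hf : ((k + 1).factorial : ℝ) = (k + 1) * k.factorial := by push_cast [Nat.factorial_succ]; ring
  have hf0 : (k.factorial : ℝ) ≠ 0 := Nat.cast_ne_zero.mpr k.factorial_ne_zero
  have hk0 : (k : ℝ) + 1 ≠ 0 := by positivity
  have h2X : (2 : ℝ[X]) * X = X * C 2 := by rw [mul_comm]; rfl
  ext j
  rw [sub_mul, h2X, mul_assoc]
  rcases j with _ | j
  · simp only [mul_coeff_zero, coeff_X_zero, zero_mul, coeff_sub, coeff_add,
      laguerrePoly_coeff, laguerreCoeff]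
    rw [hk, hf]
    simp only [Nat.choose_zero_right, coeff_C_zero]
    field_simp
    simp
  · have hj := Gamma_nat_add_ne_zero ha (j + 1)
    have hj' := Gamma_nat_add_ne_zero ha j
    have hjs := Gamma_nat_succ_add ha j
    have hj1 : (j : ℝ) + a + 1 ≠ 0 := by
      have : (0 : ℝ) ≤ j := j.cast_nonneg
      linarith
    have hch : ((j : ℝ) + 1) * k.choose (j + 1) = k.choose j * ((k : ℝ) - j) := by
      by_cases hjk : j ≤ k
      · have h1 := Nat.choose_succ_right_eq k j
        have h3 : ((k - j : ℕ) : ℝ) = (k : ℝ) - j := Nat.cast_sub hjk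
        rw [← h3]
        have h4 : (k.choose (j + 1) : ℝ) * ((j + 1 : ℕ) : ℝ) =
          (k.choose j : ℝ) * ((k - j : ℕ) : ℝ) := by exact_mod_cast h1
        rw [← h4]
        push_cast
        ring
      · rw [Nat.choose_eq_zero_of_lt (by omega), Nat.choose_eq_zero_of_lt (by omega)]
        simp
    have hp : ((k + 1).choose (j + 1) : ℝ) = k.choose j + k.choose (j + 1) := by
      exact_mod_cast Nat.choose_succ_succ k j
    simp only [coeff_X_mul, coeff_derivative, coeff_sub, coeff_add, coeff_C_mul,
      laguerrePoly_coeff, laguerreCoeff]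
    rw [hk, hf, hp, hjs]
    field_simp
    linear_combination (2 * (-2) ^ j * Real.Gamma (k + a + 1)) * hch

end LaguerrePolynomials

/-! ### Weighted polynomials, exact derivatives and the two bilinear forms -/

section WeightedIntegrals

variable {a : ℝ}

lemma loeWeight_of_pos {u : ℝ} (hu : 0 < u) :
    loeWeight a u = u ^ ((a - 1) / 2) * Real.exp (-u) := if_pos hu

lemma loeWeight_of_nonpos {u : ℝ} (hu : u ≤ 0) : loeWeight a u = 0 := if_neg hu.not_gt

lemma integrable_loeWeight_mul (ha : -1 < a) (p : ℝ[X]) :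
    Integrable fun u => loeWeight a u * p.eval u := by
  induction p using Polynomial.induction_on' with
  | add p q hp hq =>
    simp only [eval_add, mul_add]
    exact hp.add hq
  | monomial j c =>
    have hs : 0 < (a + 1) / 2 + j := by
      have : (0 : ℝ) ≤ j := j.cast_nonneg
      linarith
    have h := (Real.GammaIntegral_convergent hs).mul_const c
    refine ((integrable_indicator_iff measurableSet_Ioi).mpr h).congr (ae_of_all _ fun u => ?_)
    simp only
    rw [Set.indicator_apply]
    split_ifs with hu
    · have hu : 0 < u := hu
      rw [loeWeight_of_pos hu, eval_monomial,
        show (a + 1) / 2 + j - 1 = (a - 1) / 2 + j by ring, Real.rpow_add hu, Real.rpow_natCast]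
      ring
    · rw [loeWeight_of_nonpos (not_lt.mp hu), zero_mul]

/-- This is where the parameter `a` and the variable 2x come from: the skew product of an exact
derivative leads to the weight x w², not to w. -/
lemma mul_sq_loeWeight {u : ℝ} (hu : 0 < u) :
    u * loeWeight a u ^ 2 = u ^ a * Real.exp (-(2 * u)) := by
  rw [loeWeight_of_pos hu, mul_pow, ← Real.rpow_natCast, ← Real.rpow_mul hu.le, ← Real.exp_nat_mul]
  rw [← mul_assoc, mul_comm u, ← Real.rpow_add_one hu.ne']
  push_cast
  ring_nf

lemma integrable_mul_sq_loeWeight_mul (ha : -1 < a) (p : ℝ[X]) :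
    Integrable fun u => u * loeWeight a u ^ 2 * p.eval u := by
  induction p using Polynomial.induction_on' with
  | add p q hp hq =>
    simp only [eval_add, mul_add]
    exact hp.add hq
  | monomial j c =>
    have hs : -1 < a + j := by
      have : (0 : ℝ) ≤ j := j.cast_nonneg
      linarith
    have h := (integrableOn_rpow_mul_exp_neg_mul_rpow hs one_pos two_pos).mul_const c
    refine ((integrable_indicator_iff measurableSet_Ioi).mpr h).congr (ae_of_all _ fun u => ?_)
    simp only
    rw [Set.indicator_apply]
    split_ifs with hu
    · have hu : 0 < u := hu
      rw [mul_sq_loeWeight hu, eval_monomial, Real.rpow_add hu, Real.rpow_natCast, Real.rpow_one]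
      ring_nf
    · rw [loeWeight_of_nonpos (not_lt.mp hu)]
      simp

/-- The operator `f ↦ x f' + ((a + 1) / 2 - x) f`, conjugate to differentiation. -/
noncomputable def skewOp (a : ℝ) (f : ℝ[X]) : ℝ[X] :=
  X * derivative f + (C ((a + 1) / 2) - X) * f

/-- The function `x w f`. -/
noncomputable def weightFlux (a : ℝ) (f : ℝ[X]) (u : ℝ) : ℝ :=
  u ^ ((a + 1) / 2) * Real.exp (-u) * f.eval u

lemma weightFlux_of_pos (f : ℝ[X]) {u : ℝ} (hu : 0 < u) :
    weightFlux a f u = u * loeWeight a u * f.eval u := by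
  rw [weightFlux, loeWeight_of_pos hu, show (a + 1) / 2 = (a - 1) / 2 + 1 by ring,
    Real.rpow_add_one hu.ne']
  ring

/-- The exponent (a+1)/2 is positive, so no boundary term arises at the origin even when the weight
itself is singular there. -/
lemma weightFlux_zero (ha : -1 < a) (f : ℝ[X]) : weightFlux a f 0 = 0 := by
  rw [weightFlux, Real.zero_rpow (by linarith), zero_mul, zero_mul]

lemma continuous_weightFlux (ha : -1 < a) (f : ℝ[X]) : Continuous (weightFlux a f) := by
  unfold weightFlux
  have : 0 ≤ (a + 1) / 2 := by linarith
  have h := Real.continuous_rpow_const this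
  fun_prop

/-- Since x w'/w = (a-1)/2 - x, the product rule for x w f gives w times `skewOp`; this determines
the coefficients of `skewOp`. -/
lemma hasDerivAt_weightFlux (f : ℝ[X]) {u : ℝ} (hu : 0 < u) :
    HasDerivAt (weightFlux a f) (loeWeight a u * (skewOp a f).eval u) u := by
  have h1 := Real.hasDerivAt_rpow_const (x := u) (p := (a + 1) / 2) (Or.inl hu.ne')
  have h2 : HasDerivAt (fun v : ℝ => Real.exp (-v)) (-Real.exp (-u)) u := by
    simpa using (hasDerivAt_neg u).exp
  have h := (h1.mul h2).mul (f.hasDerivAt u)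
  refine HasDerivAt.congr_deriv h ?_
  rw [loeWeight_of_pos hu, skewOp, Pi.mul_apply,
    show (a + 1) / 2 - 1 = (a - 1) / 2 by ring, show (a + 1) / 2 = (a - 1) / 2 + 1 by ring,
    Real.rpow_add_one hu.ne']
  simp only [eval_add, eval_mul, eval_X, eval_sub, eval_C]
  ring

/-- The flux and its derivative are both integrable at infinity, hence the flux tends to zero and
only the lower endpoint contributes. -/
lemma integral_Ioi_skewOp (ha : -1 < a) (f : ℝ[X]) {x : ℝ} (hx : 0 ≤ x) :
    ∫ u in Set.Ioi x, loeWeight a u * (skewOp a f).eval u = -weightFlux a f x := by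
  have hd : ∀ u ∈ Set.Ioi x, HasDerivAt (weightFlux a f)
      (loeWeight a u * (skewOp a f).eval u) u :=
    fun u hu => hasDerivAt_weightFlux f (hx.trans_lt hu)
  have hi := (integrable_loeWeight_mul ha (skewOp a f)).integrableOn (s := Set.Ioi x)
  have hF : IntegrableOn (weightFlux a f) (Set.Ioi x) := by
    refine ((integrable_loeWeight_mul ha (X * f)).integrableOn (s := Set.Ioi x)).congr_fun
      (fun u hu => ?_) measurableSet_Ioi
    simp only
    rw [weightFlux_of_pos f (hx.trans_lt hu), eval_mul, eval_X]
    ring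
  rw [integral_Ioi_of_hasDerivAt_of_tendsto (continuous_weightFlux ha f).continuousWithinAt hd hi
    (tendsto_zero_of_hasDerivAt_of_integrableOn_Ioi hd hi hF), zero_sub]

lemma integral_loeWeight_mul_eq (p : ℝ[X]) :
    ∫ u, loeWeight a u * p.eval u = ∫ u in Set.Ioi 0, loeWeight a u * p.eval u := by
  rw [← integral_indicator measurableSet_Ioi]
  refine integral_congr_ae (ae_of_all _ fun u => ?_)
  simp only
  rw [Set.indicator_apply]
  split_ifs with hu
  · rfl
  · rw [loeWeight_of_nonpos (not_lt.mp hu), zero_mul]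

lemma integral_skewOp (ha : -1 < a) (f : ℝ[X]) :
    ∫ u, loeWeight a u * (skewOp a f).eval u = 0 := by
  rw [integral_loeWeight_mul_eq, integral_Ioi_skewOp ha f le_rfl, weightFlux_zero ha, neg_zero]

/-- The integral of a weighted polynomial up to `x`. -/
noncomputable def lowerIntegral (a : ℝ) (p : ℝ[X]) (x : ℝ) : ℝ :=
  ∫ v in Set.Iic x, loeWeight a v * p.eval v

/-- The convolution of a weighted polynomial with the sign function. -/
noncomputable def signTransform (a : ℝ) (p : ℝ[X]) (x : ℝ) : ℝ :=
  ∫ v, Real.sign (v - x) * (loeWeight a v * p.eval v)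

lemma signTransform_eq (ha : -1 < a) (p : ℝ[X]) (x : ℝ) :
    signTransform a p x = (∫ u, loeWeight a u * p.eval u) - 2 * lowerIntegral a p x := by
  have hi := integrable_loeWeight_mul ha p
  rw [lowerIntegral, ← integral_indicator measurableSet_Iic, ← integral_const_mul,
    ← integral_sub hi ((hi.indicator measurableSet_Iic).const_mul 2), signTransform]
  refine integral_congr_ae ?_
  have hne : ∀ᵐ v : ℝ, v ≠ x := by simp [ae_iff]
  filter_upwards [hne] with v hv
  rw [Set.indicator_apply]
  rcases lt_or_gt_of_ne hv with h | h
  · rw [if_pos (Set.mem_Iic.mpr h.le), Real.sign_of_neg (by linarith)]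
    ring
  · rw [if_neg (by simpa using h), Real.sign_of_pos (by linarith)]
    ring

lemma lowerIntegral_skewOp (ha : -1 < a) (f : ℝ[X]) {x : ℝ} (hx : 0 ≤ x) :
    lowerIntegral a (skewOp a f) x = weightFlux a f x := by
  have h1 := integral_add_compl (measurableSet_Iic (a := x))
    (integrable_loeWeight_mul ha (skewOp a f))
  rw [Set.compl_Iic, integral_skewOp ha, integral_Ioi_skewOp ha f hx] at h1
  rw [lowerIntegral]
  linarith

lemma signTransform_skewOp (ha : -1 < a) (f : ℝ[X]) {x : ℝ} (hx : 0 ≤ x) :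
    signTransform a (skewOp a f) x = -(2 * weightFlux a f x) := by
  rw [signTransform_eq ha, integral_skewOp ha, lowerIntegral_skewOp ha f hx, zero_sub]

lemma lowerIntegral_add (ha : -1 < a) (p q : ℝ[X]) (x : ℝ) :
    lowerIntegral a (p + q) x = lowerIntegral a p x + lowerIntegral a q x := by
  simp only [lowerIntegral, eval_add, mul_add]
  exact integral_add (integrable_loeWeight_mul ha p).integrableOn
    (integrable_loeWeight_mul ha q).integrableOn

lemma lowerIntegral_C_mul (c : ℝ) (p : ℝ[X]) (x : ℝ) :
    lowerIntegral a (C c * p) x = c * lowerIntegral a p x := by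
  simp only [lowerIntegral]
  rw [← integral_const_mul]
  refine integral_congr_ae (ae_of_all _ fun u => ?_)
  simp only [eval_mul, eval_C]
  ring

/-- The skew product of two polynomials. -/
noncomputable def skewProd (a : ℝ) (p q : ℝ[X]) : ℝ :=
  skewPairing volume volume (fun u => loeWeight a u * p.eval u) fun u => loeWeight a u * q.eval u

/-- The inner product of two polynomials for the weight `x ^ a * exp (-2 x)`. -/
noncomputable def laguerreInner (a : ℝ) (p q : ℝ[X]) : ℝ :=
  ∫ u, u * loeWeight a u ^ 2 * (p * q).eval u

lemma skewProd_antisymm (p q : ℝ[X]) : skewProd a p q = -skewProd a q p :=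
  skewPairing_antisymm _ _

lemma skewProd_self (p : ℝ[X]) : skewProd a p p = 0 := by
  have := skewProd_antisymm (a := a) p p
  linarith

lemma skewProd_add_left (ha : -1 < a) (p q r : ℝ[X]) :
    skewProd a (p + q) r = skewProd a p r + skewProd a q r := by
  simp only [skewProd, skewPairing]
  rw [← integral_add
    (integrable_sign_mul (integrable_loeWeight_mul ha p) (integrable_loeWeight_mul ha r))
    (integrable_sign_mul (integrable_loeWeight_mul ha q) (integrable_loeWeight_mul ha r))]
  refine integral_congr_ae (ae_of_all _ fun u => ?_)
  simp only [eval_add]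
  ring

lemma skewProd_C_mul_left (c : ℝ) (p r : ℝ[X]) :
    skewProd a (C c * p) r = c * skewProd a p r := by
  simp only [skewProd, skewPairing]
  rw [← integral_const_mul]
  refine integral_congr_ae (ae_of_all _ fun u => ?_)
  simp only [eval_mul, eval_C]
  ring

/-- The sign transform of an exact derivative is local: it is minus twice the flux. Multiplying by
the other weighted polynomial gives the weight x w², so skew products reduce to a symmetric inner
product. -/
lemma skewProd_skewOp_left (ha : -1 < a) (f g : ℝ[X]) :
    skewProd a (skewOp a f) g = 2 * laguerreInner a f g := by
  rw [skewProd_antisymm, skewProd, skewPairing_eq_integral (integrable_loeWeight_mul ha g)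
    (integrable_loeWeight_mul ha _), ← integral_neg, laguerreInner, ← integral_const_mul]
  refine integral_congr_ae (ae_of_all _ fun u => ?_)
  simp only
  rcases le_or_gt u 0 with hu | hu
  · simp [loeWeight_of_nonpos hu]
  · have h := signTransform_skewOp ha f hu.le
    rw [signTransform] at h
    rw [h, weightFlux_of_pos f hu, eval_mul]
    ring

lemma laguerreInner_comm (p q : ℝ[X]) : laguerreInner a p q = laguerreInner a q p := by
  rw [laguerreInner, mul_comm p q, laguerreInner]

lemma laguerreInner_add_left (ha : -1 < a) (p q r : ℝ[X]) :
    laguerreInner a (p + q) r = laguerreInner a p r + laguerreInner a q r := by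
  simp only [laguerreInner, add_mul, eval_add, mul_add]
  exact integral_add (integrable_mul_sq_loeWeight_mul ha _) (integrable_mul_sq_loeWeight_mul ha _)

lemma laguerreInner_C_mul_left (c : ℝ) (p r : ℝ[X]) :
    laguerreInner a (C c * p) r = c * laguerreInner a p r := by
  simp only [laguerreInner]
  rw [← integral_const_mul]
  refine integral_congr_ae (ae_of_all _ fun u => ?_)
  simp only [eval_mul, eval_C]
  ring

lemma laguerreInner_X_mul_left (p r : ℝ[X]) :
    laguerreInner a (X * p) r = laguerreInner a p (X * r) := by
  simp only [laguerreInner]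
  refine integral_congr_ae (ae_of_all _ fun u => ?_)
  simp only [eval_mul, eval_X]
  ring

/-- Evaluate the skew product of D f and D g by removing D from either argument; antisymmetry of the
skew product becomes antisymmetry of D for the inner product, with no further integration by parts.
-/
lemma laguerreInner_skewOp_left (ha : -1 < a) (f g : ℝ[X]) :
    laguerreInner a (skewOp a f) g = -laguerreInner a f (skewOp a g) := by
  have h1 := skewProd_skewOp_left ha f (skewOp a g)
  have h2 := skewProd_skewOp_left ha g (skewOp a f)
  rw [skewProd_antisymm, h2, laguerreInner_comm g] at h1
  linarith

end WeightedIntegrals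

/-! ### Orthogonality and skew-orthogonality of Laguerre polynomials -/

section LaguerreOrthogonality

variable {a : ℝ}

/-- The squared norm of the Laguerre polynomial in the variable `2 x`. -/
noncomputable def laguerreNorm (a : ℝ) (k : ℕ) : ℝ :=
  Real.Gamma (k + a + 1) / (k.factorial * 2 ^ (a + 1))

lemma laguerreNorm_pos (ha : -1 < a) (k : ℕ) : 0 < laguerreNorm a k := by
  have : (0 : ℝ) ≤ k := k.cast_nonneg
  have h1 : 0 < Real.Gamma (k + a + 1) := Real.Gamma_pos_of_pos (by linarith)
  unfold laguerreNorm
  positivity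

lemma laguerreNorm_succ (ha : -1 < a) (k : ℕ) :
    ((k : ℝ) + 1) * laguerreNorm a (k + 1) = (k + 1 + a) * laguerreNorm a k := by
  have h2 : (0 : ℝ) < 2 ^ (a + 1) := by positivity
  have hf0 : (k.factorial : ℝ) ≠ 0 := Nat.cast_ne_zero.mpr k.factorial_ne_zero
  have hk0 : (k : ℝ) + 1 ≠ 0 := by positivity
  rw [laguerreNorm, laguerreNorm, Gamma_nat_succ_add ha, Nat.factorial_succ]
  push_cast
  field_simp
  ring

/-- The lowered Laguerre polynomial `k L - x L'`, a multiple of the previous one. -/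
noncomputable def laguerreLow (a : ℝ) (k : ℕ) : ℝ[X] :=
  C (k : ℝ) * laguerrePoly a k - X * derivative (laguerrePoly a k)

lemma laguerreLow_zero (ha : -1 < a) : laguerreLow a 0 = 0 := by
  simp [laguerreLow, laguerrePoly_zero ha]

lemma laguerreLow_succ (ha : -1 < a) (k : ℕ) :
    laguerreLow a (k + 1) = C ((k : ℝ) + 1 + a) * laguerrePoly a k := by
  rw [laguerreLow, laguerrePoly_lower ha]
  push_cast
  ring

/-- Subtracting the lowering operator from the raising one leaves 2D, a relation with no diagonal
term. Writing the lower neighbour as `laguerreLow` avoids a separate case at `k = 0`. -/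
lemma skewOp_laguerrePoly (ha : -1 < a) (k : ℕ) :
    C 2 * skewOp a (laguerrePoly a k) =
      C ((k : ℝ) + 1) * laguerrePoly a (k + 1) - laguerreLow a k := by
  have h1 : (C 2 : ℝ[X]) * C ((a + 1) / 2) = C (a + 1) := by rw [← C_mul]; congr 1; ring
  have h2 : (C ((k : ℝ) + a + 1) : ℝ[X]) = C (k : ℝ) + C (a + 1) := by
    rw [← C_add]; congr 1; ring
  have h3 : (C 2 : ℝ[X]) = 2 := rfl
  rw [laguerrePoly_raise ha, laguerreLow, skewOp, h2, ← h1, h3]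
  ring

/-- Raising is D - X + k + (a+1)/2 and lowering is -D - X + l + (a+1)/2. As D is antisymmetric and X
symmetric, these are adjoint up to the scalar k - l, which drives the induction for orthogonality
and for the norms. -/
lemma laguerreInner_succ_left (ha : -1 < a) (k l : ℕ) :
    ((k : ℝ) + 1) * laguerreInner a (laguerrePoly a (k + 1)) (laguerrePoly a l) =
      laguerreInner a (laguerrePoly a k) (laguerreLow a l) +
        ((k : ℝ) - l) * laguerreInner a (laguerrePoly a k) (laguerrePoly a l) := by
  have h1 : C ((k : ℝ) + 1) * laguerrePoly a (k + 1) = skewOp a (laguerrePoly a k) +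
      (C (-1) * (X * laguerrePoly a k) + C (k + (a + 1) / 2) * laguerrePoly a k) := by
    have h2 : (C ((k : ℝ) + a + 1) : ℝ[X]) = C ((a + 1) / 2) + C (k + (a + 1) / 2) := by
      rw [← C_add]; congr 1; ring
    have h3 : (C (-1) : ℝ[X]) = -1 := by simp
    rw [laguerrePoly_raise ha, skewOp, h2, h3]
    ring
  have h2 : laguerreLow a l = C (-1) * skewOp a (laguerrePoly a l) +
      (C (-1) * (X * laguerrePoly a l) + C (l + (a + 1) / 2) * laguerrePoly a l) := by
    have h3 : (C (-1) : ℝ[X]) = -1 := by simp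
    rw [laguerreLow, skewOp, C_add, h3]
    ring
  rw [← laguerreInner_C_mul_left, h1, h2, laguerreInner_add_left ha, laguerreInner_add_left ha,
    laguerreInner_C_mul_left, laguerreInner_C_mul_left, laguerreInner_X_mul_left,
    laguerreInner_skewOp_left ha, laguerreInner_comm (laguerrePoly a k) (_ + _),
    laguerreInner_add_left ha, laguerreInner_add_left ha, laguerreInner_C_mul_left,
    laguerreInner_C_mul_left, laguerreInner_C_mul_left,
    laguerreInner_comm (skewOp a _), laguerreInner_comm (X * _),
    laguerreInner_comm (laguerrePoly a l)]
  ring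

lemma laguerreInner_of_lt (ha : -1 < a) : ∀ k l : ℕ, l < k →
    laguerreInner a (laguerrePoly a k) (laguerrePoly a l) = 0 := by
  intro k
  induction k with
  | zero => intro l hl; omega
  | succ k ih =>
    intro l hl
    have hk0 : (k : ℝ) + 1 ≠ 0 := by positivity
    have h := laguerreInner_succ_left ha k l
    have h1 : laguerreInner a (laguerrePoly a k) (laguerreLow a l) = 0 := by
      rcases l with _ | l
      · rw [laguerreLow_zero ha]; simp [laguerreInner]
      · rw [laguerreLow_succ ha, laguerreInner_comm, laguerreInner_C_mul_left, laguerreInner_comm,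
          ih l (by omega), mul_zero]
    have h2 : ((k : ℝ) - l) * laguerreInner a (laguerrePoly a k) (laguerrePoly a l) = 0 := by
      rcases (Nat.lt_succ_iff.mp hl).lt_or_eq with h' | h'
      · rw [ih l h', mul_zero]
      · rw [h', sub_self, zero_mul]
    rw [h1, h2, add_zero] at h
    exact (mul_eq_zero.mp h).resolve_left hk0

lemma laguerreInner_of_ne (ha : -1 < a) {k l : ℕ} (h : k ≠ l) :
    laguerreInner a (laguerrePoly a k) (laguerrePoly a l) = 0 := by
  rcases lt_or_gt_of_ne h with h | h
  · rw [laguerreInner_comm, laguerreInner_of_lt ha _ _ h]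
  · exact laguerreInner_of_lt ha _ _ h

lemma laguerreInner_self (ha : -1 < a) (k : ℕ) :
    laguerreInner a (laguerrePoly a k) (laguerrePoly a k) = laguerreNorm a k := by
  induction k with
  | zero =>
    rw [laguerrePoly_zero ha, laguerreInner, laguerreNorm]
    have h := Real.integral_rpow_mul_exp_neg_mul_Ioi (a := a + 1) (r := 2) (by linarith) two_pos
    have h2 : ∫ u : ℝ, u * loeWeight a u ^ 2 * eval u (1 * 1) =
        ∫ u in Set.Ioi (0 : ℝ), u ^ (a + 1 - 1) * Real.exp (-(2 * u)) := by
      rw [← integral_indicator measurableSet_Ioi]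
      refine integral_congr_ae (ae_of_all _ fun u => ?_)
      simp only
      rw [Set.indicator_apply]
      split_ifs with hu
      · rw [mul_sq_loeWeight hu]
        simp
      · rw [loeWeight_of_nonpos (not_lt.mp hu)]
        simp
    rw [h2, h, one_div, Real.inv_rpow two_pos.le]
    simp
    field_simp
  | succ k ih =>
    have hk0 : (k : ℝ) + 1 ≠ 0 := by positivity
    have h := laguerreInner_succ_left ha k (k + 1)
    rw [laguerreLow_succ ha, laguerreInner_comm _ (C _ * _), laguerreInner_C_mul_left, ih,
      laguerreInner_of_ne ha (k := k) (l := k + 1) (by omega), mul_zero, add_zero,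
      ← laguerreNorm_succ ha] at h
    exact mul_left_cancel₀ hk0 h

/-- A combination of L_{k+2} and L_k lies in the image of D, so skew products satisfy a recursion in
steps of two, with an inner product as source. Parity is thereby preserved. -/
lemma skewProd_laguerre_add_two (ha : -1 < a) (k : ℕ) (g : ℝ[X]) :
    ((k : ℝ) + 2) * skewProd a (laguerrePoly a (k + 2)) g =
      4 * laguerreInner a (laguerrePoly a (k + 1)) g +
        ((k : ℝ) + 1 + a) * skewProd a (laguerrePoly a k) g := by
  have h := skewOp_laguerrePoly ha (k + 1)
  have h1 := skewProd_skewOp_left ha (laguerrePoly a (k + 1)) g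
  have h2 : C ((k : ℝ) + 2) * laguerrePoly a (k + 2) =
      C 2 * skewOp a (laguerrePoly a (k + 1)) + C ((k : ℝ) + 1 + a) * laguerrePoly a k := by
    rw [h, laguerreLow_succ ha]
    have h3 : (C (((k + 1 : ℕ) : ℝ) + 1) : ℝ[X]) = C ((k : ℝ) + 2) := by
      congr 1; push_cast; ring
    rw [h3]
    ring
  rw [← skewProd_C_mul_left, h2, skewProd_add_left ha, skewProd_C_mul_left, skewProd_C_mul_left, h1]
  ring

lemma skewProd_laguerre_one (ha : -1 < a) (g : ℝ[X]) :
    skewProd a (laguerrePoly a 1) g = 4 * laguerreInner a (laguerrePoly a 0) g := by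
  have h := skewOp_laguerrePoly ha 0
  rw [laguerreLow_zero ha] at h
  have h2 : laguerrePoly a 1 = C 2 * skewOp a (laguerrePoly a 0) := by
    rw [h]; simp
  rw [h2, skewProd_C_mul_left, skewProd_skewOp_left ha]
  ring

lemma skewProd_even_even (ha : -1 < a) (j l : ℕ) :
    skewProd a (laguerrePoly a (2 * j)) (laguerrePoly a (2 * l)) = 0 := by
  have step : ∀ j l : ℕ, skewProd a (laguerrePoly a (2 * j)) (laguerrePoly a (2 * l)) = 0 →
      skewProd a (laguerrePoly a (2 * (j + 1))) (laguerrePoly a (2 * l)) = 0 := by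
    intro j l h
    have h1 := skewProd_laguerre_add_two ha (2 * j) (laguerrePoly a (2 * l))
    rw [h, laguerreInner_of_ne ha (by omega), mul_zero, mul_zero, add_zero] at h1
    exact (mul_eq_zero.mp h1).resolve_left (by positivity)
  -- The column of index 0 is filled starting from the vanishing self-product; antisymmetry turns it
  -- into the base row of the induction on `j`.
  have h0 : ∀ l, skewProd a (laguerrePoly a (2 * l)) (laguerrePoly a (2 * 0)) = 0 := by
    intro l
    induction l with
    | zero => exact skewProd_self _
    | succ l ih => exact step l 0 ih
  induction j with
  | zero => rw [skewProd_antisymm, h0, neg_zero]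
  | succ j ih => exact step j l ih

/-- L_{2j+1} is D applied to a combination of L_0, L_2, …, L_{2j}, so only these indices can pair
with it. -/
lemma skewProd_odd_of_forall_ne (ha : -1 < a) (j l : ℕ) (h : ∀ i ≤ j, 2 * i ≠ l) :
    skewProd a (laguerrePoly a (2 * j + 1)) (laguerrePoly a l) = 0 := by
  induction j with
  | zero =>
    rw [mul_zero, zero_add, skewProd_laguerre_one ha, laguerreInner_of_ne ha (h 0 le_rfl), mul_zero]
  | succ j ih =>
    have h1 := skewProd_laguerre_add_two ha (2 * j + 1) (laguerrePoly a l)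
    rw [ih fun i hi => h i (by omega), laguerreInner_of_ne ha
      (by have := h (j + 1) le_rfl; omega), mul_zero, mul_zero, add_zero] at h1
    exact (mul_eq_zero.mp h1).resolve_left (by positivity)

/-- D moves the index by exactly one in either direction, hence reverses parity. -/
lemma laguerreInner_skewOp_same_parity (ha : -1 < a) {k l : ℕ} (h : k % 2 = l % 2) :
    laguerreInner a (laguerrePoly a k) (skewOp a (laguerrePoly a l)) = 0 := by
  have h1 := skewOp_laguerrePoly ha l
  have h2 : (2 : ℝ) * laguerreInner a (skewOp a (laguerrePoly a l)) (laguerrePoly a k) = 0 := by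
    have hl : laguerreInner a (laguerreLow a l) (laguerrePoly a k) = 0 := by
      rcases l with _ | l
      · rw [laguerreLow_zero ha]; simp [laguerreInner]
      · rw [laguerreLow_succ ha, laguerreInner_C_mul_left, laguerreInner_of_ne ha (by omega),
          mul_zero]
    have h3 : C 2 * skewOp a (laguerrePoly a l) = C ((l : ℝ) + 1) * laguerrePoly a (l + 1) +
        C (-1) * laguerreLow a l := by
      rw [h1]; simp; ring
    rw [← laguerreInner_C_mul_left, h3, laguerreInner_add_left ha, laguerreInner_C_mul_left,
      laguerreInner_C_mul_left, hl, laguerreInner_of_ne ha (by omega)]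
    ring
  rw [laguerreInner_comm]
  linarith

lemma natDegree_skewOp_laguerrePoly_le (k : ℕ) :
    (skewOp a (laguerrePoly a k)).natDegree ≤ k + 1 := by
  have h := natDegree_laguerrePoly_le a k
  refine natDegree_add_le_of_degree_le ?_ ?_
  · refine natDegree_mul_le.trans ?_
    have := natDegree_derivative_le (laguerrePoly a k)
    rw [natDegree_X]
    omega
  · refine natDegree_mul_le.trans ?_
    have : (C ((a + 1) / 2) - X : ℝ[X]).natDegree ≤ 1 := 
      (natDegree_sub_le _ _).trans (by rw [natDegree_C, natDegree_X]; simp)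
    omega

/-- The integral of a weighted Laguerre polynomial. -/
noncomputable def laguerreMean (a : ℝ) (k : ℕ) : ℝ := ∫ u, loeWeight a u * (laguerrePoly a k).eval u

/-- The weighted integral of D L_k is zero, so the raised and lowered polynomials have the same
mean. This yields the two-step recursion for the means and the vanishing of the odd ones. -/
lemma integral_laguerreLow (ha : -1 < a) (k : ℕ) :
    ∫ u, loeWeight a u * (laguerreLow a k).eval u = ((k : ℝ) + 1) * laguerreMean a (k + 1) := by
  have h := integral_skewOp ha (laguerrePoly a k)
  have h2 : laguerreLow a k = C ((k : ℝ) + 1) * laguerrePoly a (k + 1) -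
      C 2 * skewOp a (laguerrePoly a k) := by
    rw [skewOp_laguerrePoly ha]; ring
  have h3 : ∀ u, loeWeight a u * (laguerreLow a k).eval u =
      ((k : ℝ) + 1) * (loeWeight a u * (laguerrePoly a (k + 1)).eval u) -
      2 * (loeWeight a u * (skewOp a (laguerrePoly a k)).eval u) := by
    intro u
    rw [h2]
    simp only [eval_sub, eval_mul, eval_C]
    ring
  simp only [h3]
  rw [integral_sub ((integrable_loeWeight_mul ha _).const_mul _)
    ((integrable_loeWeight_mul ha _).const_mul _), integral_const_mul, integral_const_mul, h,
    laguerreMean]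
  ring

lemma laguerreMean_one (ha : -1 < a) : laguerreMean a 1 = 0 := by
  have h := integral_laguerreLow ha 0
  rw [laguerreLow_zero ha] at h
  simpa using h.symm

lemma laguerreMean_add_two (ha : -1 < a) (k : ℕ) :
    ((k : ℝ) + 2) * laguerreMean a (k + 2) = ((k : ℝ) + 1 + a) * laguerreMean a k := by
  have h := integral_laguerreLow ha (k + 1)
  have h1 : ∫ u, loeWeight a u * (laguerreLow a (k + 1)).eval u =
      ((k : ℝ) + 1 + a) * laguerreMean a k := by
    rw [laguerreLow_succ ha, laguerreMean, ← integral_const_mul]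
    refine integral_congr_ae (ae_of_all _ fun u => ?_)
    simp only [eval_mul, eval_C]
    ring
  rw [h1] at h
  rw [h]
  push_cast
  ring

lemma laguerreMean_odd (ha : -1 < a) (m : ℕ) : laguerreMean a (2 * m + 1) = 0 := by
  induction m with
  | zero => exact laguerreMean_one ha
  | succ m ih =>
    have h := laguerreMean_add_two ha (2 * m + 1)
    rw [ih, mul_zero] at h
    exact (mul_eq_zero.mp h).resolve_left (by positivity)

lemma laguerreMean_even (ha : -1 < a) (m : ℕ) :
    laguerreMean a (2 * m) = Real.Gamma (m + (a + 1) / 2) / m.factorial := by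
  induction m with
  | zero =>
    have hs : 0 < (a + 1) / 2 := by linarith
    rw [laguerreMean, integral_loeWeight_mul_eq]
    simp only [Nat.cast_zero, zero_add, Nat.factorial_zero, Nat.cast_one, div_one, mul_zero]
    rw [Real.Gamma_eq_integral hs]
    refine setIntegral_congr_fun measurableSet_Ioi fun u hu => ?_
    rw [loeWeight_of_pos hu, laguerrePoly_zero ha, eval_one,
      show (a + 1) / 2 - 1 = (a - 1) / 2 by ring]
    ring
  | succ m ih =>
    have h := laguerreMean_add_two ha (2 * m)
    have hm : (m : ℝ) + (a + 1) / 2 ≠ 0 := by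
      have : (0 : ℝ) ≤ m := m.cast_nonneg
      linarith
    have hf0 : (m.factorial : ℝ) ≠ 0 := Nat.cast_ne_zero.mpr m.factorial_ne_zero
    have hm0 : (m : ℝ) + 1 ≠ 0 := by positivity
    rw [ih] at h
    have hG : Real.Gamma (((m + 1 : ℕ) : ℝ) + (a + 1) / 2) =
        (m + (a + 1) / 2) * Real.Gamma (m + (a + 1) / 2) := by
      rw [← Real.Gamma_add_one hm]
      push_cast
      ring_nf
    rw [hG, Nat.factorial_succ]
    rw [show 2 * (m + 1) = 2 * m + 2 by ring]
    push_cast at h ⊢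
    field_simp at h ⊢
    linarith

end LaguerreOrthogonality

/-! ### Skew-orthogonal bases for both parities and the telescoped density -/

section ClosedForm

variable {a : ℝ}

/-- The contribution of the `k`-th Laguerre polynomial to the density. -/
noncomputable def laguerreBlock (a : ℝ) (k : ℕ) (x : ℝ) : ℝ :=
  (loeWeight a x * (skewOp a (laguerrePoly a k)).eval x * signTransform a (laguerrePoly a k) x +
    2 * x * loeWeight a x ^ 2 * (laguerrePoly a k).eval x ^ 2) / (2 * laguerreNorm a k)

/-- D L_{2b} has degree at most 2b + 1, so m pairs fit into the space of polynomials of degree below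
2m. Partners pair to twice the Laguerre norm; all other pairs vanish by orthogonality or parity. -/
lemma isSkewOrthogonal_even (ha : -1 < a) (m : ℕ) :
    IsSkewOrthogonal fun (j : (Fin m × Bool) ⊕ Fin 0) u => loeWeight a u *
      (Sum.elim (fun q : Fin m × Bool => if q.2 then laguerrePoly a (2 * q.1) else
        skewOp a (laguerrePoly a (2 * q.1))) (fun _ => 0) j : ℝ[X]).eval u where
  measurable j := (measurable_loeWeight a).mul (Polynomial.continuous _).measurable
  integrable j := integrable_loeWeight_mul ha _
  pairing_eq_zero j k hjk hjk' := by
    rcases j with ⟨b, i⟩ | t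
    swap
    · exact t.elim0
    rcases k with ⟨c, i'⟩ | t
    swap
    · exact t.elim0
    cases i <;> cases i'
    · exact (skewProd_skewOp_left ha _ _).trans (by
        simp only [Sum.elim_inl, Bool.false_eq_true, if_false]
        rw [laguerreInner_skewOp_same_parity ha (by omega), mul_zero])
    · refine (skewProd_skewOp_left ha _ _).trans ?_
      simp only [Sum.elim_inl, if_true]
      rw [laguerreInner_of_ne ha, mul_zero]
      intro h
      apply hjk'
      have : c = b := Fin.ext (by omega)
      simp [this]
    · refine (skewProd_antisymm _ _).trans ?_
      refine neg_eq_zero.mpr ((skewProd_skewOp_left ha _ _).trans ?_)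
      simp only [Sum.elim_inl, if_true]
      rw [laguerreInner_of_ne ha, mul_zero]
      intro h
      apply hjk'
      have : c = b := Fin.ext (by omega)
      simp [this]
    · exact skewProd_even_even ha _ _
  integral_eq_zero t := t.elim0
  pairing_ne_zero b := by
    refine ne_of_eq_of_ne (skewProd_skewOp_left ha _ _) ?_
    simp only [Sum.elim_inl, if_true]
    rw [laguerreInner_self ha]
    exact mul_ne_zero two_ne_zero (laguerreNorm_pos ha _).ne'
  integral_ne_zero t := t.elim0

/-- For odd size the pairs use odd indices, because odd Laguerre polynomials and all D L_k have
weighted integral zero. The unpaired L_{2m} has positive integral and is skew-orthogonal to every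
pair. -/
lemma isSkewOrthogonal_odd (ha : -1 < a) (m : ℕ) :
    IsSkewOrthogonal fun (j : (Fin m × Bool) ⊕ Fin 1) u => loeWeight a u *
      (Sum.elim (fun q : Fin m × Bool => if q.2 then laguerrePoly a (2 * q.1 + 1) else
        skewOp a (laguerrePoly a (2 * q.1 + 1))) (fun _ => laguerrePoly a (2 * m)) j : ℝ[X]).eval u
    where
  measurable j := (measurable_loeWeight a).mul (Polynomial.continuous _).measurable
  integrable j := integrable_loeWeight_mul ha _
  pairing_eq_zero j k hjk hjk' := by
    have hsingle : ∀ (b : Fin m) (i : Bool), skewProd a (if i then laguerrePoly a (2 * b + 1) else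
        skewOp a (laguerrePoly a (2 * b + 1))) (laguerrePoly a (2 * m)) = 0 := by
      intro b i
      cases i
      · simp only [Bool.false_eq_true, if_false]
        rw [skewProd_skewOp_left ha, laguerreInner_of_ne ha (by omega), mul_zero]
      · simp only [if_true]
        exact skewProd_odd_of_forall_ne ha _ _ fun i hi => by omega
    rcases j with ⟨b, i⟩ | t <;> rcases k with ⟨c, i'⟩ | t'
    · cases i <;> cases i'
      · exact (skewProd_skewOp_left ha _ _).trans (by
        simp only [Sum.elim_inl, Bool.false_eq_true, if_false]
        rw [laguerreInner_skewOp_same_parity ha (by omega), mul_zero])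
      · refine (skewProd_skewOp_left ha _ _).trans ?_
        simp only [Sum.elim_inl, if_true]
        rw [laguerreInner_of_ne ha, mul_zero]
        intro h
        apply hjk'
        have : c = b := Fin.ext (by omega)
        simp [this]
      · refine (skewProd_antisymm _ _).trans ?_
        refine neg_eq_zero.mpr ((skewProd_skewOp_left ha _ _).trans ?_)
        simp only [Sum.elim_inl, if_true]
        rw [laguerreInner_of_ne ha, mul_zero]
        intro h
        apply hjk'
        have : c = b := Fin.ext (by omega)
        simp [this]
      · exact skewProd_odd_of_forall_ne ha _ _ fun i hi => by simp only; omega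
    · exact hsingle b i
    · exact (skewProd_antisymm _ _).trans (neg_eq_zero.mpr (hsingle c i'))
    · exact absurd (congrArg Sum.inr (Subsingleton.elim t t')) hjk
  integral_eq_zero t q := by
    obtain ⟨b, i⟩ := q
    cases i
    · exact integral_skewOp ha _
    · exact laguerreMean_odd ha b
  pairing_ne_zero b := by
    refine ne_of_eq_of_ne (skewProd_skewOp_left ha _ _) ?_
    simp only [Sum.elim_inl, if_true]
    rw [laguerreInner_self ha]
    exact mul_ne_zero two_ne_zero (laguerreNorm_pos ha _).ne'
  integral_ne_zero t := by
    have h := laguerreMean_even ha m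
    have hm : 0 < (m : ℝ) + (a + 1) / 2 := by
      have : (0 : ℝ) ≤ m := m.cast_nonneg
      linarith
    have h1 := Real.Gamma_pos_of_pos hm
    refine ne_of_eq_of_ne h ?_
    positivity

lemma skewDensity_block (ha : -1 < a) (k : ℕ) {x : ℝ} (hx : 0 < x) :
    (loeWeight a x * (skewOp a (laguerrePoly a k)).eval x * signTransform a (laguerrePoly a k) x -
      loeWeight a x * (laguerrePoly a k).eval x *
        signTransform a (skewOp a (laguerrePoly a k)) x) /
      skewProd a (skewOp a (laguerrePoly a k)) (laguerrePoly a k) = laguerreBlock a k x := by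
  rw [skewProd_skewOp_left ha, laguerreInner_self ha, signTransform_skewOp ha _ hx.le,
    weightFlux_of_pos _ hx, laguerreBlock]
  congr 1
  ring

lemma loeDensity_even (ha : -1 < a) (m : ℕ) {x : ℝ} (hx : 0 < x) :
    loeDensity a (2 * m + 2) x = ∑ b ∈ Finset.range (m + 1), laguerreBlock a (2 * b) x := by
  have hcard : Fintype.card ((Fin (m + 1) × Bool) ⊕ Fin 0) = 2 * m + 1 + 1 := by
    simp; ring
  rw [loeDensity_eq_skewDensity (Fintype.equivFinOfCardEq hcard)
    (fun j => Sum.elim (fun q : Fin (m + 1) × Bool => if q.2 then laguerrePoly a (2 * q.1) else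
        skewOp a (laguerrePoly a (2 * q.1))) (fun _ => 0) j) ?_ (isSkewOrthogonal_even ha (m + 1)) x]
  · rw [skewDensity, Finset.univ_eq_empty (α := Fin 0), Finset.sum_empty, add_zero,
      ← Fin.sum_univ_eq_sum_range (fun b => laguerreBlock a (2 * b) x)]
    refine Finset.sum_congr rfl fun b _ => ?_
    exact skewDensity_block ha (2 * b) hx
  · rintro (⟨b, i⟩ | t)
    · cases i
      · exact (natDegree_skewOp_laguerrePoly_le _).trans_lt (by simp only; omega)
      · exact (natDegree_laguerrePoly_le _ _).trans_lt (by simp only; omega)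
    · exact t.elim0

lemma loeDensity_odd (ha : -1 < a) (m : ℕ) {x : ℝ} (hx : 0 < x) :
    loeDensity a (2 * m + 1) x = ∑ b ∈ Finset.range m, laguerreBlock a (2 * b + 1) x +
      loeWeight a x * (laguerrePoly a (2 * m)).eval x / laguerreMean a (2 * m) := by
  have hcard : Fintype.card ((Fin m × Bool) ⊕ Fin 1) = 2 * m + 1 := by
    simp; ring
  rw [loeDensity_eq_skewDensity (Fintype.equivFinOfCardEq hcard)
    (fun j => Sum.elim (fun q : Fin m × Bool => if q.2 then laguerrePoly a (2 * q.1 + 1) else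
        skewOp a (laguerrePoly a (2 * q.1 + 1))) (fun _ => laguerrePoly a (2 * m)) j) ?_
    (isSkewOrthogonal_odd ha m) x]
  · rw [skewDensity, ← Fin.sum_univ_eq_sum_range (fun b => laguerreBlock a (2 * b + 1) x)]
    refine congrArg₂ (· + ·) (Finset.sum_congr rfl fun b _ => ?_) ?_
    · exact skewDensity_block ha (2 * b + 1) hx
    · simp [laguerreMean]
  · rintro (⟨b, i⟩ | t)
    · cases i
      · exact (natDegree_skewOp_laguerrePoly_le _).trans_lt (by simp only; omega)
      · exact (natDegree_laguerrePoly_le _ _).trans_lt (by simp only; omega)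
    · exact (natDegree_laguerrePoly_le _ _).trans_lt (by omega)

lemma signTransform_relation (ha : -1 < a) (k : ℕ) {x : ℝ} (hx : 0 < x) :
    ((k : ℝ) + 1) * signTransform a (laguerrePoly a (k + 1)) x -
      signTransform a (laguerreLow a k) x = -(4 * (x * loeWeight a x * (laguerrePoly a k).eval x)) := by
  have h1 := signTransform_skewOp ha (laguerrePoly a k) hx.le
  rw [weightFlux_of_pos _ hx] at h1
  have hi : ∀ p, Integrable fun v => Real.sign (v - x) * (loeWeight a v * eval v p) := fun p =>
    (integrable_loeWeight_mul ha p).bdd_mul (c := 1)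
      (measurable_real_sign.comp (measurable_id.sub_const x)).aestronglyMeasurable
      (ae_of_all _ fun v => by simpa using abs_real_sign_le_one (v - x))
  have h2 : 2 * signTransform a (skewOp a (laguerrePoly a k)) x =
      ((k : ℝ) + 1) * signTransform a (laguerrePoly a (k + 1)) x -
      signTransform a (laguerreLow a k) x := by
    unfold signTransform
    rw [← integral_const_mul, ← integral_const_mul, ← integral_sub ((hi _).const_mul _) (hi _)]
    refine integral_congr_ae (ae_of_all _ fun v => ?_)
    simp only
    have h3 := congrArg (eval v) (skewOp_laguerrePoly ha k)
    simp only [eval_mul, eval_C, eval_sub] at h3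
    linear_combination (Real.sign (v - x) * loeWeight a v) * h3
  rw [← h2, h1]
  ring

/-- The telescoped sum of the blocks of one parity. -/
noncomputable def laguerreTelescope (a : ℝ) (n : ℕ) (x : ℝ) : ℝ :=
  x * loeWeight a x ^ 2 * ∑ k ∈ Finset.range n, (laguerrePoly a k).eval x ^ 2 / laguerreNorm a k +
    loeWeight a x / 4 * (laguerrePoly a n).eval x * signTransform a (laguerreLow a n) x /
      laguerreNorm a n

lemma signTransform_C_mul (c : ℝ) (p : ℝ[X]) (x : ℝ) :
    signTransform a (C c * p) x = c * signTransform a p x := by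
  unfold signTransform
  rw [← integral_const_mul]
  refine integral_congr_ae (ae_of_all _ fun v => ?_)
  simp only [eval_mul, eval_C]
  ring

lemma laguerreTelescope_zero (ha : -1 < a) (x : ℝ) : laguerreTelescope a 0 x = 0 := by
  simp [laguerreTelescope, laguerreLow_zero ha, signTransform]

lemma laguerreTelescope_one (ha : -1 < a) (x : ℝ) :
    laguerreTelescope a 1 x = laguerreBlock a 0 x := by
  have h0 := (laguerreNorm_pos ha 0).ne'
  have h1 := (laguerreNorm_pos ha 1).ne'
  have hn := laguerreNorm_succ ha 0
  have h3 := congrArg (eval x) (skewOp_laguerrePoly ha 0)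
  rw [laguerreLow_zero ha] at h3
  simp only [eval_mul, eval_C, Nat.cast_zero, zero_add, one_mul, sub_zero] at h3
  simp only [Nat.cast_zero, zero_add, one_mul] at hn
  rw [laguerreTelescope, laguerreBlock, laguerreLow_succ ha, signTransform_C_mul, ← h3]
  simp only [Finset.sum_range_one, Nat.cast_zero, zero_add]
  rw [hn] at h1 ⊢
  have h4 : 1 + a ≠ 0 := left_ne_zero_of_mul h1
  field_simp
  ring

/-- In the block, D L_{k+1} splits into an L_{k+2} part, which is the new end term, and an L_k part.
By `signTransform_relation` the latter cancels the old end term and leaves x w² L_k²/h_k, with h_k =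
`laguerreNorm a k`: the summand of index k that blocks of the other parity would supply. -/
lemma laguerreTelescope_add_two (ha : -1 < a) (k : ℕ) {x : ℝ} (hx : 0 < x) :
    laguerreTelescope a (k + 2) x = laguerreTelescope a k x + laguerreBlock a (k + 1) x := by
  have hk : (0 : ℝ) ≤ k := k.cast_nonneg
  have h0 := (laguerreNorm_pos ha k).ne'
  have hn0 := laguerreNorm_succ ha k
  have hn1 := laguerreNorm_succ ha (k + 1)
  push_cast at hn1
  have h1 : laguerreNorm a (k + 1) = (k + 1 + a) / (k + 1) * laguerreNorm a k := by
    field_simp; linarith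
  have h2 : laguerreNorm a (k + 2) = (k + 2 + a) / (k + 2) * laguerreNorm a (k + 1) := by
    have : (k : ℝ) + 2 ≠ 0 := by positivity
    field_simp
    linear_combination hn1
  have h3 := congrArg (eval x) (skewOp_laguerrePoly ha (k + 1))
  rw [laguerreLow_succ ha] at h3
  simp only [eval_mul, eval_C, eval_sub] at h3
  push_cast at h3
  have h4 := signTransform_relation ha k hx
  rw [laguerreTelescope, laguerreTelescope, laguerreBlock, laguerreLow_succ ha, signTransform_C_mul,
    Finset.sum_range_succ, Finset.sum_range_succ]
  push_cast
  have e1 : (skewOp a (laguerrePoly a (k + 1))).eval x = (((k : ℝ) + 1 + 1) *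
      (laguerrePoly a (k + 1 + 1)).eval x - (k + 1 + a) * (laguerrePoly a k).eval x) / 2 := by
    linarith
  have e2 : signTransform a (laguerreLow a k) x = ((k : ℝ) + 1) *
      signTransform a (laguerrePoly a (k + 1)) x +
      4 * (x * loeWeight a x * (laguerrePoly a k).eval x) := by linarith
  rw [e1, e2, h2, h1]
  have p1 : (k : ℝ) + 1 + a ≠ 0 := by linarith
  have p2 : (k : ℝ) + 2 + a ≠ 0 := by linarith
  have p3 : (k : ℝ) + 1 ≠ 0 := by positivity
  have p4 : (k : ℝ) + 2 ≠ 0 := by positivity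
  generalize (∑ k ∈ Finset.range k, (laguerrePoly a k).eval x ^ 2 / laguerreNorm a k) = S
  field_simp
  ring

/-- The Gamma quotient multiplying the last weighted Laguerre polynomial. -/
noncomputable def loeConst (a : ℝ) (n : ℕ) : ℝ :=
  Real.Gamma ((n : ℝ) / 2 + 1) / Real.Gamma (((n : ℝ) + 1 + a) / 2)

/-- Legendre's duplication formula, applied to the numerator and to the denominator, brings the
constant for odd `n` to the same Gamma quotient as for even `n`. The density formula thus becomes
independent of parity. -/
lemma loeConst_odd (ha : -1 < a) (m : ℕ) :
    (2 * (m : ℝ) + 1 + a) * laguerreMean a (2 * m) / (4 * laguerreNorm a (2 * m + 1)) =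
      loeConst a (2 * m + 1) := by
  have hm : (0 : ℝ) ≤ m := m.cast_nonneg
  have d1 := Real.Gamma_mul_Gamma_add_half ((m : ℝ) + (a + 1) / 2)
  have d2 := Real.Gamma_mul_Gamma_add_half ((m : ℝ) + 1)
  have g1 := Gamma_nat_succ_add ha (2 * m)
  have f1 : Real.Gamma ((m : ℝ) + 1) = m.factorial := Real.Gamma_nat_eq_factorial m
  have f2 : Real.Gamma (2 * ((m : ℝ) + 1)) = (2 * m + 1).factorial := by
    rw [← Real.Gamma_nat_eq_factorial]; congr 1; push_cast; ring
  have q1 : 0 < Real.Gamma ((m : ℝ) + (a + 1) / 2 + 1 / 2) := Real.Gamma_pos_of_pos (by linarith)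
  have q2 : 0 < Real.Gamma (2 * ((m : ℝ) + (a + 1) / 2)) := Real.Gamma_pos_of_pos (by linarith)
  have q3 : (m.factorial : ℝ) ≠ 0 := Nat.cast_ne_zero.mpr m.factorial_ne_zero
  have q4 : ((2 * m + 1).factorial : ℝ) ≠ 0 := Nat.cast_ne_zero.mpr (Nat.factorial_ne_zero _)
  have q5 : Real.sqrt Real.pi ≠ 0 := (Real.sqrt_pos.mpr Real.pi_pos).ne'
  have q6 : 2 * (m : ℝ) + a + 1 ≠ 0 := by linarith
  rw [laguerreMean_even ha, laguerreNorm, loeConst, g1]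
  rw [f1, f2] at d2
  push_cast
  rw [show (2 * (m : ℝ) + 1) / 2 + 1 = m + 1 + 1 / 2 by ring,
    show (2 * (m : ℝ) + 1 + 1 + a) / 2 = m + (a + 1) / 2 + 1 / 2 by ring,
    show 2 * (m : ℝ) + a + 1 = 2 * (m + (a + 1) / 2) by ring] at *
  have e1 : Real.Gamma ((m : ℝ) + 1 + 1 / 2) =
      ((2 * m + 1).factorial : ℝ) * 2 ^ (1 - 2 * ((m : ℝ) + 1)) * √Real.pi / m.factorial := by
    rw [eq_div_iff q3, mul_comm]; exact d2
  have e2 : Real.Gamma ((m : ℝ) + (a + 1) / 2) = Real.Gamma (2 * ((m : ℝ) + (a + 1) / 2)) *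
      2 ^ (1 - 2 * ((m : ℝ) + (a + 1) / 2)) * √Real.pi /
      Real.Gamma ((m : ℝ) + (a + 1) / 2 + 1 / 2) := by
    rw [eq_div_iff q1.ne']; exact d1
  have e3 : (2 : ℝ) ^ (1 - 2 * ((m : ℝ) + (a + 1) / 2)) * 2 ^ (a + 1) =
      4 * 2 ^ (1 - 2 * ((m : ℝ) + 1)) := by
    rw [← Real.rpow_add two_pos, show (4 : ℝ) = 2 ^ (2 : ℝ) by norm_num, ← Real.rpow_add two_pos]
    congr 1; ring
  rw [e1, e2]
  have q7 : 2 * ((m : ℝ) + (a + 1) / 2) ≠ 0 := by linarith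
  have q8 : (0 : ℝ) < 2 ^ (a + 1) := by positivity
  rw [show 2 * (m : ℝ) + 1 + a = 2 * (m + (a + 1) / 2) by ring]
  generalize Real.Gamma (2 * ((m : ℝ) + (a + 1) / 2)) = G at *
  generalize Real.Gamma ((m : ℝ) + (a + 1) / 2 + 1 / 2) = G' at *
  generalize 2 * ((m : ℝ) + (a + 1) / 2) = s at *
  generalize (2 : ℝ) ^ (1 - s) = t at *
  generalize (2 : ℝ) ^ (1 - 2 * ((m : ℝ) + 1)) = t' at *
  generalize (2 : ℝ) ^ (a + 1) = t'' at *
  field_simp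
  linear_combination e3

lemma laguerreTelescope_odd (ha : -1 < a) (m : ℕ) {x : ℝ} (hx : 0 < x) :
    ∑ b ∈ Finset.range (m + 1), laguerreBlock a (2 * b) x = laguerreTelescope a (2 * m + 1) x := by
  induction m with
  | zero => simp [laguerreTelescope_one ha]
  | succ m ih =>
    rw [Finset.sum_range_succ, ih, show 2 * (m + 1) + 1 = 2 * m + 1 + 2 by ring,
      laguerreTelescope_add_two ha _ hx]
    rfl

lemma laguerreTelescope_even (ha : -1 < a) (m : ℕ) {x : ℝ} (hx : 0 < x) :
    ∑ b ∈ Finset.range m, laguerreBlock a (2 * b + 1) x = laguerreTelescope a (2 * m) x := by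
  induction m with
  | zero => simp [laguerreTelescope_zero ha]
  | succ m ih =>
    rw [Finset.sum_range_succ, ih, show 2 * (m + 1) = 2 * m + 2 by ring,
      laguerreTelescope_add_two ha _ hx]

/-- The one-point density, in a form valid for both parities of the number of eigenvalues. -/
theorem loeDensity_succ (ha : -1 < a) (n : ℕ) {x : ℝ} (hx : 0 < x) :
    loeDensity a (n + 1) x =
      x * loeWeight a x ^ 2 *
        ∑ k ∈ Finset.range n, (laguerrePoly a k).eval x ^ 2 / laguerreNorm a k +
      loeWeight a x * (laguerrePoly a n).eval x *
        (loeConst a n - lowerIntegral a (laguerreLow a n) x / (2 * laguerreNorm a n)) := by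
  have hn := (laguerreNorm_pos ha n).ne'
  -- The constant has two origins. For even `n` the total integral of the lowered polynomial
  -- vanishes and the unpaired function supplies it; for odd `n` there is no unpaired function and
  -- that total integral supplies it.
  rcases Nat.even_or_odd' n with ⟨m, rfl | rfl⟩
  · rw [loeDensity_odd ha m hx, laguerreTelescope_even ha m hx, laguerreTelescope,
      signTransform_eq ha, integral_laguerreLow ha, laguerreMean_odd ha]
    have h : (laguerreMean a (2 * m))⁻¹ = loeConst a (2 * m) := by
      rw [laguerreMean_even ha, loeConst, inv_div, ← Real.Gamma_nat_eq_factorial]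
      congr 2 <;> push_cast <;> ring
    rw [← h]
    field_simp
    ring
  · rw [show 2 * m + 1 + 1 = 2 * m + 2 by ring, loeDensity_even ha m hx,
      laguerreTelescope_odd ha m hx, laguerreTelescope,
      signTransform_eq ha, integral_laguerreLow ha]
    have h2 := laguerreMean_add_two ha (2 * m)
    have h3 : (((2 * m + 1 : ℕ) : ℝ) + 1) * laguerreMean a (2 * m + 1 + 1) =
        (2 * (m : ℝ) + 1 + a) * laguerreMean a (2 * m) := by
      push_cast at h2 ⊢
      linear_combination h2
    rw [h3, ← loeConst_odd ha]
    field_simp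
    ring

end ClosedForm

/-! ### Power series with infinite radius of convergence -/

section EntireSeries

/-- Coefficients of a power series with infinite radius of convergence. -/
def EntireCoeff (c : ℕ → ℝ) : Prop := ∀ r : ℝ, Summable fun j => |c j| * r ^ j

/-- The sum of a power series. -/
noncomputable def entireSum (c : ℕ → ℝ) (z : ℝ) : ℝ := ∑' j, c j * z ^ j

/-- Coefficients of the derivative of a power series. -/
def derivCoeff (c : ℕ → ℝ) (j : ℕ) : ℝ := ((j : ℝ) + 1) * c (j + 1)

namespace EntireCoeff

variable {c d : ℕ → ℝ}

lemma summable (hc : EntireCoeff c) (z : ℝ) : Summable fun j => c j * z ^ j := by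
  refine Summable.of_norm ?_
  simpa [abs_mul, abs_pow] using hc |z|

lemma of_bound {C B : ℝ} (h : ∀ j, |c j| ≤ C * B ^ j / j.factorial) : EntireCoeff c := by
  intro r
  have hs : Summable fun j : ℕ => C * ((B * |r|) ^ j / j.factorial) :=
    (Real.summable_pow_div_factorial (B * |r|)).mul_left C
  refine Summable.of_norm_bounded hs fun j => ?_
  rw [norm_mul, Real.norm_eq_abs, abs_abs, norm_pow, Real.norm_eq_abs, mul_pow]
  calc |c j| * |r| ^ j ≤ C * B ^ j / j.factorial * |r| ^ j := by gcongr; exact h j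
    _ = _ := by ring

lemma derivCoeff (hc : EntireCoeff c) : EntireCoeff (derivCoeff c) := by
  intro r
  have h1 := (summable_nat_add_iff 1).mpr (hc (2 * (|r| + 1)))
  refine Summable.of_norm_bounded h1 fun j => ?_
  have hj : ((j : ℝ) + 1) ≤ 2 ^ (j + 1) := by
    have := (j + 1).lt_two_pow_self.le
    exact_mod_cast this
  have hr : |r| ^ j ≤ (|r| + 1) ^ (j + 1) := by
    calc |r| ^ j ≤ (|r| + 1) ^ j := by gcongr; linarith
      _ ≤ (|r| + 1) ^ (j + 1) := pow_le_pow_right₀ (by linarith [abs_nonneg r]) (by omega)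
  rw [norm_mul, Real.norm_eq_abs, abs_abs, norm_pow, Real.norm_eq_abs, _root_.derivCoeff, abs_mul,
    abs_of_nonneg (by positivity : (0 : ℝ) ≤ j + 1), mul_pow]
  calc ((j : ℝ) + 1) * |c (j + 1)| * |r| ^ j
      ≤ 2 ^ (j + 1) * |c (j + 1)| * (|r| + 1) ^ (j + 1) := by gcongr
    _ = _ := by ring

lemma hasDerivAt (hc : EntireCoeff c) (z : ℝ) :
    HasDerivAt (entireSum c) (entireSum (_root_.derivCoeff c) z) z := by
  set R : ℝ := |z| + 1 with hR
  have hR1 : 1 ≤ R := by rw [hR]; linarith [abs_nonneg z]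
  -- The doubled radius absorbs the factor `j` of the derivative through j ≤ 2^j.
  have hu : Summable fun j : ℕ => |c j| * (2 * R) ^ j := hc _
  have hz : z ∈ Metric.ball (0 : ℝ) R := by simp [hR]
  have h := hasDerivAt_tsum_of_isPreconnected (g := fun j z => c j * z ^ j)
    (g' := fun j z => c j * ((j : ℝ) * z ^ (j - 1))) hu Metric.isOpen_ball
    (convex_ball (0 : ℝ) R).isPreconnected
    (fun j y _ => (hasDerivAt_pow j y).const_mul (c j))
    (fun j y hy => by
      rw [Metric.mem_ball, dist_zero_right, Real.norm_eq_abs] at hy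
      rw [norm_mul, norm_mul, norm_pow, Real.norm_eq_abs, Real.norm_eq_abs, Real.norm_eq_abs,
        mul_pow, Nat.abs_cast]
      have hj : (j : ℝ) ≤ 2 ^ j := by exact_mod_cast j.lt_two_pow_self.le
      have h1 : |y| ^ (j - 1) ≤ R ^ j := by
        calc |y| ^ (j - 1) ≤ R ^ (j - 1) := by gcongr
          _ ≤ R ^ j := pow_le_pow_right₀ hR1 (by omega)
      gcongr)
    hz (hc.summable z) hz
  refine h.congr_deriv ?_
  have hs : Summable fun j : ℕ => c j * ((j : ℝ) * z ^ (j - 1)) := by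
    rw [← summable_nat_add_iff 1]
    refine (hc.derivCoeff.summable z).congr fun j => ?_
    simp [_root_.derivCoeff]
    ring
  rw [hs.tsum_eq_zero_add, entireSum]
  simp only [Nat.cast_zero, zero_mul, mul_zero, zero_add]
  refine tsum_congr fun j => ?_
  simp [_root_.derivCoeff]
  ring

lemma continuous (hc : EntireCoeff c) : Continuous (entireSum c) :=
  continuous_iff_continuousAt.mpr fun z => (hc.hasDerivAt z).continuousAt

lemma add (hc : EntireCoeff c) (hd : EntireCoeff d) : EntireCoeff fun j => c j + d j := by
  intro r
  refine Summable.of_norm_bounded ((hc |r|).add (hd |r|)) fun j => ?_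
  rw [norm_mul, Real.norm_eq_abs, abs_abs, norm_pow, Real.norm_eq_abs, ← add_mul]
  gcongr
  exact abs_add_le _ _

lemma const_mul (hc : EntireCoeff c) (k : ℝ) : EntireCoeff fun j => k * c j := by
  intro r
  refine ((hc r).mul_left |k|).congr fun j => ?_
  rw [abs_mul]
  ring

/-- Multiplication by the variable. -/
lemma shift (hc : EntireCoeff c) : EntireCoeff fun j => if j = 0 then 0 else c (j - 1) := by
  intro r
  rw [← summable_nat_add_iff 1]
  refine ((hc r).mul_left r).congr fun j => ?_
  simp [pow_succ]
  ring

lemma sum_add (hc : EntireCoeff c) (hd : EntireCoeff d) (z : ℝ) :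
    entireSum (fun j => c j + d j) z = entireSum c z + entireSum d z := by
  unfold entireSum
  rw [← (hc.summable z).tsum_add (hd.summable z)]
  exact tsum_congr fun j => by ring

lemma abs_sum_le {C B : ℝ} (hB : 0 ≤ B) (h : ∀ j, |c j| ≤ C * B ^ j / j.factorial) {z R : ℝ}
    (hz : |z| ≤ R) : |entireSum c z| ≤ C * Real.exp (B * R) := by
  have hC : 0 ≤ C := by simpa using (abs_nonneg _).trans (h 0)
  have hR : 0 ≤ R := (abs_nonneg z).trans hz
  have hs : HasSum (fun j : ℕ => C * ((B * R) ^ j / j.factorial)) (C * Real.exp (B * R)) := by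
    rw [Real.exp_eq_exp_ℝ]
    exact (NormedSpace.expSeries_div_hasSum_exp (B * R)).mul_left C
  refine (tsum_of_norm_bounded (f := fun j => c j * z ^ j) hs fun j => ?_ : ‖entireSum c z‖ ≤ _)
  rw [norm_mul, Real.norm_eq_abs, norm_pow, Real.norm_eq_abs, mul_pow]
  calc |c j| * |z| ^ j ≤ C * B ^ j / j.factorial * R ^ j := by gcongr; exact h j
    _ = _ := by ring

lemma euler (hc : EntireCoeff c) : EntireCoeff fun j => (j : ℝ) * c j := by
  intro r
  rw [← summable_nat_add_iff 1]
  refine ((hc.derivCoeff r).mul_left r).congr fun j => ?_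
  simp only [_root_.derivCoeff, pow_succ]
  push_cast
  ring

lemma sum_euler (hc : EntireCoeff c) (z : ℝ) :
    entireSum (fun j => (j : ℝ) * c j) z = z * entireSum (_root_.derivCoeff c) z := by
  rw [entireSum, (hc.euler.summable z).tsum_eq_zero_add, entireSum, ← tsum_mul_left]
  simp only [Nat.cast_zero, zero_mul, zero_add]
  refine tsum_congr fun j => ?_
  simp only [_root_.derivCoeff, pow_succ]
  push_cast
  ring

lemma sum_shift (hc : EntireCoeff c) (z : ℝ) :
    entireSum (fun j => if j = 0 then 0 else c (j - 1)) z = z * entireSum c z := by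
  rw [entireSum, (hc.shift.summable z).tsum_eq_zero_add, entireSum, ← tsum_mul_left]
  simp only [if_true, zero_mul, zero_add]
  refine tsum_congr fun j => ?_
  simp [pow_succ]
  ring

end EntireCoeff

lemma entireSum_const_mul (k : ℝ) (c : ℕ → ℝ) (z : ℝ) :
    entireSum (fun j => k * c j) z = k * entireSum c z := by
  unfold entireSum
  rw [← tsum_mul_left]
  exact tsum_congr fun j => by ring

lemma derivCoeff_bound {c : ℕ → ℝ} {C B : ℝ} (h : ∀ j, |c j| ≤ C * B ^ j / j.factorial) (j : ℕ) :
    |derivCoeff c j| ≤ C * B * B ^ j / j.factorial := by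
  have h1 := h (j + 1)
  have hf : ((j + 1).factorial : ℝ) = (j + 1) * j.factorial := by push_cast [Nat.factorial_succ]; ring
  rw [derivCoeff, abs_mul, abs_of_nonneg (by positivity : (0 : ℝ) ≤ j + 1)]
  rw [hf] at h1
  calc ((j : ℝ) + 1) * |c (j + 1)| ≤ (j + 1) * (C * B ^ (j + 1) / ((j + 1) * j.factorial)) := by
        gcongr
    _ = _ := by
        have : (j : ℝ) + 1 ≠ 0 := by positivity
        field_simp
        ring

end EntireSeries

/-! ### The deformed Bessel recursion and its expansion in ε -/

section BesselSeries

/-- Coefficients of the Frobenius solution of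
`(s d/ds) ^ 2 V + (s ^ 2 - a ^ 2 - ε s ^ 4 / 16) V = 0`, in powers of `s ^ 2`. -/
noncomputable def besselCoeff (a ε : ℝ) : ℕ → ℝ
  | 0 => 1 / (2 ^ a * Real.Gamma (a + 1))
  | 1 => -(1 / (2 ^ a * Real.Gamma (a + 1))) / (4 * (1 + a))
  | j + 2 => (-besselCoeff a ε (j + 1) + ε / 16 * besselCoeff a ε j) /
      (4 * ((j : ℝ) + 2) * (j + 2 + a))

/-- The coefficients of the first order term in `ε`. -/
noncomputable def besselCoeffOne (a : ℝ) : ℕ → ℝ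
  | 0 => 0
  | j + 1 => (1 - a - 2 * j) * besselCoeff a 0 j / 96 +
      (1 - a ^ 2) / 24 * ((j + 1) * besselCoeff a 0 (j + 1))

variable {a : ℝ}

/-- The growth rate in the bounds on the coefficients. -/
noncomputable def coeffRate (a : ℝ) : ℝ := 1 + 1 / min 1 (1 + a)

lemma one_le_coeffRate (ha : -1 < a) : 1 ≤ coeffRate a := by
  have : 0 < min 1 (1 + a) := lt_min one_pos (by linarith)
  have : 0 < 1 / min 1 (1 + a) := by positivity
  unfold coeffRate
  linarith

/-- With c = min 1 (1 + a), the divisor is at least 4c(j+2)². Part of it produces the factorials and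
the rest absorbs the three terms on the right, as c times `coeffRate` is at least 1. The source term
is included so that one lemma bounds the coefficients, their first-order part and the remainder. -/
lemma abs_le_of_recursion (ha : -1 < a) {u : ℕ → ℝ} {K : ℝ}
    (h0 : |u 0| ≤ K) (h1 : |u 1| ≤ K * coeffRate a)
    (h2 : ∀ j : ℕ, 4 * ((j : ℝ) + 2) * (j + 2 + a) * |u (j + 2)| ≤
      |u (j + 1)| + |u j| + K * coeffRate a ^ j / j.factorial) (j : ℕ) :
    |u j| ≤ K * coeffRate a ^ j / j.factorial := by
  have hK : 0 ≤ K := (abs_nonneg _).trans h0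
  set c := min 1 (1 + a) with hc
  have hc0 : 0 < c := lt_min one_pos (by linarith)
  have hc1 : c ≤ 1 := min_le_left _ _
  have hca : c ≤ 1 + a := min_le_right _ _
  set B := coeffRate a with hB
  have hB1 : 1 ≤ B := one_le_coeffRate ha
  have hcB : 1 ≤ c * B := by
    rw [hB, coeffRate, ← hc, mul_add, mul_one_div, div_self hc0.ne']
    linarith
  induction j using Nat.twoStepInduction with
  | zero => simpa using h0
  | one => simpa using h1
  | more j ih0 ih1 =>
    have hf1 : ((j + 1).factorial : ℝ) = (j + 1) * j.factorial := by
      push_cast [Nat.factorial_succ]; ring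
    have hf2 : ((j + 2).factorial : ℝ) = (j + 2) * ((j + 1) * j.factorial) := by
      push_cast [Nat.factorial_succ]; ring
    have hj : (0 : ℝ) ≤ j := j.cast_nonneg
    have hjf : (0 : ℝ) < j.factorial := by exact_mod_cast j.factorial_pos
    have h3 := h2 j
    have hq : 4 * c * ((j : ℝ) + 2) ^ 2 ≤ 4 * ((j : ℝ) + 2) * (j + 2 + a) := by
      have : c * ((j : ℝ) + 2) ≤ j + 2 + a := by nlinarith
      nlinarith
    rw [hf1] at ih1
    rw [hf2]
    set T := K * B ^ j / j.factorial with hT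
    have hT0 : 0 ≤ T := by positivity
    have e1 : K * B ^ (j + 1) / ((j + 1) * j.factorial) = T * B / (j + 1) := by
      rw [hT]; field_simp; ring
    have e2 : K * B ^ (j + 2) / ((j + 2) * ((j + 1) * j.factorial)) =
        T * B ^ 2 / ((j + 2) * (j + 1)) := by
      rw [hT]; field_simp; ring
    rw [e1] at ih1
    rw [e2]
    have h4 : 4 * c * ((j : ℝ) + 2) ^ 2 * |u (j + 2)| ≤ T * B / (j + 1) + T + T :=
      (mul_le_mul_of_nonneg_right hq (abs_nonneg _)).trans (h3.trans (by linarith))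
    have h5 : T * B / (j + 1) + T + T ≤ 4 * c * ((j : ℝ) + 2) ^ 2 *
        (T * B ^ 2 / ((j + 2) * (j + 1))) := by
      have h6 : 4 * c * ((j : ℝ) + 2) ^ 2 * (T * B ^ 2 / ((j + 2) * (j + 1))) =
          (4 * (c * B) * (j + 2) * (T * B)) / (j + 1) := by
        field_simp
      have h7 : T * B / (j + 1) + T + T = (T * B + 2 * T * (j + 1)) / (j + 1) := by
        field_simp; ring
      rw [h6, h7]
      have hTB : T ≤ T * B := le_mul_of_one_le_right hT0 hB1
      have h8 : T * B + 2 * T * (j + 1) ≤ 4 * 1 * (j + 2) * (T * B) := by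
        nlinarith [mul_nonneg hj (mul_nonneg hT0 (by linarith : (0 : ℝ) ≤ B)),
          mul_le_mul_of_nonneg_right hTB (by linarith : (0 : ℝ) ≤ (j : ℝ) + 1)]
      have h9 : 4 * 1 * ((j : ℝ) + 2) * (T * B) ≤ 4 * (c * B) * (j + 2) * (T * B) := by
        have : 0 ≤ T * B := hT0.trans hTB
        gcongr
      exact div_le_div_of_nonneg_right (h8.trans h9) (by positivity)
    exact le_of_mul_le_mul_left (h4.trans h5) (by positivity)

lemma besselCoeff_zero (a ε : ℝ) : besselCoeff a ε 0 = 1 / (2 ^ a * Real.Gamma (a + 1)) := by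
  rw [besselCoeff]

lemma besselCoeff_one (a ε : ℝ) :
    besselCoeff a ε 1 = -(1 / (2 ^ a * Real.Gamma (a + 1))) / (4 * (1 + a)) := by
  rw [besselCoeff]

lemma besselCoeff_add_two (ha : -1 < a) (ε : ℝ) (j : ℕ) :
    4 * ((j : ℝ) + 2) * (j + 2 + a) * besselCoeff a ε (j + 2) =
      -besselCoeff a ε (j + 1) + ε / 16 * besselCoeff a ε j := by
  have hj : (0 : ℝ) ≤ j := j.cast_nonneg
  have h1 : (j : ℝ) + 2 + a ≠ 0 := by linarith
  have h2 : (j : ℝ) + 2 ≠ 0 := by linarith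
  rw [besselCoeff]
  field_simp

lemma besselCoeff_zero_succ (ha : -1 < a) (j : ℕ) :
    4 * ((j : ℝ) + 1) * (j + 1 + a) * besselCoeff a 0 (j + 1) = -besselCoeff a 0 j := by
  rcases j with _ | j
  · have : 1 + a ≠ 0 := by linarith
    rw [zero_add, besselCoeff_zero, besselCoeff_one]
    push_cast
    rw [zero_add]
    field_simp
  · have h := besselCoeff_add_two ha 0 j
    push_cast
    linear_combination h

lemma besselCoeffZero_pos (ha : -1 < a) (ε : ℝ) : 0 < besselCoeff a ε 0 := by
  rw [besselCoeff_zero]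
  have := Real.Gamma_pos_of_pos (show 0 < a + 1 by linarith)
  positivity

lemma abs_besselCoeff_le (ha : -1 < a) {ε : ℝ} (hε : |ε| ≤ 1) (j : ℕ) :
    |besselCoeff a ε j| ≤ besselCoeff a 0 0 * coeffRate a ^ j / j.factorial := by
  have hc := besselCoeffZero_pos ha 0
  have hB := one_le_coeffRate ha
  have ha1 : 0 < 1 + a := by linarith
  refine abs_le_of_recursion ha ?_ ?_ (fun j => ?_) j
  · rw [besselCoeff_zero, besselCoeff_zero a 0] at *
    rw [abs_of_pos hc]
  · rw [besselCoeff_one, ← besselCoeff_zero a 0, abs_div, abs_neg, abs_of_pos hc,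
      abs_of_pos (by linarith), div_eq_mul_inv]
    refine mul_le_mul_of_nonneg_left ?_ hc.le
    have h1 : 1 / (1 + a) ≤ 1 / min 1 (1 + a) :=
      one_div_le_one_div_of_le (lt_min one_pos ha1) (min_le_right _ _)
    have h2 : (4 * (1 + a))⁻¹ ≤ 1 / (1 + a) := by
      rw [one_div]
      exact inv_anti₀ ha1 (by linarith)
    unfold coeffRate
    linarith
  · have hj : (0 : ℝ) ≤ j := j.cast_nonneg
    have h1 := besselCoeff_add_two ha ε j
    have h2 : |4 * ((j : ℝ) + 2) * (j + 2 + a) * besselCoeff a ε (j + 2)| =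
        4 * ((j : ℝ) + 2) * (j + 2 + a) * |besselCoeff a ε (j + 2)| := by
      rw [abs_mul, abs_of_pos (by nlinarith)]
    rw [← h2, h1]
    have h3 : |ε / 16 * besselCoeff a ε j| ≤ |besselCoeff a ε j| := by
      rw [abs_mul, abs_div, abs_of_pos (by norm_num : (0 : ℝ) < 16)]
      exact mul_le_of_le_one_left (abs_nonneg _) (by linarith)
    have h4 : 0 ≤ besselCoeff a 0 0 * coeffRate a ^ j / j.factorial := by positivity
    calc _ ≤ |-besselCoeff a ε (j + 1)| + |ε / 16 * besselCoeff a ε j| := abs_add_le _ _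
      _ ≤ _ := by rw [abs_neg]; linarith

/-- The factor (1 - a²)/24 in `besselCoeffOne` is forced by this cancellation: the first two
coefficients do not depend on ε. -/
lemma besselCoeffOne_one (ha : -1 < a) : besselCoeffOne a 1 = 0 := by
  have h := besselCoeff_zero_succ ha 0
  push_cast at h
  rw [besselCoeffOne]
  push_cast
  linear_combination ((1 - a) / 96) * h

/-- This is the recursion of `besselCoeff` differentiated in ε at 0. With its zero initial values it
identifies the closed form as the true first-order term. -/
lemma besselCoeffOne_add_two (ha : -1 < a) (j : ℕ) :
    4 * ((j : ℝ) + 2) * (j + 2 + a) * besselCoeffOne a (j + 2) =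
      -besselCoeffOne a (j + 1) + 1 / 16 * besselCoeff a 0 j := by
  have h1 := besselCoeff_zero_succ ha j
  have h2 := besselCoeff_zero_succ ha (j + 1)
  rw [besselCoeffOne, besselCoeffOne]
  push_cast at h2 ⊢
  have e1 : besselCoeff a 0 j = -(4 * ((j : ℝ) + 1) * (j + 1 + a) * besselCoeff a 0 (j + 1)) := by
    linarith
  have e2 : besselCoeff a 0 (j + 1) =
      -(4 * ((j : ℝ) + 2) * (j + 2 + a) * besselCoeff a 0 (j + 2)) := by
    linear_combination h2
  rw [e1, e2]
  ring

lemma abs_besselCoeffOne_le (ha : -1 < a) (j : ℕ) :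
    |besselCoeffOne a j| ≤ besselCoeff a 0 0 * coeffRate a ^ j / j.factorial := by
  have hc := besselCoeffZero_pos ha 0
  have hB := one_le_coeffRate ha
  refine abs_le_of_recursion ha ?_ ?_ (fun j => ?_) j
  · simpa [besselCoeffOne] using hc.le
  · rw [besselCoeffOne_one ha, abs_zero]; positivity
  · have hj : (0 : ℝ) ≤ j := j.cast_nonneg
    have h1 := besselCoeffOne_add_two ha j
    have h2 : |4 * ((j : ℝ) + 2) * (j + 2 + a) * besselCoeffOne a (j + 2)| =
        4 * ((j : ℝ) + 2) * (j + 2 + a) * |besselCoeffOne a (j + 2)| := by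
      rw [abs_mul, abs_of_pos (by nlinarith)]
    rw [← h2, h1]
    have h3 := abs_besselCoeff_le ha (ε := 0) (by simp) j
    calc _ ≤ |-besselCoeffOne a (j + 1)| + |1 / 16 * besselCoeff a 0 j| := abs_add_le _ _
      _ ≤ _ := by
        rw [abs_neg, abs_mul, abs_of_pos (by norm_num : (0 : ℝ) < 1 / 16)]
        linarith [abs_nonneg (besselCoeffOne a j), abs_nonneg (besselCoeff a 0 j)]

/-- The remainder of the second order expansion of the coefficients. -/
noncomputable def besselCoeffRem (a ε : ℝ) (j : ℕ) : ℝ :=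
  besselCoeff a ε j - besselCoeff a 0 j - ε * besselCoeffOne a j

/-- The remainder obeys the same recursion with zero initial values and a source ε²/16 times
`besselCoeffOne`; the general bound then carries the factor ε² throughout. -/
lemma abs_besselCoeffRem_le (ha : -1 < a) {ε : ℝ} (hε : |ε| ≤ 1) (j : ℕ) :
    |besselCoeffRem a ε j| ≤ ε ^ 2 * besselCoeff a 0 0 * coeffRate a ^ j / j.factorial := by
  have hc := besselCoeffZero_pos ha 0
  have hB := one_le_coeffRate ha
  refine abs_le_of_recursion ha ?_ ?_ (fun j => ?_) j
  · rw [besselCoeffRem, besselCoeff_zero, besselCoeff_zero a 0, besselCoeffOne]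
    simp only [sub_self, mul_zero, abs_zero]
    rw [← besselCoeff_zero a 0]
    positivity
  · rw [besselCoeffRem, besselCoeff_one, besselCoeff_one, besselCoeffOne_one ha]
    simp only [sub_self, mul_zero, abs_zero]
    positivity
  · have hj : (0 : ℝ) ≤ j := j.cast_nonneg
    have h1 := besselCoeffOne_add_two ha j
    have h1' := besselCoeff_add_two ha ε j
    have h1'' := besselCoeff_add_two ha 0 j
    have h5 : 4 * ((j : ℝ) + 2) * (j + 2 + a) * besselCoeffRem a ε (j + 2) =
        -besselCoeffRem a ε (j + 1) + ε / 16 * besselCoeffRem a ε j +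
          ε ^ 2 / 16 * besselCoeffOne a j := by
      unfold besselCoeffRem
      linear_combination h1' - h1'' - ε * h1
    have h2 : |4 * ((j : ℝ) + 2) * (j + 2 + a) * besselCoeffRem a ε (j + 2)| =
        4 * ((j : ℝ) + 2) * (j + 2 + a) * |besselCoeffRem a ε (j + 2)| := by
      rw [abs_mul, abs_of_pos (by nlinarith)]
    rw [← h2, h5]
    have h3 := abs_besselCoeffOne_le ha j
    have h4 : |ε / 16 * besselCoeffRem a ε j| ≤ |besselCoeffRem a ε j| := by
      rw [abs_mul, abs_div, abs_of_pos (by norm_num : (0 : ℝ) < 16)]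
      exact mul_le_of_le_one_left (abs_nonneg _) (by linarith)
    have h6 : |ε ^ 2 / 16 * besselCoeffOne a j| ≤
        ε ^ 2 * besselCoeff a 0 0 * coeffRate a ^ j / j.factorial := by
      rw [abs_mul, abs_of_nonneg (by positivity : 0 ≤ ε ^ 2 / 16)]
      calc ε ^ 2 / 16 * |besselCoeffOne a j| ≤ ε ^ 2 * |besselCoeffOne a j| := by
            have := mul_nonneg (sq_nonneg ε) (abs_nonneg (besselCoeffOne a j))
            linarith
        _ ≤ ε ^ 2 * (besselCoeff a 0 0 * coeffRate a ^ j / j.factorial) := by gcongr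
        _ = _ := by ring
    calc _ ≤ |-besselCoeffRem a ε (j + 1) + ε / 16 * besselCoeffRem a ε j| +
          |ε ^ 2 / 16 * besselCoeffOne a j| := abs_add_le _ _
      _ ≤ |-besselCoeffRem a ε (j + 1)| + |ε / 16 * besselCoeffRem a ε j| +
          |ε ^ 2 / 16 * besselCoeffOne a j| := by gcongr; exact abs_add_le _ _
      _ ≤ _ := by rw [abs_neg]; linarith

lemma entireCoeff_besselCoeff (ha : -1 < a) {ε : ℝ} (hε : |ε| ≤ 1) :
    EntireCoeff (besselCoeff a ε) := .of_bound (abs_besselCoeff_le ha hε)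

lemma entireCoeff_besselCoeffOne (ha : -1 < a) : EntireCoeff (besselCoeffOne a) :=
  .of_bound (abs_besselCoeffOne_le ha)

lemma entireCoeff_besselCoeffRem (ha : -1 < a) {ε : ℝ} (hε : |ε| ≤ 1) :
    EntireCoeff (besselCoeffRem a ε) := .of_bound (abs_besselCoeffRem_le ha hε)

lemma entireCoeff_besselCoeff_zero (ha : -1 < a) : EntireCoeff (besselCoeff a 0) :=
  entireCoeff_besselCoeff ha (by simp)

/-- The differential equation of the Bessel series, in terms of `z d/dz`. -/
lemma besselSeries_euler (ha : -1 < a) (z : ℝ) :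
    4 * entireSum (fun j => (j : ℝ) * (j * besselCoeff a 0 j)) z +
      4 * a * entireSum (fun j => (j : ℝ) * besselCoeff a 0 j) z =
      -(z * entireSum (besselCoeff a 0) z) := by
  have hc := entireCoeff_besselCoeff_zero ha
  rw [← entireSum_const_mul, ← entireSum_const_mul,
    ← (hc.euler.euler.const_mul 4).sum_add (hc.euler.const_mul (4 * a)), ← hc.sum_shift,
    ← neg_one_mul, ← entireSum_const_mul]
  unfold entireSum
  refine tsum_congr fun j => ?_
  rcases j with _ | j
  · simp
  · have h := besselCoeff_zero_succ ha j
    simp only [Nat.add_eq_zero_iff, one_ne_zero, and_false, if_false, Nat.add_sub_cancel]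
    push_cast
    linear_combination z ^ (j + 1) * h

lemma besselSeriesOne (ha : -1 < a) (z : ℝ) :
    entireSum (besselCoeffOne a) z = ((1 - a) * (z * entireSum (besselCoeff a 0) z) -
      2 * (z * entireSum (fun j => (j : ℝ) * besselCoeff a 0 j) z)) / 96 +
      (1 - a ^ 2) / 24 * entireSum (fun j => (j : ℝ) * besselCoeff a 0 j) z := by
  have hc := entireCoeff_besselCoeff_zero ha
  have h : ((1 - a) * (z * entireSum (besselCoeff a 0) z) -
      2 * (z * entireSum (fun j => (j : ℝ) * besselCoeff a 0 j) z)) / 96 +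
      (1 - a ^ 2) / 24 * entireSum (fun j => (j : ℝ) * besselCoeff a 0 j) z =
      ((1 - a) / 96 * (z * entireSum (besselCoeff a 0) z) +
      (-2 / 96) * (z * entireSum (fun j => (j : ℝ) * besselCoeff a 0 j) z)) +
      (1 - a ^ 2) / 24 * entireSum (fun j => (j : ℝ) * besselCoeff a 0 j) z := by ring
  rw [h, ← hc.sum_shift, ← hc.euler.sum_shift, ← entireSum_const_mul, ← entireSum_const_mul,
    ← entireSum_const_mul, ← (hc.shift.const_mul _).sum_add (hc.euler.shift.const_mul _),
    ← ((hc.shift.const_mul _).add (hc.euler.shift.const_mul _)).sum_add (hc.euler.const_mul _)]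
  unfold entireSum
  refine tsum_congr fun j => ?_
  rcases j with _ | j
  · simp [besselCoeffOne]
  · rw [besselCoeffOne]
    simp only [Nat.add_eq_zero_iff, one_ne_zero, and_false, if_false, Nat.add_sub_cancel]
    push_cast
    ring

end BesselSeries

/-! ### Bessel's equation, the first-order correction and its integral -/

section BesselFunctions

/-- The function `s ^ a * ∑ c_j s ^ (2 j)`. -/
noncomputable def frobSeries (a : ℝ) (c : ℕ → ℝ) (s : ℝ) : ℝ := s ^ a * entireSum c (s ^ 2)

/-- The image of `frobSeries a c` under `s d/ds`. -/
noncomputable def frobSeriesEuler (a : ℝ) (c : ℕ → ℝ) (s : ℝ) : ℝ :=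
  s ^ a * (a * entireSum c (s ^ 2) + 2 * entireSum (fun j => (j : ℝ) * c j) (s ^ 2))

variable {a : ℝ}

lemma hasDerivAt_frobSeries {c : ℕ → ℝ} (hc : EntireCoeff c) {s : ℝ} (hs : 0 < s) :
    HasDerivAt (frobSeries a c) (frobSeriesEuler a c s / s) s := by
  have h1 := Real.hasDerivAt_rpow_const (x := s) (p := a) (Or.inl hs.ne')
  have h2 : HasDerivAt (fun s : ℝ => s ^ 2) (2 * s) s := by simpa using hasDerivAt_pow 2 s
  have h3 := (hc.hasDerivAt (s ^ 2)).comp s h2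
  refine (h1.mul h3).congr_deriv ?_
  have h4 := hc.sum_euler (s ^ 2)
  rw [frobSeriesEuler, h4, Real.rpow_sub_one hs.ne', Function.comp_apply]
  field_simp

lemma hasDerivAt_frobSeriesEuler {c : ℕ → ℝ} (hc : EntireCoeff c) {s : ℝ} (hs : 0 < s) :
    HasDerivAt (frobSeriesEuler a c) (s ^ a * (a ^ 2 * entireSum c (s ^ 2) +
      4 * a * entireSum (fun j => (j : ℝ) * c j) (s ^ 2) +
      4 * entireSum (fun j => (j : ℝ) * (j * c j)) (s ^ 2)) / s) s := by
  have h1 := (hasDerivAt_frobSeries (a := a) hc hs).const_mul a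
  have h2 := (hasDerivAt_frobSeries (a := a) hc.euler hs).const_mul 2
  have h3 := h1.add h2
  have h4 : frobSeriesEuler a c = (fun x => a * frobSeries a c x) +
      fun x => 2 * frobSeries a (fun j => (j : ℝ) * c j) x := by
    ext x
    simp only [frobSeriesEuler, frobSeries, Pi.add_apply]
    ring
  rw [h4]
  refine h3.congr_deriv ?_
  simp only [frobSeriesEuler]
  ring

lemma besselCoeff_zero_eq (ha : -1 < a) (k : ℕ) :
    besselCoeff a 0 k = (-1) ^ k / (k.factorial * Real.Gamma (k + a + 1)) / (2 ^ (2 * k) * 2 ^ a) := by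
  have h2a : (0 : ℝ) < 2 ^ a := by positivity
  induction k with
  | zero =>
    rw [besselCoeff_zero]
    simp
    field_simp
  | succ k ih =>
    have hk : (0 : ℝ) ≤ k := k.cast_nonneg
    have h := besselCoeff_zero_succ ha k
    have h1 := Gamma_nat_add_ne_zero ha k
    have h2 : (k : ℝ) + 1 + a ≠ 0 := by linarith
    have h2' : (k : ℝ) + a + 1 ≠ 0 := by linarith
    have h3 : (k : ℝ) + 1 ≠ 0 := by linarith
    have h4 : (k.factorial : ℝ) ≠ 0 := Nat.cast_ne_zero.mpr k.factorial_ne_zero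
    rw [ih] at h
    rw [Gamma_nat_succ_add ha, Nat.factorial_succ, show 2 * (k + 1) = 2 * k + 2 by ring, pow_add]
    have h5 : besselCoeff a 0 (k + 1) = -((-1) ^ k / (k.factorial * Real.Gamma (k + a + 1)) /
        (2 ^ (2 * k) * 2 ^ a)) / (4 * ((k : ℝ) + 1) * (k + 1 + a)) := by
      rw [eq_div_iff (by positivity), ← h]
      ring
    rw [h5]
    push_cast
    rw [show (k : ℝ) + 1 + a = k + a + 1 by ring]
    field_simp
    ring

lemma besselJ_eq (ha : -1 < a) {s : ℝ} (hs : 0 < s) :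
    besselJ a s = frobSeries a (besselCoeff a 0) s := by
  rw [besselJ, frobSeries, entireSum, ← tsum_mul_left]
  refine tsum_congr fun k => ?_
  have h2a : (0 : ℝ) < 2 ^ a := by positivity
  rw [besselCoeff_zero_eq ha, Real.rpow_add (by positivity), Real.div_rpow hs.le two_pos.le,
    Real.div_rpow hs.le two_pos.le, show (2 * (k : ℝ)) = ((2 * k : ℕ) : ℝ) by push_cast; ring,
    Real.rpow_natCast, Real.rpow_natCast, ← pow_mul]
  field_simp

lemma eventuallyEq_besselJ (ha : -1 < a) {s : ℝ} (hs : 0 < s) :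
    besselJ a =ᶠ[𝓝 s] frobSeries a (besselCoeff a 0) := by
  filter_upwards [lt_mem_nhds hs] with t ht
  exact besselJ_eq ha ht

/-- The function `s J'(s)`. -/
noncomputable def besselEuler (a s : ℝ) : ℝ := frobSeriesEuler a (besselCoeff a 0) s

lemma hasDerivAt_besselJ (ha : -1 < a) {s : ℝ} (hs : 0 < s) :
    HasDerivAt (besselJ a) (besselEuler a s / s) s :=
  (hasDerivAt_frobSeries (entireCoeff_besselCoeff_zero ha) hs).congr_of_eventuallyEq
    (eventuallyEq_besselJ ha hs)

lemma deriv_besselJ (ha : -1 < a) {s : ℝ} (hs : 0 < s) :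
    deriv (besselJ a) s = besselEuler a s / s := (hasDerivAt_besselJ ha hs).deriv

/-- Bessel's equation. -/
lemma hasDerivAt_besselEuler (ha : -1 < a) {s : ℝ} (hs : 0 < s) :
    HasDerivAt (besselEuler a) ((a ^ 2 - s ^ 2) * besselJ a s / s) s := by
  refine (hasDerivAt_frobSeriesEuler (a := a) (entireCoeff_besselCoeff_zero ha) hs).congr_deriv ?_
  have h := besselSeries_euler ha (s ^ 2)
  rw [besselJ_eq ha hs, frobSeries]
  linear_combination (s ^ a / s) * h

/-- The first order correction to the Bessel function. -/
noncomputable def besselOne (a s : ℝ) : ℝ :=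
  (s ^ 2 * besselJ a s - s ^ 2 * besselEuler a s) / 96 +
    (1 - a ^ 2) / 48 * (besselEuler a s - a * besselJ a s)

/-- The image of `besselOne` under `s d/ds`. -/
noncomputable def besselOneEuler (a s : ℝ) : ℝ :=
  (2 * s ^ 2 * besselJ a s - s ^ 2 * besselEuler a s -
    s ^ 2 * ((a ^ 2 - s ^ 2) * besselJ a s)) / 96 +
    (1 - a ^ 2) / 48 * ((a ^ 2 - s ^ 2) * besselJ a s - a * besselEuler a s)

lemma frobSeries_besselCoeffOne (ha : -1 < a) {s : ℝ} (hs : 0 < s) :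
    frobSeries a (besselCoeffOne a) s = besselOne a s := by
  rw [frobSeries, besselSeriesOne ha, besselOne, besselJ_eq ha hs, frobSeries, besselEuler,
    frobSeriesEuler]
  ring

lemma hasDerivAt_besselOne (ha : -1 < a) {s : ℝ} (hs : 0 < s) :
    HasDerivAt (besselOne a) (besselOneEuler a s / s) s := by
  have hJ := hasDerivAt_besselJ ha hs
  have hE := hasDerivAt_besselEuler ha hs
  have h2 : HasDerivAt (fun s : ℝ => s ^ 2) (2 * s) s := by simpa using hasDerivAt_pow 2 s
  have h := (((h2.mul hJ).sub (h2.mul hE)).div_const 96).add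
    ((hE.sub (hJ.const_mul a)).const_mul ((1 - a ^ 2) / 48))
  refine h.congr_deriv ?_
  rw [besselOneEuler]
  field_simp
  ring

/-- Differentiating the closed form already found for the series and using uniqueness of derivatives
spares a second manipulation of coefficients. -/
lemma frobSeriesEuler_besselCoeffOne (ha : -1 < a) {s : ℝ} (hs : 0 < s) :
    frobSeriesEuler a (besselCoeffOne a) s = besselOneEuler a s := by
  have h1 := hasDerivAt_frobSeries (a := a) (entireCoeff_besselCoeffOne ha) hs
  have h2 : frobSeries a (besselCoeffOne a) =ᶠ[𝓝 s] besselOne a := by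
    filter_upwards [lt_mem_nhds hs] with t ht
    exact frobSeries_besselCoeffOne ha ht
  have h3 := h1.unique ((hasDerivAt_besselOne ha hs).congr_of_eventuallyEq h2)
  rwa [div_left_inj' hs.ne'] at h3

lemma besselCoeff_expand (a ε : ℝ) : besselCoeff a ε =
    fun j => (besselCoeff a 0 j + ε * besselCoeffOne a j) + besselCoeffRem a ε j := by
  ext j
  rw [besselCoeffRem]
  ring

lemma frobSeries_expand (ha : -1 < a) {ε : ℝ} (hε : |ε| ≤ 1) {s : ℝ} (hs : 0 < s) :
    frobSeries a (besselCoeff a ε) s =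
      besselJ a s + ε * besselOne a s + frobSeries a (besselCoeffRem a ε) s := by
  have h0 := entireCoeff_besselCoeff_zero ha
  have h1 := (entireCoeff_besselCoeffOne ha).const_mul ε
  have h2 := entireCoeff_besselCoeffRem ha hε
  rw [besselJ_eq ha hs, ← frobSeries_besselCoeffOne ha hs]
  simp only [frobSeries]
  rw [besselCoeff_expand a ε, (h0.add h1).sum_add h2, h0.sum_add h1, entireSum_const_mul]
  ring

lemma frobSeriesEuler_expand (ha : -1 < a) {ε : ℝ} (hε : |ε| ≤ 1) {s : ℝ} (hs : 0 < s) :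
    frobSeriesEuler a (besselCoeff a ε) s =
      besselEuler a s + ε * besselOneEuler a s + frobSeriesEuler a (besselCoeffRem a ε) s := by
  have h0 := entireCoeff_besselCoeff_zero ha
  have h1 := (entireCoeff_besselCoeffOne ha).const_mul ε
  have h2 := entireCoeff_besselCoeffRem ha hε
  rw [← frobSeriesEuler_besselCoeffOne ha hs]
  simp only [besselEuler, frobSeriesEuler]
  have e : (fun j : ℕ => (j : ℝ) * besselCoeff a ε j) = fun j : ℕ =>
      ((j : ℝ) * besselCoeff a 0 j + ε * ((j : ℝ) * besselCoeffOne a j)) +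
        (j : ℝ) * besselCoeffRem a ε j := by
    ext j
    rw [besselCoeffRem]
    ring
  rw [e, besselCoeff_expand a ε, (h0.add h1).sum_add h2, h0.sum_add h1, entireSum_const_mul,
    (h0.euler.add ((entireCoeff_besselCoeffOne ha).euler.const_mul ε)).sum_add h2.euler,
    h0.euler.sum_add ((entireCoeff_besselCoeffOne ha).euler.const_mul ε), entireSum_const_mul]
  ring

/-- Uniform bounds on the remainder. -/
lemma exists_bound_frobSeries_rem (ha : -1 < a) (S : ℝ) : ∃ K : ℝ, 0 ≤ K ∧ ∀ ε s : ℝ, |ε| ≤ 1 →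
    0 ≤ s → s ≤ S → |frobSeries a (besselCoeffRem a ε) s| ≤ K * ε ^ 2 * s ^ a ∧
      |frobSeriesEuler a (besselCoeffRem a ε) s| ≤ K * ε ^ 2 * s ^ a := by
  have hc := besselCoeffZero_pos ha 0
  have hB := one_le_coeffRate ha
  set B := coeffRate a with hBdef
  set D := besselCoeff a 0 0 * Real.exp (B * S ^ 2) with hD
  have hD0 : 0 ≤ D := by positivity
  -- The factor s^a is kept out of the constant: for negative `a` it is unbounded near 0 but still
  -- integrable, which is what the integral of the remainder needs.
  refine ⟨D + |a| * D + 2 * (S ^ 2 * (D * B)), by positivity, fun ε s hε hs hsS => ?_⟩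
  have hb := abs_besselCoeffRem_le ha hε
  have hz : |s ^ 2| ≤ S ^ 2 := by rw [abs_of_nonneg (by positivity)]; gcongr
  have h1 := EntireCoeff.abs_sum_le (by positivity) hb hz
  have h2 := EntireCoeff.abs_sum_le (by positivity) (derivCoeff_bound hb) hz
  have hsa : 0 ≤ s ^ a := Real.rpow_nonneg hs a
  have h1' : |entireSum (besselCoeffRem a ε) (s ^ 2)| ≤ D * ε ^ 2 := h1.trans_eq (by rw [hD]; ring)
  have h2' : |entireSum (derivCoeff (besselCoeffRem a ε)) (s ^ 2)| ≤ D * B * ε ^ 2 :=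
    h2.trans_eq (by rw [hD]; ring)
  have h3 : |entireSum (fun j => (j : ℝ) * besselCoeffRem a ε j) (s ^ 2)| ≤
      S ^ 2 * (D * B * ε ^ 2) := by
    rw [(entireCoeff_besselCoeffRem ha hε).sum_euler, abs_mul]
    gcongr
  have hn1 : 0 ≤ |a| * D * ε ^ 2 := by positivity
  have hn2 : 0 ≤ 2 * (S ^ 2 * (D * B)) * ε ^ 2 := by positivity
  have hn3 : 0 ≤ D * ε ^ 2 := by positivity
  constructor
  · rw [frobSeries, abs_mul, abs_of_nonneg hsa, mul_comm]
    refine mul_le_mul_of_nonneg_right ?_ hsa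
    nlinarith
  · rw [frobSeriesEuler, abs_mul, abs_of_nonneg hsa, mul_comm]
    refine mul_le_mul_of_nonneg_right ?_ hsa
    calc _ ≤ |a * entireSum (besselCoeffRem a ε) (s ^ 2)| +
          |2 * entireSum (fun j => (j : ℝ) * besselCoeffRem a ε j) (s ^ 2)| := abs_add_le _ _
      _ ≤ |a| * (D * ε ^ 2) + 2 * (S ^ 2 * (D * B * ε ^ 2)) := by
        rw [abs_mul, abs_mul, abs_of_pos (two_pos : (0 : ℝ) < 2)]
        gcongr
      _ ≤ _ := by nlinarith

lemma intervalIntegrable_frobSeries (ha : -1 < a) {c : ℕ → ℝ} (hc : EntireCoeff c) (s t : ℝ) :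
    IntervalIntegrable (frobSeries a c) volume s t := by
  unfold frobSeries
  refine (intervalIntegral.intervalIntegrable_rpow' ha).mul_continuousOn ?_
  exact (hc.continuous.comp (continuous_pow 2)).continuousOn

lemma intervalIntegrable_besselJ (ha : -1 < a) {s t : ℝ} (hs : 0 ≤ s) (ht : 0 ≤ t) :
    IntervalIntegrable (besselJ a) volume s t := by
  refine (intervalIntegrable_frobSeries ha (entireCoeff_besselCoeff_zero ha) s t).congr ?_
  intro u hu
  have : 0 < u := by
    rw [Set.mem_uIoc] at hu
    rcases hu with h | h <;> linarith
  exact (besselJ_eq ha this).symm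

lemma intervalIntegrable_sq_mul_besselJ (ha : -1 < a) {s t : ℝ} (hs : 0 ≤ s) (ht : 0 ≤ t) :
    IntervalIntegrable (fun u => u ^ 2 * besselJ a u) volume s t :=
  (intervalIntegrable_besselJ ha hs ht).continuousOn_mul (continuous_pow 2).continuousOn

lemma intervalIntegrable_besselOne (ha : -1 < a) {s t : ℝ} (hs : 0 ≤ s) (ht : 0 ≤ t) :
    IntervalIntegrable (besselOne a) volume s t := by
  refine (intervalIntegrable_frobSeries ha (entireCoeff_besselCoeffOne ha) s t).congr ?_
  intro u hu
  have : 0 < u := by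
    rw [Set.mem_uIoc] at hu
    rcases hu with h | h <;> linarith
  exact frobSeries_besselCoeffOne ha this

/-- The integral appearing at first order, in closed form. -/
lemma integral_besselOne_sub (ha : -1 < a) {s : ℝ} (hs : 0 < s) :
    ∫ t in (0 : ℝ)..s, (besselOne a t - t ^ 2 / 8 * besselJ a t) =
      (1 - a ^ 2) * (3 - a) / 48 * (∫ t in (0 : ℝ)..s, besselJ a t) -
        s * (((3 + a ^ 2) / 48 + s ^ 2 / 96) * besselJ a s - 1 / 12 * besselEuler a s) := by
  -- `F` is an antiderivative up to the multiple (1 - a²)(3 - a)/48 of the Bessel function. The same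
  -- constant appears in `hardConst_firstOrder`, so the two merge into a multiple of `besselJI`.
  set F : ℝ → ℝ := fun t => -(t * (((3 + a ^ 2) / 48 + t ^ 2 / 96) * frobSeries a (besselCoeff a 0) t -
    1 / 12 * besselEuler a t)) with hF
  have hc := entireCoeff_besselCoeff_zero ha
  have hcont : ContinuousOn F (Set.Icc 0 s) := by
    -- Absorbing the factor `t` into t^(a+1) gives continuity at 0, where t^a alone may blow up.
    have h1 : ContinuousOn (fun t : ℝ => -(t ^ (a + 1) * (((3 + a ^ 2) / 48 + t ^ 2 / 96) *
        entireSum (besselCoeff a 0) (t ^ 2) - 1 / 12 * (a * entireSum (besselCoeff a 0) (t ^ 2) +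
          2 * entireSum (fun j => (j : ℝ) * besselCoeff a 0 j) (t ^ 2))))) (Set.Icc 0 s) := by
      have h2 := hc.continuous
      have h3 := hc.euler.continuous
      have h4 : Continuous fun t : ℝ => t ^ (a + 1) := Real.continuous_rpow_const (by linarith)
      fun_prop
    refine h1.congr fun t ht => ?_
    simp only [hF, frobSeries, besselEuler, frobSeriesEuler]
    rcases ht.1.eq_or_lt with h | h
    · rw [← h, Real.zero_rpow (show a + 1 ≠ 0 by linarith)]
      simp
    · rw [Real.rpow_add_one h.ne']
      ring
  have hd : ∀ t ∈ Set.Ioo 0 s, HasDerivAt F (besselOne a t - t ^ 2 / 8 * besselJ a t -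
      (1 - a ^ 2) * (3 - a) / 48 * besselJ a t) t := by
    intro t ht
    have ht0 : 0 < t := ht.1
    have hJ := hasDerivAt_frobSeries (a := a) hc ht0
    have hE := hasDerivAt_besselEuler ha ht0
    have h2 : HasDerivAt (fun s : ℝ => (3 + a ^ 2) / 48 + s ^ 2 / 96) (2 * t / 96) t := by
      have : HasDerivAt (fun s : ℝ => s ^ 2) (2 * t) t := by simpa using hasDerivAt_pow 2 t
      exact (this.div_const 96).const_add _
    have h := ((hasDerivAt_id t).mul ((h2.mul hJ).sub (hE.const_mul (1 / 12)))).neg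
    refine h.congr_deriv ?_
    rw [besselOne, besselJ_eq ha ht0]
    change _ = (t ^ 2 * _ - t ^ 2 * besselEuler a t) / 96 + _ - _ - _
    have : frobSeriesEuler a (besselCoeff a 0) t = besselEuler a t := rfl
    simp only [Pi.mul_apply, Pi.sub_apply, id, this]
    field_simp
    ring
  have hi1 : IntervalIntegrable (fun t => besselOne a t - t ^ 2 / 8 * besselJ a t) volume 0 s := by
    refine (intervalIntegrable_besselOne ha le_rfl hs.le).sub ?_
    refine ((intervalIntegrable_sq_mul_besselJ ha le_rfl hs.le).const_mul (1 / 8)).congr ?_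
    intro t _
    simp only
    ring
  have hi2 := (intervalIntegrable_besselJ ha le_rfl hs.le).const_mul ((1 - a ^ 2) * (3 - a) / 48)
  have h := intervalIntegral.integral_eq_sub_of_hasDerivAt_of_le hs.le hcont hd (hi1.sub hi2)
  rw [intervalIntegral.integral_sub hi1 hi2, intervalIntegral.integral_const_mul] at h
  have hF0 : F 0 = 0 := by simp [hF]
  rw [hF0] at h
  simp only [hF, ← besselJ_eq ha hs] at h
  linarith

end BesselFunctions

/-! ### Christoffel-Darboux sum and Laguerre functions as deformed Bessel series -/

section LaguerreClosedForms

variable {a : ℝ}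

/-- The Euler operator `x d/dx` applied to a Laguerre polynomial, in terms of the preceding one. -/
lemma laguerrePoly_euler_succ (ha : -1 < a) (n : ℕ) :
    X * derivative (laguerrePoly a (n + 1)) =
      X * derivative (laguerrePoly a n) - 2 * X * laguerrePoly a n := by
  rw [laguerrePoly_lower ha, laguerrePoly_raise ha]
  have : (C ((n : ℝ) + 1 + a) : ℝ[X]) = C ((n : ℝ) + a + 1) := by congr 1; ring
  rw [this]
  ring

/-- Laguerre's equation in terms of the Euler operator. -/
lemma laguerrePoly_ode (ha : -1 < a) (n : ℕ) :
    X * derivative (X * derivative (laguerrePoly a n)) +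
      (C a - 2 * X) * (X * derivative (laguerrePoly a n)) +
        C (2 * (n : ℝ)) * X * laguerrePoly a n = 0 := by
  have h1 := congrArg (fun p => X * derivative p) (laguerrePoly_raise ha n)
  have h2 := laguerrePoly_euler_succ ha n
  simp only [derivative_mul, derivative_C, zero_mul, zero_add, derivative_add, derivative_sub,
    derivative_X, derivative_ofNat, mul_one, one_mul, zero_sub] at h1
  simp only [derivative_mul, derivative_X, one_mul]
  have e1 : (C ((n : ℝ) + a + 1) : ℝ[X]) = C (n : ℝ) + C a + 1 := by simp
  have e2 : (C ((n : ℝ) + 1) : ℝ[X]) = C (n : ℝ) + 1 := by simp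
  have e3 : (C (2 * (n : ℝ)) : ℝ[X]) = 2 * C (n : ℝ) := by rw [C_mul]; rfl
  rw [e1, e2] at h1
  rw [e3]
  linear_combination (C (n : ℝ) + 1) * h2 - h1

/-- The diagonal Christoffel-Darboux sum in closed form. -/
lemma laguerre_kernel_sum (ha : -1 < a) (n : ℕ) (x : ℝ) :
    2 * x * laguerreNorm a n *
        ∑ k ∈ Finset.range n, (laguerrePoly a k).eval x ^ 2 / laguerreNorm a k =
      2 * n * x * (laguerrePoly a n).eval x ^ 2 +
        (a - 2 * x) * (laguerrePoly a n).eval x * (x * (derivative (laguerrePoly a n)).eval x) +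
        (x * (derivative (laguerrePoly a n)).eval x) ^ 2 := by
  induction n with
  | zero => simp [laguerrePoly_zero ha]
  | succ n ih =>
    have h1 := congrArg (eval x) (laguerrePoly_raise ha n)
    have h2 := congrArg (eval x) (laguerrePoly_euler_succ ha n)
    simp only [eval_mul, eval_add, eval_sub, eval_C, eval_X, eval_ofNat] at h1 h2
    have hh := laguerreNorm_succ ha n
    have h0 := (laguerreNorm_pos ha n).ne'
    have hn : (n : ℝ) + 1 ≠ 0 := by positivity
    rw [Finset.sum_range_succ, h2]
    refine mul_left_cancel₀ hn ?_
    set L := eval x (laguerrePoly a n)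
    set L' := eval x (laguerrePoly a (n + 1))
    set D := eval x (derivative (laguerrePoly a n))
    set S := ∑ k ∈ Finset.range n, (laguerrePoly a k).eval x ^ 2 / laguerreNorm a k
    have h3 : ((n : ℝ) + 1) * (2 * x * laguerreNorm a (n + 1) * (S + L ^ 2 / laguerreNorm a n)) =
        (n + 1 + a) * (2 * x * laguerreNorm a n * S + 2 * x * L ^ 2) := by
      field_simp
      linear_combination x * (S * laguerreNorm a n + L ^ 2) * hh
    rw [h3, ih]
    push_cast
    linear_combination (-2 * x * ((n + 1) * L' + (x * D + (n + a + 1 - 2 * x) * L)) -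
      (a - 2 * x) * (x * D - 2 * x * L)) * h1

/-- The lowered polynomial up to an exact derivative. -/
lemma lowerIntegral_laguerreLow (ha : -1 < a) (n : ℕ) {x : ℝ} (hx : 0 < x) :
    lowerIntegral a (laguerreLow a n) x =
      lowerIntegral a ((C ((n : ℝ) + (a + 1) / 2) - X) * laguerrePoly a n) x -
        x * loeWeight a x * (laguerrePoly a n).eval x := by
  have h : laguerreLow a n = (C ((n : ℝ) + (a + 1) / 2) - X) * laguerrePoly a n +
      C (-1) * skewOp a (laguerrePoly a n) := by
    rw [laguerreLow, skewOp]
    simp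
    ring
  rw [h, lowerIntegral_add ha, lowerIntegral_C_mul, lowerIntegral_skewOp ha _ hx.le,
    weightFlux_of_pos _ hx]
  ring

/-- The power series of `exp (-x)` times a Laguerre polynomial. -/
noncomputable def laguerreExpSeries (a : ℝ) (n : ℕ) : PowerSeries ℝ :=
  (laguerrePoly a n : PowerSeries ℝ) * PowerSeries.mk fun k => (-1 : ℝ) ^ k / k.factorial

/-- Multiplication by e^(-x) removes the term x·(x d/dx) from Laguerre's equation. What remains is a
three-term recursion in which `n` occurs only through 2n + a + 1. -/
lemma laguerreExpSeries_ode (ha : -1 < a) (n : ℕ) :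
    let D := laguerreExpSeries a n
    PowerSeries.X * PowerSeries.derivative ℝ (PowerSeries.X * PowerSeries.derivative ℝ D) +
      PowerSeries.C a * (PowerSeries.X * PowerSeries.derivative ℝ D) =
      PowerSeries.X ^ 2 * D - PowerSeries.C (2 * (n : ℝ) + a + 1) * PowerSeries.X * D := by
  intro D
  have hE : PowerSeries.derivative ℝ (PowerSeries.mk fun k => (-1 : ℝ) ^ k / k.factorial) =
      -PowerSeries.mk fun k => (-1 : ℝ) ^ k / k.factorial := by
    ext k
    have hk : (k : ℝ) + 1 ≠ 0 := by positivity
    simp only [PowerSeries.coeff_derivative, PowerSeries.coeff_mk, map_neg, Nat.factorial_succ]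
    push_cast
    field_simp
    ring
  have hA := congrArg (fun p : ℝ[X] => (p : PowerSeries ℝ)) (laguerrePoly_ode ha n)
  set E := PowerSeries.mk fun k => (-1 : ℝ) ^ k / k.factorial
  have hD : D = (laguerrePoly a n : PowerSeries ℝ) * E := rfl
  have e1 : (PowerSeries.C (2 * (n : ℝ) + a + 1) : PowerSeries ℝ) =
      PowerSeries.C (2 * (n : ℝ)) + PowerSeries.C a + 1 := by simp
  simp only [coe_add, coe_mul, coe_sub, coe_C, coe_X, coe_zero, ← PowerSeries.derivative_coe] at hA
  have e2 : ((2 : ℝ[X]) : PowerSeries ℝ) = 2 := by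
    rw [show (2 : ℝ[X]) = 1 + 1 by norm_num, coe_add, coe_one]
    norm_num
  rw [e2] at hA
  rw [hD, e1]
  simp only [Derivation.leibniz, hE, smul_eq_mul, PowerSeries.derivative_X, map_add, map_neg,
    mul_one] at hA ⊢
  linear_combination E * hA

lemma laguerreExpSeries_coeff_zero (n : ℕ) : PowerSeries.coeff 0 (laguerreExpSeries a n) =
    2 ^ a * (Real.Gamma (n + a + 1) / n.factorial) * besselCoeff a 0 0 := by
  have h2 : (2 : ℝ) ^ a ≠ 0 := by positivity
  rw [laguerreExpSeries, PowerSeries.coeff_mul, besselCoeff_zero]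
  simp only [Finset.Nat.antidiagonal_zero, Finset.sum_singleton, coeff_coe, laguerrePoly_coeff,
    laguerreCoeff, PowerSeries.coeff_mk]
  simp
  field_simp

/-- Write d_j for the coefficients. They satisfy j(j+a) d_j = d_{j-2} - 2κ d_{j-1}; dividing d_j by
(8κ)^j turns this into the recursion of `besselCoeff` with ε = 1/κ². This fixes the scale x =
s²/(8κ). -/
lemma laguerreExpSeries_coeff (ha : -1 < a) (n : ℕ) (j : ℕ) {κ : ℝ} (hκ : κ = n + (a + 1) / 2)
    (hκ0 : 0 < κ) : PowerSeries.coeff j (laguerreExpSeries a n) =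
    2 ^ a * (Real.Gamma (n + a + 1) / n.factorial) * (besselCoeff a (1 / κ ^ 2) j * (8 * κ) ^ j) := by
  have hode := laguerreExpSeries_ode ha n
  have h2κ : 2 * (n : ℝ) + a + 1 = 2 * κ := by rw [hκ]; ring
  simp only [h2κ] at hode
  set D := laguerreExpSeries a n
  induction j using Nat.strong_induction_on with
  | _ j ih =>
    rcases j with _ | _ | j
    · rw [laguerreExpSeries_coeff_zero, besselCoeff_zero, besselCoeff_zero]
      simp
    · have h0 := ih 0 (by omega)
      have hc := congrArg (PowerSeries.coeff (0 + 1)) hode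
      simp only [mul_assoc, map_add, map_sub, PowerSeries.coeff_C_mul, PowerSeries.coeff_succ_X_mul,
        PowerSeries.coeff_derivative, pow_two, PowerSeries.coeff_zero_X_mul] at hc
      have h1a : 1 + a ≠ 0 := by linarith
      have h2 : (1 + a) * PowerSeries.coeff 1 D = -(2 * κ) * PowerSeries.coeff 0 D := by
        simp only [Nat.cast_zero, zero_add, mul_one, zero_sub] at hc
        linarith
      refine mul_left_cancel₀ h1a (h2.trans ?_)
      rw [h0, zero_add, besselCoeff_zero, besselCoeff_one]
      field_simp
      ring
    · have h0 := ih j (by omega)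
      have h1 := ih (j + 1) (by omega)
      have hc := congrArg (PowerSeries.coeff (j + 2)) hode
      simp only [mul_assoc, map_add, map_sub, PowerSeries.coeff_C_mul, PowerSeries.coeff_succ_X_mul,
        PowerSeries.coeff_derivative, pow_two] at hc
      have hj : (0 : ℝ) ≤ j := j.cast_nonneg
      have h1a : (j : ℝ) + 2 ≠ 0 := by linarith
      have h1b : (j : ℝ) + 2 + a ≠ 0 := by linarith
      have h2 : 4 * ((j : ℝ) + 2) * (j + 2 + a) * PowerSeries.coeff (j + 2) D =
          4 * (-(2 * κ) * PowerSeries.coeff (j + 1) D + PowerSeries.coeff j D) := by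
        push_cast at hc
        linarith
      have h3 := besselCoeff_add_two ha (1 / κ ^ 2) j
      refine mul_left_cancel₀ (by positivity : 4 * ((j : ℝ) + 2) * (j + 2 + a) ≠ 0) (h2.trans ?_)
      rw [h0, h1, show ∀ G : ℝ, 4 * ((j : ℝ) + 2) * (j + 2 + a) *
        (G * (besselCoeff a (1 / κ ^ 2) (j + 2) * (8 * κ) ^ (j + 2))) =
        G * ((4 * ((j : ℝ) + 2) * (j + 2 + a) * besselCoeff a (1 / κ ^ 2) (j + 2)) *
          (8 * κ) ^ (j + 2)) from fun G => by ring, h3]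
      field_simp
      ring

/-- The Laguerre function as a deformed Bessel series. -/
lemma exp_neg_mul_laguerrePoly (ha : -1 < a) (n : ℕ) {κ : ℝ} (hκ : κ = n + (a + 1) / 2) (x : ℝ) :
    Real.exp (-x) * (laguerrePoly a n).eval x =
      2 ^ a * (Real.Gamma (n + a + 1) / n.factorial) *
        entireSum (besselCoeff a (1 / κ ^ 2)) (8 * κ * x) := by
  have hκ0 : 0 < κ := by
    have : (0 : ℝ) ≤ n := n.cast_nonneg
    rw [hκ]; linarith
  have hL : (laguerrePoly a n).eval x = ∑' j, (laguerrePoly a n).coeff j * x ^ j := by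
    rw [eval_eq_sum_range, tsum_eq_sum]
    intro j hj
    rw [coeff_eq_zero_of_natDegree_lt (by simpa using hj), zero_mul]
  have hE : Real.exp (-x) = ∑' k : ℕ, (-1 : ℝ) ^ k / k.factorial * x ^ k := by
    rw [Real.exp_eq_exp_ℝ, NormedSpace.exp_eq_tsum_div]
    refine tsum_congr fun k => ?_
    rw [neg_pow]
    ring
  have hLs : Summable fun j => ‖(laguerrePoly a n).coeff j * x ^ j‖ := by
    refine summable_of_ne_finset_zero (s := Finset.range ((laguerrePoly a n).natDegree + 1)) ?_
    intro j hj
    rw [coeff_eq_zero_of_natDegree_lt (by simpa using hj), zero_mul, norm_zero]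
  have hEs : Summable fun k : ℕ => ‖(-1 : ℝ) ^ k / k.factorial * x ^ k‖ := by
    refine (Real.summable_pow_div_factorial |x|).congr fun k => ?_
    simp
    ring
  rw [mul_comm, hL, hE, tsum_mul_tsum_eq_tsum_sum_antidiagonal_of_summable_norm hLs hEs,
    entireSum, ← tsum_mul_left]
  refine tsum_congr fun j => ?_
  have h := laguerreExpSeries_coeff ha n j hκ hκ0
  rw [laguerreExpSeries, PowerSeries.coeff_mul] at h
  rw [mul_pow, show ∀ G c : ℝ, G * (c * ((8 * κ) ^ j * x ^ j)) = G * (c * (8 * κ) ^ j) * x ^ j from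
    fun G c => by ring, ← h, Finset.sum_mul]
  refine Finset.sum_congr rfl fun p hp => ?_
  rw [← Finset.HasAntidiagonal.mem_antidiagonal.mp hp, pow_add, coeff_coe, PowerSeries.coeff_mk]
  ring

end LaguerreClosedForms

/-! ### The exact density in the hard edge variable -/

section HardEdgeClosedForm

variable {a : ℝ}

/-- The value of a Laguerre function in the hard edge variable. -/
lemma laguerre_scaled (ha : -1 < a) (n : ℕ) {κ : ℝ} (hκ : κ = n + (a + 1) / 2) {s : ℝ}
    (hs : 0 < s) : s ^ a * (Real.exp (-(s ^ 2 / (8 * κ))) * (laguerrePoly a n).eval (s ^ 2 / (8 * κ))) =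
      2 ^ a * (Real.Gamma (n + a + 1) / n.factorial) *
        frobSeries a (besselCoeff a (1 / κ ^ 2)) s := by
  have hκ0 : 0 < κ := by
    have : (0 : ℝ) ≤ n := n.cast_nonneg
    rw [hκ]; linarith
  rw [exp_neg_mul_laguerrePoly ha n hκ, frobSeries,
    show 8 * κ * (s ^ 2 / (8 * κ)) = s ^ 2 by field_simp]
  ring

/-- The value of the Euler operator on a Laguerre function in the hard edge variable. -/
lemma laguerre_euler_scaled (ha : -1 < a) (n : ℕ) {κ : ℝ} (hκ : κ = n + (a + 1) / 2)
    (hκ1 : 1 ≤ κ) {s : ℝ} (hs : 0 < s) {x : ℝ} (hx : x = s ^ 2 / (8 * κ)) :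
    s ^ a * (Real.exp (-x) * (x * (derivative (laguerrePoly a n)).eval x -
        x * (laguerrePoly a n).eval x)) =
      2 ^ a * (Real.Gamma (n + a + 1) / n.factorial) *
        ((frobSeriesEuler a (besselCoeff a (1 / κ ^ 2)) s -
          a * frobSeries a (besselCoeff a (1 / κ ^ 2)) s) / 2) := by
  have hκ0 : 0 < κ := by linarith
  have hε : |1 / κ ^ 2| ≤ 1 := by
    rw [abs_of_pos (by positivity), div_le_one (by positivity)]
    nlinarith
  have hc := entireCoeff_besselCoeff ha hε
  have h1 : HasDerivAt (fun x : ℝ => Real.exp (-x) * (laguerrePoly a n).eval x)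
      (-Real.exp (-x) * (laguerrePoly a n).eval x +
        Real.exp (-x) * (derivative (laguerrePoly a n)).eval x) x := by
    have h2 : HasDerivAt (fun v : ℝ => Real.exp (-v)) (-Real.exp (-x)) x := by
      simpa using (hasDerivAt_neg x).exp
    exact h2.mul ((laguerrePoly a n).hasDerivAt x)
  have h3 : HasDerivAt (fun x : ℝ => 2 ^ a * (Real.Gamma (n + a + 1) / n.factorial) *
      entireSum (besselCoeff a (1 / κ ^ 2)) (8 * κ * x))
      (2 ^ a * (Real.Gamma (n + a + 1) / n.factorial) *
        (entireSum (derivCoeff (besselCoeff a (1 / κ ^ 2))) (8 * κ * x) * (8 * κ))) x := by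
    have h4 : HasDerivAt (fun x : ℝ => 8 * κ * x) (8 * κ) x := by
      simpa using (hasDerivAt_id x).const_mul (8 * κ)
    exact ((hc.hasDerivAt (8 * κ * x)).comp x h4).const_mul _
  have h5 : (fun x : ℝ => Real.exp (-x) * (laguerrePoly a n).eval x) = _ :=
    funext (exp_neg_mul_laguerrePoly ha n hκ)
  rw [h5] at h1
  have h6 := h1.unique h3
  have h7 := hc.sum_euler (s ^ 2)
  have h8 : 8 * κ * x = s ^ 2 := by rw [hx]; field_simp
  rw [h8] at h6
  rw [frobSeriesEuler, frobSeries, h7]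
  linear_combination s ^ a * x * h6 + (2 ^ a * (Real.Gamma (n + a + 1) / n.factorial)) * s ^ a *
    entireSum (derivCoeff (besselCoeff a (1 / κ ^ 2))) (s ^ 2) * h8

/-- The incomplete integral of the weighted Laguerre polynomial in the hard edge variable. -/
lemma lowerIntegral_scaled (ha : -1 < a) (n : ℕ) {κ : ℝ} (hκ : κ = n + (a + 1) / 2)
    (hκ1 : 1 ≤ κ) {s : ℝ} (hs : 0 < s) :
    lowerIntegral a ((C κ - X) * laguerrePoly a n) (s ^ 2 / (8 * κ)) =
      2 ^ a * (Real.Gamma (n + a + 1) / n.factorial) / (4 * (8 * κ) ^ ((a - 1) / 2)) *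
        ∫ t in (0 : ℝ)..s, frobSeries a (besselCoeff a (1 / κ ^ 2)) t * (1 - 1 / κ ^ 2 * t ^ 2 / 8) := by
  have hκ0 : 0 < κ := by linarith
  have hε : |1 / κ ^ 2| ≤ 1 := by
    rw [abs_of_pos (by positivity), div_le_one (by positivity)]
    nlinarith
  have hc := entireCoeff_besselCoeff ha hε
  set p := (C κ - X) * laguerrePoly a n with hp
  set x := s ^ 2 / (8 * κ) with hx
  have hx0 : 0 < x := by positivity
  have h1 : lowerIntegral a p x = ∫ u in (0 : ℝ)..x, loeWeight a u * p.eval u := by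
    rw [lowerIntegral, intervalIntegral.integral_of_le hx0.le, ← Set.Iic_inter_Ioi, Set.inter_comm,
      ← Measure.restrict_restrict measurableSet_Ioi, ← integral_indicator measurableSet_Ioi]
    refine integral_congr_ae (ae_of_all _ fun u => ?_)
    simp only
    rw [Set.indicator_apply]
    split_ifs with hu
    · rfl
    · rw [loeWeight_of_nonpos (not_lt.mp hu), zero_mul]
  set f : ℝ → ℝ := fun t => t ^ 2 / (8 * κ) with hf
  have hpt : ∀ t : ℝ, 0 < t → loeWeight a (f t) * p.eval (f t) * (t / (4 * κ)) =
      2 ^ a * (Real.Gamma (n + a + 1) / n.factorial) / (4 * (8 * κ) ^ ((a - 1) / 2)) *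
        (frobSeries a (besselCoeff a (1 / κ ^ 2)) t * (1 - 1 / κ ^ 2 * t ^ 2 / 8)) := by
    intro t ht
    have hft : 0 < f t := by positivity
    have h2 := laguerre_scaled ha n hκ ht
    have h3 : (f t) ^ ((a - 1) / 2) = t ^ a / t / (8 * κ) ^ ((a - 1) / 2) := by
      rw [hf]
      simp only
      rw [Real.div_rpow (by positivity) (by positivity), ← Real.rpow_natCast, ← Real.rpow_mul ht.le,
        ← Real.rpow_sub_one ht.ne']
      congr 2
      push_cast
      ring
    rw [loeWeight_of_pos hft, h3, hp]
    simp only [eval_mul, eval_sub, eval_C, eval_X]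
    have h4 : (0 : ℝ) < (8 * κ) ^ ((a - 1) / 2) := by positivity
    have h5 : f t = t ^ 2 / (8 * κ) := rfl
    rw [← h5] at h2
    have h6 : κ - f t = κ * (1 - 1 / κ ^ 2 * t ^ 2 / 8) := by
      rw [h5]; field_simp
    rw [h6]
    field_simp
    field_simp at h2
    linear_combination (8 * κ ^ 2 - t ^ 2) * h2
  have hmono : ∀ t ∈ Set.Ioo (min 0 s) (max 0 s), HasDerivWithinAt f (t / (4 * κ)) (Set.Ioi t) t := by
    intro t _
    have h2 : HasDerivAt (fun s : ℝ => s ^ 2) (2 * t) t := by simpa using hasDerivAt_pow 2 t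
    refine ((h2.div_const (8 * κ)).congr_deriv ?_).hasDerivWithinAt
    field_simp
    ring
  have hcont : ContinuousOn (fun u => loeWeight a u * p.eval u) (f '' Set.Ioo (min 0 s) (max 0 s)) := by
    have : ContinuousOn (fun u : ℝ => u ^ ((a - 1) / 2) * Real.exp (-u) * p.eval u) (Set.Ioi 0) := by
      refine ContinuousOn.mul (ContinuousOn.mul ?_ (by fun_prop)) (by fun_prop)
      exact fun u hu => (Real.continuousAt_rpow_const _ _ (Or.inl (ne_of_gt hu))).continuousWithinAt
    refine (this.congr fun u hu => ?_).mono (t := f '' Set.Ioo (min 0 s) (max 0 s)) ?_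
    · rw [loeWeight_of_pos hu]
    · rintro _ ⟨t, ht, rfl⟩
      rw [min_eq_left hs.le] at ht
      have : 0 < t := ht.1
      exact show 0 < f t by positivity
  have hintg : IntervalIntegrable (fun t => frobSeries a (besselCoeff a (1 / κ ^ 2)) t *
      (1 - 1 / κ ^ 2 * t ^ 2 / 8)) volume 0 s :=
    (intervalIntegrable_frobSeries ha hc 0 s).mul_continuousOn (by fun_prop)
  -- The weight may be singular at the origin, so the substitution u = t²/(8κ) uses the version
  -- needing continuity only on the open interval, together with integrability.
  have hsub := intervalIntegral.integral_comp_mul_deriv''' (a := 0) (b := s) (f := f)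
    (f' := fun t => t / (4 * κ)) (g := fun u => loeWeight a u * p.eval u) (by fun_prop) hmono hcont
    (integrable_loeWeight_mul ha p).integrableOn ?_
  · have e0 : f 0 = 0 := by simp [hf]
    have e1 : f s = x := rfl
    rw [e0, e1] at hsub
    rw [h1, ← hsub, ← intervalIntegral.integral_const_mul]
    refine intervalIntegral.integral_congr_ae (ae_of_all _ fun t ht => ?_)
    rw [Set.uIoc_of_le hs.le] at ht
    exact hpt t ht.1
  · rw [Set.uIcc_of_le hs.le, integrableOn_Icc_iff_integrableOn_Ioc]
    refine ((intervalIntegrable_iff_integrableOn_Ioc_of_le hs.le).mp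
      (hintg.const_mul _)).congr_fun (fun t ht => (hpt t ht.1).symm) measurableSet_Ioc

/-- The scaled prefactor. -/
noncomputable def hardPrefactor (a : ℝ) (n : ℕ) (κ : ℝ) : ℝ :=
  Real.Gamma (n + a + 1) / n.factorial / κ ^ a

/-- The scaled constant. -/
noncomputable def hardConst (a : ℝ) (n : ℕ) (κ : ℝ) : ℝ :=
  loeConst a n * (κ / 2) ^ ((a - 1) / 2)

/-- Closed form of the hard edge density at finite size. -/
theorem loeHardDensity_succ (ha : -1 < a) (n : ℕ) {κ : ℝ} (hκ : κ = n + (a + 1) / 2)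
    (hκ1 : 1 ≤ κ) {s : ℝ} (hs : 0 < s) :
    loeHardDensity a (n + 1) (s ^ 2 / 2) = hardPrefactor a n κ *
      ((1 / 2 - a ^ 2 / (2 * s ^ 2) - 1 / κ ^ 2 * s ^ 2 / 32) *
          frobSeries a (besselCoeff a (1 / κ ^ 2)) s ^ 2 +
        1 / (2 * s ^ 2) * frobSeriesEuler a (besselCoeff a (1 / κ ^ 2)) s ^ 2 +
        1 / 2 * (frobSeries a (besselCoeff a (1 / κ ^ 2)) s / s) * (hardConst a n κ -
          ∫ t in (0 : ℝ)..s, frobSeries a (besselCoeff a (1 / κ ^ 2)) t *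
            (1 - 1 / κ ^ 2 * t ^ 2 / 8))) := by
  have hκ0 : 0 < κ := by linarith
  have hN : Nhat a (n + 1) = κ := by rw [Nhat, hκ]; push_cast; ring
  have hx : s ^ 2 / 2 / (4 * κ) = s ^ 2 / (8 * κ) := by field_simp; norm_num
  have hx0 : 0 < s ^ 2 / (8 * κ) := by positivity
  have h1 := laguerre_scaled ha n hκ hs
  have h2 := laguerre_euler_scaled ha n hκ hκ1 hs rfl
  have h3 := lowerIntegral_scaled ha n hκ hκ1 hs
  have h4 := laguerre_kernel_sum ha n (s ^ 2 / (8 * κ))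
  have h5 := lowerIntegral_laguerreLow ha n hx0
  rw [← hκ, h3] at h5
  rw [loeHardDensity, hN, hx, loeDensity_succ ha n hx0, h5, hardPrefactor, hardConst,
    mul_sq_loeWeight hx0, loeWeight_of_pos hx0]
  have hG : 0 < Real.Gamma (n + a + 1) / n.factorial := by
    have : (0 : ℝ) ≤ n := n.cast_nonneg
    have := Real.Gamma_pos_of_pos (show (0 : ℝ) < n + a + 1 by linarith)
    positivity
  have hh : laguerreNorm a n = Real.Gamma (n + a + 1) / n.factorial / 2 ^ (a + 1) := by
    rw [laguerreNorm]; field_simp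
  -- All real powers of s, κ and 2 are reduced to powers with exponent `q`; after they are
  -- generalised, only a rational identity is left.
  set q := (a - 1) / 2 with hq
  have hsp : 0 < s ^ q := by positivity
  have hkp : 0 < κ ^ q := by positivity
  have htp : (0 : ℝ) < 2 ^ q := by positivity
  have rpow_a : ∀ z : ℝ, 0 < z → z ^ a = z * (z ^ q) ^ 2 := by
    intro z hz
    rw [show a = 1 + q * (2 : ℕ) by rw [hq]; push_cast; ring, Real.rpow_add hz, Real.rpow_one,
      Real.rpow_mul hz.le, Real.rpow_natCast]
  have e1 := rpow_a s hs
  have e2 := rpow_a κ hκ0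
  have e3 := rpow_a 2 two_pos
  have e4 := rpow_a _ hx0
  have e5 : (2 : ℝ) ^ (a + 1) = 4 * (2 ^ q) ^ 2 := by
    rw [Real.rpow_add_one two_ne_zero, e3]; ring
  have e6 : (8 * κ) ^ q = (2 ^ q) ^ 3 * κ ^ q := by
    rw [Real.mul_rpow (by norm_num) hκ0.le, show (8 : ℝ) = 2 ^ (3 : ℕ) by norm_num,
      ← Real.rpow_natCast, ← Real.rpow_natCast, ← Real.rpow_mul two_pos.le,
      ← Real.rpow_mul two_pos.le, mul_comm q]
  have e7 : (κ / 2) ^ q = κ ^ q / 2 ^ q := Real.div_rpow hκ0.le two_pos.le q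
  have e8 : (s ^ 2 / (8 * κ)) ^ q = (s ^ q) ^ 2 / ((2 ^ q) ^ 3 * κ ^ q) := by
    rw [Real.div_rpow (by positivity) (by positivity), e6, ← Real.rpow_natCast,
      ← Real.rpow_natCast (s ^ q), ← Real.rpow_mul hs.le, ← Real.rpow_mul hs.le, mul_comm q]
  have e9 : Real.exp (-(2 * (s ^ 2 / (8 * κ)))) = Real.exp (-(s ^ 2 / (8 * κ))) ^ 2 := by
    rw [← Real.exp_nat_mul]; congr 1; push_cast; ring
  have en : (n : ℝ) = κ - (a + 1) / 2 := by rw [hκ]; ring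
  rw [e1, e3] at h1 h2
  rw [e4, e2, e3, e6, e7, e8, e9, hh, e5]
  rw [hh, e5] at h4
  clear_value q
  clear rpow_a e1 e2 e3 e4 e5 e6 e7 e8 e9 h3 h5 hh
  generalize frobSeries a (besselCoeff a (1 / κ ^ 2)) s = V at *
  generalize frobSeriesEuler a (besselCoeff a (1 / κ ^ 2)) s = W at *
  generalize (∫ t in (0 : ℝ)..s, frobSeries a (besselCoeff a (1 / κ ^ 2)) t *
    (1 - 1 / κ ^ 2 * t ^ 2 / 8)) = I at *
  generalize Real.Gamma (n + a + 1) / n.factorial = G at *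
  generalize loeConst a n = c at *
  generalize ∑ k ∈ Finset.range n,
    (laguerrePoly a k).eval (s ^ 2 / (8 * κ)) ^ 2 / laguerreNorm a k = S at *
  generalize (derivative (laguerrePoly a n)).eval (s ^ 2 / (8 * κ)) = D at *
  generalize (laguerrePoly a n).eval (s ^ 2 / (8 * κ)) = L at *
  generalize Real.exp (-(s ^ 2 / (8 * κ))) = E at *
  generalize s ^ q = sp at *
  generalize κ ^ q = kp at *
  generalize (2 : ℝ) ^ q = tp at *
  rw [en] at h4
  -- The weighted polynomial, its Euler derivative and the Christoffel-Darboux sum are solved for in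
  -- terms of the deformed Bessel values `V` and `W`.
  have hM : E * L = 2 * tp ^ 2 * G * V / (s * sp ^ 2) := by
    field_simp
    linear_combination h1
  have hT : E * (s ^ 2 / (8 * κ) * D) = s ^ 2 / (8 * κ) * (2 * tp ^ 2 * G * V / (s * sp ^ 2)) +
      2 * tp ^ 2 * G * ((W - a * V) / 2) / (s * sp ^ 2) := by
    rw [← hM, ← sub_eq_iff_eq_add', eq_div_iff (by positivity)]
    linear_combination h2
  have hS : E ^ 2 * S = 8 * tp ^ 2 * κ / (G * s ^ 2) *
      ((2 * (κ - (a + 1) / 2)) * (s ^ 2 / (8 * κ)) * (E * L) ^ 2 +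
        (a - 2 * (s ^ 2 / (8 * κ))) * (E * L) * (E * (s ^ 2 / (8 * κ) * D)) +
        (E * (s ^ 2 / (8 * κ) * D)) ^ 2) * 2 := by
    rw [show ∀ u v : ℝ, u * (E * L) ^ 2 + v * (E * L) * (E * (s ^ 2 / (8 * κ) * D)) +
      (E * (s ^ 2 / (8 * κ) * D)) ^ 2 = E ^ 2 * (u * L ^ 2 + v * L * (s ^ 2 / (8 * κ) * D) +
        (s ^ 2 / (8 * κ) * D) ^ 2) from fun u v => by ring, ← h4]
    field_simp
    ring
  rw [show ∀ u v w r : ℝ, 1 / (4 * κ) * (u * v ^ 2 * E ^ 2 * S + v * E * L *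
    (c - (w - u * (v * E) * L) / r)) = 1 / (4 * κ) * (u * v ^ 2 * (E ^ 2 * S) + v * (E * L) *
    (c - (w - u * v * (E * L)) / r)) from fun u v w r => by ring, hS, hT, hM]
  field_simp
  ring

end HardEdgeClosedForm

/-! ### Ratios of Gamma functions to second order -/

section GammaRatio

/-- The logarithm of `Γ (z + (1 + b) / 2) / Γ (z + (1 - b) / 2) / z ^ b`. -/
noncomputable def logGammaRatio (b z : ℝ) : ℝ :=
  Real.log (Real.Gamma (z + (1 + b) / 2)) - Real.log (Real.Gamma (z + (1 - b) / 2)) - b * Real.log z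

lemma log_Gamma_add_one {x : ℝ} (hx : 0 < x) :
    Real.log (Real.Gamma (x + 1)) = Real.log x + Real.log (Real.Gamma x) := by
  rw [Real.Gamma_add_one hx.ne', Real.log_mul hx.ne' (Real.Gamma_pos_of_pos hx).ne']

lemma abs_log_sub_log_sub_le {x : ℝ} (hx : |x| ≤ 1 / 2) :
    |Real.log (1 + x) - Real.log (1 - x) - (2 * x + 2 * x ^ 3 / 3)| ≤ 4 * |x| ^ 5 := by
  have h1 := Real.abs_log_sub_add_sum_range_le (x := x) (by linarith) 4
  have h2 := Real.abs_log_sub_add_sum_range_le (x := -x) (by rw [abs_neg]; linarith) 4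
  simp only [Finset.sum_range_succ, Finset.sum_range_zero, abs_neg, sub_neg_eq_add] at h1 h2
  have h3 : |x| ^ (4 + 1) / (1 - |x|) ≤ 2 * |x| ^ 5 := by
    rw [div_le_iff₀ (by linarith)]
    have : 0 ≤ |x| ^ 5 := by positivity
    have h := mul_le_mul_of_nonneg_left (show 1 ≤ 2 * (1 - |x|) by linarith) this
    calc |x| ^ (4 + 1) = |x| ^ 5 * 1 := by ring
      _ ≤ _ := h
      _ = _ := by ring
  have h4 := abs_le.mp (h1.trans h3)
  have h5 := abs_le.mp (h2.trans h3)
  norm_num at h4 h5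
  rw [abs_le]
  constructor <;> linarith [h4.1, h4.2, h5.1, h5.2]

/-- By the functional equation the increment is elementary. Centred at z + 1/2 it involves only
log(1+t) - log(1-t), which is odd in t; hence no even powers of 1/(2z+1) occur. -/
lemma logGammaRatio_step {b z : ℝ} (hz : 1 + |b| ≤ z) :
    logGammaRatio b (z + 1) - logGammaRatio b z =
      (Real.log (1 + b / (2 * z + 1)) - Real.log (1 - b / (2 * z + 1))) -
        b * (Real.log (1 + 1 / (2 * z + 1)) - Real.log (1 - 1 / (2 * z + 1))) := by
  have hb := abs_nonneg b
  have hb1 := le_abs_self b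
  have hb2 := neg_abs_le b
  have hz0 : 0 < z := by linarith
  have hw : 0 < 2 * z + 1 := by linarith
  have h1 : 0 < z + (1 + b) / 2 := by linarith
  have h2 : 0 < z + (1 - b) / 2 := by linarith
  have e1 : 1 + b / (2 * z + 1) = (z + (1 + b) / 2) * (2 / (2 * z + 1)) := by field_simp; ring
  have e2 : 1 - b / (2 * z + 1) = (z + (1 - b) / 2) * (2 / (2 * z + 1)) := by field_simp; ring
  have e3 : 1 + 1 / (2 * z + 1) = (z + 1) * (2 / (2 * z + 1)) := by field_simp; ring
  have e4 : 1 - 1 / (2 * z + 1) = z * (2 / (2 * z + 1)) := by field_simp; ring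
  have h3 : 2 / (2 * z + 1) ≠ 0 := by positivity
  rw [e1, e2, e3, e4, Real.log_mul h1.ne' h3, Real.log_mul h2.ne' h3,
    Real.log_mul (by positivity) h3, Real.log_mul hz0.ne' h3, logGammaRatio, logGammaRatio,
    show z + 1 + (1 + b) / 2 = z + (1 + b) / 2 + 1 by ring,
    show z + 1 + (1 - b) / 2 = z + (1 - b) / 2 + 1 by ring, log_Gamma_add_one h1,
    log_Gamma_add_one h2]
  ring

/-- The linear terms cancel and the cubic ones match the increment of b(1-b²)/24/z² up to O(z⁻⁵).
The error is stated as a difference of values of 1/z⁴ so that it telescopes. -/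
lemma exists_logGammaRatio_step_bound (b : ℝ) : ∃ K : ℝ, 0 ≤ K ∧ ∀ z : ℝ, 1 + |b| ≤ z →
    |(logGammaRatio b (z + 1) - b * (1 - b ^ 2) / 24 / (z + 1) ^ 2) -
      (logGammaRatio b z - b * (1 - b ^ 2) / 24 / z ^ 2)| ≤
      K * (1 / z ^ 4 - 1 / (z + 1) ^ 4) := by
  refine ⟨4 * (4 * |b| ^ 5 + 4 * |b| + 2 * |b * (1 - b ^ 2) / 24|), by positivity, fun z hz => ?_⟩
  have hb := abs_nonneg b
  have hz0 : 0 < z := by linarith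
  have hz1 : 1 ≤ z := by linarith
  have hw : 0 < 2 * z + 1 := by linarith
  set β := b * (1 - b ^ 2) / 24 with hβ
  set x := b / (2 * z + 1) with hx
  set y := 1 / (2 * z + 1) with hy
  have hy0 : 0 < y := by positivity
  have hyz : y ≤ 1 / z := by
    rw [hy]
    exact one_div_le_one_div_of_le hz0 (by linarith)
  have hxy : |x| = |b| * y := by rw [hx, hy, abs_div, abs_of_pos hw]; ring
  have hy2 : |y| ≤ 1 / 2 := by
    rw [abs_of_pos hy0, hy, div_le_div_iff₀ hw two_pos]; linarith
  have hx2 : |x| ≤ 1 / 2 := by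
    rw [hxy, hy, mul_one_div, div_le_div_iff₀ hw two_pos]; linarith
  have h1 := abs_log_sub_log_sub_le hx2
  have h2 := abs_log_sub_log_sub_le hy2
  have hstep := logGammaRatio_step hz
  have hy5 : y ^ 5 ≤ 1 / z ^ 5 := by
    calc y ^ 5 ≤ (1 / z) ^ 5 := by gcongr
      _ = 1 / z ^ 5 := by rw [one_div_pow]
  have h3 : |2 * x + 2 * x ^ 3 / 3 - b * (2 * y + 2 * y ^ 3 / 3) + β / z ^ 2 - β / (z + 1) ^ 2| ≤
      2 * |β| * (1 / z ^ 5) := by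
    have e : 2 * x + 2 * x ^ 3 / 3 - b * (2 * y + 2 * y ^ 3 / 3) + β / z ^ 2 - β / (z + 1) ^ 2 =
        β * ((8 * z ^ 2 + 8 * z + 1) / (z ^ 2 * (z + 1) ^ 2 * (2 * z + 1) ^ 3)) := by
      rw [hx, hy, hβ]
      field_simp
      ring
    have hpos : 0 ≤ (8 * z ^ 2 + 8 * z + 1) / (z ^ 2 * (z + 1) ^ 2 * (2 * z + 1) ^ 3) := by
      positivity
    rw [e, abs_mul, abs_of_nonneg hpos, mul_comm 2 |β|, mul_assoc |β|]
    refine mul_le_mul_of_nonneg_left ?_ (abs_nonneg β)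
    rw [mul_one_div, div_le_div_iff₀ (by positivity) (by positivity)]
    calc (8 * z ^ 2 + 8 * z + 1) * z ^ 5 ≤ (2 * (2 * z + 1) ^ 2) * (z ^ 2 * (z + 1) ^ 2 * (2 * z + 1)) := by
          have h1 : z ^ 5 ≤ z ^ 2 * (z + 1) ^ 2 * (2 * z + 1) := by
            calc z ^ 5 = z ^ 2 * z ^ 2 * z := by ring
              _ ≤ _ := by gcongr <;> linarith
          refine mul_le_mul ?_ h1 (by positivity) (by positivity)
          nlinarith
      _ = _ := by ring
  have h4 : 1 / z ^ 5 ≤ 4 * (1 / z ^ 4 - 1 / (z + 1) ^ 4) := by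
    rw [div_sub_div _ _ (by positivity) (by positivity), ← mul_div_assoc,
      div_le_div_iff₀ (by positivity) (by positivity)]
    have h1 : (z + 1) ^ 4 ≤ 16 * z ^ 4 := by
      calc (z + 1) ^ 4 ≤ (2 * z) ^ 4 := by gcongr; linarith
        _ = _ := by ring
    have h2 : 4 * z ^ 3 ≤ (z + 1) ^ 4 - z ^ 4 := by nlinarith [sq_nonneg z]
    calc 1 * (z ^ 4 * (z + 1) ^ 4) ≤ 1 * (z ^ 4 * (16 * z ^ 4)) := by gcongr
      _ = 4 * (4 * z ^ 3) * z ^ 5 := by ring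
      _ ≤ 4 * ((z + 1) ^ 4 - z ^ 4) * z ^ 5 := by gcongr
      _ = _ := by ring
  have h5 : |(logGammaRatio b (z + 1) - β / (z + 1) ^ 2) - (logGammaRatio b z - β / z ^ 2)| ≤
      (4 * |b| ^ 5 + 4 * |b| + 2 * |β|) * (1 / z ^ 5) := by
    have e : (logGammaRatio b (z + 1) - β / (z + 1) ^ 2) - (logGammaRatio b z - β / z ^ 2) =
        (Real.log (1 + x) - Real.log (1 - x) - (2 * x + 2 * x ^ 3 / 3)) -
        b * (Real.log (1 + y) - Real.log (1 - y) - (2 * y + 2 * y ^ 3 / 3)) +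
        (2 * x + 2 * x ^ 3 / 3 - b * (2 * y + 2 * y ^ 3 / 3) + β / z ^ 2 - β / (z + 1) ^ 2) := by
      linear_combination hstep
    rw [e]
    have h2' : |b * (Real.log (1 + y) - Real.log (1 - y) - (2 * y + 2 * y ^ 3 / 3))| ≤
        |b| * (4 * |y| ^ 5) := by
      rw [abs_mul]; gcongr
    refine (abs_add_le _ _).trans
      ((add_le_add ((abs_sub _ _).trans (add_le_add h1 h2')) h3).trans ?_)
    rw [hxy, abs_of_pos hy0, mul_pow]
    have : 0 ≤ |b| ^ 5 := by positivity
    have h6 := mul_le_mul_of_nonneg_left hy5 this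
    have h7 := mul_le_mul_of_nonneg_left hy5 hb
    linarith
  refine h5.trans ?_
  rw [mul_assoc, mul_left_comm]
  exact mul_le_mul_of_nonneg_left h4 (by positivity)

/-- Euler's limit for the Gamma function, in logarithmic form. -/
lemma tendsto_log_Gamma_add (s : ℝ) (hs : 0 < s) :
    Tendsto (fun n : ℕ => Real.log (Real.Gamma (s + n + 1)) - s * Real.log n -
      Real.log n.factorial) atTop (𝓝 0) := by
  have h := Real.GammaSeq_tendsto_Gamma s
  have hG := Real.Gamma_pos_of_pos hs
  have h1 := ((Real.continuousAt_log hG.ne').tendsto.comp h).const_sub (Real.log (Real.Gamma s))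
  rw [sub_self] at h1
  refine h1.congr' ?_
  filter_upwards [eventually_gt_atTop 0] with n hn
  have hn0 : (0 : ℝ) < n := by exact_mod_cast hn
  have hP : ∀ m : ℕ, Real.Gamma (s + m) = (∏ j ∈ Finset.range m, (s + j)) * Real.Gamma s := by
    intro m
    induction m with
    | zero => simp
    | succ m ih =>
      rw [Finset.prod_range_succ, mul_right_comm, ← ih, Nat.cast_succ, ← add_assoc,
        Real.Gamma_add_one (by positivity)]
      ring
  have hP1 := hP (n + 1)
  have hpos : 0 < ∏ j ∈ Finset.range (n + 1), (s + (j : ℝ)) :=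
    Finset.prod_pos fun j _ => by positivity
  have hf : (0 : ℝ) < n.factorial := by positivity
  rw [Function.comp_apply, Real.GammaSeq, Real.log_div (by positivity) hpos.ne',
    Real.log_mul (by positivity) hf.ne', Real.log_rpow hn0]
  push_cast at hP1
  rw [add_assoc, hP1, Real.log_mul hpos.ne' hG.ne']
  ring

/-- Euler's limit at the two shifted points: the factorials cancel and the difference of exponents
is exactly `b`. -/
lemma tendsto_logGammaRatio_nat {b z : ℝ} (hz : 1 + |b| ≤ z) :
    Tendsto (fun n : ℕ => logGammaRatio b (z + (n + 1 : ℕ))) atTop (𝓝 0) := by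
  have hb := abs_nonneg b
  have hb1 := le_abs_self b
  have hb2 := neg_abs_le b
  have h1 := tendsto_log_Gamma_add (z + (1 + b) / 2) (by linarith)
  have h2 := tendsto_log_Gamma_add (z + (1 - b) / 2) (by linarith)
  have h3 : Tendsto (fun n : ℕ => Real.log (1 + (z + 1) / n)) atTop (𝓝 0) := by
    have h4 : Tendsto (fun n : ℕ => 1 + (z + 1) / (n : ℝ)) atTop (𝓝 (1 + 0)) :=
      (tendsto_const_nhds.div_atTop tendsto_natCast_atTop_atTop).const_add 1
    rw [add_zero] at h4
    simpa [Function.comp_def] using (Real.continuousAt_log one_ne_zero).tendsto.comp h4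
  have h5 := (h1.sub h2).sub (h3.const_mul b)
  simp only [sub_self, mul_zero] at h5
  refine h5.congr' ?_
  filter_upwards [eventually_gt_atTop 0] with n hn
  have hn0 : (0 : ℝ) < n := by exact_mod_cast hn
  have e : Real.log (1 + (z + 1) / n) = Real.log (z + (n + 1 : ℕ)) - Real.log n := by
    rw [← Real.log_div _ hn0.ne']
    · congr 1; push_cast; field_simp; ring
    · have : (0 : ℝ) < z := by linarith
      positivity
  rw [e, logGammaRatio]
  push_cast
  rw [show z + ((n : ℝ) + 1) + (1 + b) / 2 = z + (1 + b) / 2 + n + 1 by ring,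
    show z + ((n : ℝ) + 1) + (1 - b) / 2 = z + (1 - b) / 2 + n + 1 by ring]
  ring

/-- Sum the increments from z to infinity, where the function vanishes along integer translates; the
bounds telescope to 1/z⁴. -/
lemma exists_logGammaRatio_bound (b : ℝ) : ∃ K : ℝ, 0 ≤ K ∧ ∀ z : ℝ, 1 + |b| ≤ z →
    |logGammaRatio b z - b * (1 - b ^ 2) / 24 / z ^ 2| ≤ K * (1 / z ^ 4) := by
  obtain ⟨K, hK, hstep⟩ := exists_logGammaRatio_step_bound b
  refine ⟨K, hK, fun z hz => ?_⟩
  have hb := abs_nonneg b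
  set β := b * (1 - b ^ 2) / 24
  set F : ℝ → ℝ := fun z => logGammaRatio b z - β / z ^ 2 with hF
  have htel : ∀ m : ℕ, |F (z + m) - F z| ≤ K * (1 / z ^ 4 - 1 / (z + m) ^ 4) := by
    intro m
    induction m with
    | zero => simp
    | succ m ih =>
      have h1 := hstep (z + m) (by have : (0 : ℝ) ≤ m := m.cast_nonneg; linarith)
      have h2 := abs_sub_le (F (z + m + 1)) (F (z + m)) (F z)
      rw [Nat.cast_succ, ← add_assoc]
      calc _ ≤ _ := h2
        _ ≤ K * (1 / (z + m) ^ 4 - 1 / (z + m + 1) ^ 4) + K * (1 / z ^ 4 - 1 / (z + m) ^ 4) :=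
          add_le_add h1 ih
        _ = _ := by ring
  have hlim : Tendsto (fun n : ℕ => |F (z + (n + 1 : ℕ)) - F z|) atTop (𝓝 |0 - F z|) := by
    have h1 := tendsto_logGammaRatio_nat hz
    have h2 : Tendsto (fun n : ℕ => β / (z + (n + 1 : ℕ)) ^ 2) atTop (𝓝 0) := by
      refine tendsto_const_nhds.div_atTop ((tendsto_pow_atTop two_ne_zero).comp ?_)
      exact tendsto_atTop_add_const_left _ _
        (tendsto_natCast_atTop_atTop.comp (tendsto_add_atTop_nat 1))
    have h3 := ((h1.sub h2).sub_const (F z)).abs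
    rwa [sub_zero] at h3
  have h4 := le_of_tendsto' hlim (b := K * (1 / z ^ 4)) fun n => (htel (n + 1)).trans ?_
  · rwa [zero_sub, abs_neg] at h4
  · refine mul_le_mul_of_nonneg_left ?_ hK
    have : 0 ≤ 1 / (z + (n + 1 : ℕ)) ^ 4 := by positivity
    linarith

/-- The ratio of Gamma functions to second order. -/
theorem isBigO_gammaRatio (b : ℝ) :
    (fun z : ℝ => Real.Gamma (z + (1 + b) / 2) / Real.Gamma (z + (1 - b) / 2) / z ^ b -
      (1 + b * (1 - b ^ 2) / 24 / z ^ 2)) =O[atTop] fun z : ℝ => 1 / z ^ 4 := by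
  obtain ⟨K, hK, hbd⟩ := exists_logGammaRatio_bound b
  set β := b * (1 - b ^ 2) / 24
  refine IsBigO.of_bound (K + (|β| + K) ^ 2) ?_
  filter_upwards [eventually_ge_atTop (1 + |b|), eventually_ge_atTop (1 + |β| + K)] with z hz hz'
  have hb := abs_nonneg b
  have hβ := abs_nonneg β
  have hb1 := le_abs_self b
  have hb2 := neg_abs_le b
  have hz0 : 0 < z := by linarith
  have hz1 : 1 ≤ z := by linarith
  have h := hbd z hz
  set f := logGammaRatio b z with hf
  have e : Real.Gamma (z + (1 + b) / 2) / Real.Gamma (z + (1 - b) / 2) / z ^ b = Real.exp f := by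
    have h1 := Real.Gamma_pos_of_pos (show 0 < z + (1 + b) / 2 by linarith)
    have h2 := Real.Gamma_pos_of_pos (show 0 < z + (1 - b) / 2 by linarith)
    rw [hf, logGammaRatio, Real.exp_sub, Real.exp_sub, Real.exp_log h1, Real.exp_log h2,
      Real.rpow_def_of_pos hz0, mul_comm b]
  have hz2 : 1 / z ^ 4 ≤ 1 / z ^ 2 := by
    exact one_div_le_one_div_of_le (by positivity) (pow_le_pow_right₀ hz1 (by norm_num))
  have hfb : |f| ≤ (|β| + K) * (1 / z ^ 2) := by
    have h1 : |f| ≤ |f - β / z ^ 2| + |β / z ^ 2| := by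
      have := abs_add_le (f - β / z ^ 2) (β / z ^ 2)
      rwa [sub_add_cancel] at this
    have h2 : |β / z ^ 2| = |β| * (1 / z ^ 2) := by
      rw [abs_div, abs_of_pos (by positivity : 0 < z ^ 2)]; ring
    have h3 := mul_le_mul_of_nonneg_left hz2 hK
    linarith
  have hf1 : |f| ≤ 1 := by
    refine hfb.trans ?_
    rw [mul_one_div, div_le_one (by positivity)]
    nlinarith
  have h2 := Real.abs_exp_sub_one_sub_id_le hf1
  have h3 : f ^ 2 ≤ (|β| + K) ^ 2 * (1 / z ^ 4) := by
    rw [← sq_abs]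
    calc |f| ^ 2 ≤ ((|β| + K) * (1 / z ^ 2)) ^ 2 := by gcongr
      _ = _ := by ring
  rw [e, Real.norm_eq_abs, Real.norm_eq_abs, abs_of_pos (by positivity : 0 < 1 / z ^ 4)]
  calc |Real.exp f - (1 + β / z ^ 2)| = |(Real.exp f - 1 - f) + (f - β / z ^ 2)| := by ring_nf
    _ ≤ f ^ 2 + K * (1 / z ^ 4) := (abs_add_le _ _).trans (add_le_add h2 h)
    _ ≤ _ := by linarith

end GammaRatio

/-! ### Decay of the Bessel function and its total integral -/

section BesselDecay

variable {a : ℝ}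

/-- The energy `u² + u'²` of `u = √s J`. -/
noncomputable def besselEnergy (a s : ℝ) : ℝ :=
  s * besselJ a s ^ 2 + (besselEuler a s + besselJ a s / 2) ^ 2 / s

/-- The function u = √s J satisfies u'' + (1 - (a² - 1/4)/s²) u = 0, so its energy changes only
through the perturbation of order s⁻². -/
lemma hasDerivAt_besselEnergy (ha : -1 < a) {s : ℝ} (hs : 0 < s) :
    HasDerivAt (besselEnergy a) ((a ^ 2 - 1 / 4) *
      (2 * besselJ a s * (besselEuler a s + besselJ a s / 2)) / s ^ 2) s := by
  have hJ := hasDerivAt_besselJ ha hs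
  have hE := hasDerivAt_besselEuler ha hs
  have h := ((hasDerivAt_id s).mul (hJ.pow 2)).add
    (((hE.add (hJ.div_const 2)).pow 2).div (hasDerivAt_id s) hs.ne')
  refine h.congr_deriv ?_
  simp only [id, Pi.pow_apply, Pi.add_apply]
  field_simp
  ring

/-- From |2uu'| ≤ u² + u'² and integrability of s⁻² at infinity, the energy times exp(c/s) is
nonincreasing. -/
lemma besselEnergy_le (ha : -1 < a) {s : ℝ} (hs : 1 ≤ s) :
    besselEnergy a s ≤ besselEnergy a 1 * Real.exp |a ^ 2 - 1 / 4| := by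
  set c := |a ^ 2 - 1 / 4| with hc
  have hd : ∀ t : ℝ, 0 < t → HasDerivAt (fun s => besselEnergy a s * Real.exp (c / s))
      (((a ^ 2 - 1 / 4) * (2 * besselJ a t * (besselEuler a t + besselJ a t / 2)) / t ^ 2 -
        c * besselEnergy a t / t ^ 2) * Real.exp (c / t)) t := by
    intro t ht
    have h1 : HasDerivAt (fun s : ℝ => c / s) (-c / t ^ 2) t := by
      refine ((hasDerivAt_const t c).div (hasDerivAt_id t) ht.ne').congr_deriv ?_
      simp
    refine ((hasDerivAt_besselEnergy ha ht).mul h1.exp).congr_deriv ?_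
    field_simp
    ring
  have hanti : AntitoneOn (fun s => besselEnergy a s * Real.exp (c / s)) (Set.Ici 1) := by
    refine antitoneOn_of_deriv_nonpos (convex_Ici 1) ?_ ?_ ?_
    · exact fun t ht => (hd t (one_pos.trans_le ht)).continuousAt.continuousWithinAt
    · rw [interior_Ici]
      exact fun t ht => (hd t (one_pos.trans ht)).differentiableAt.differentiableWithinAt
    · rw [interior_Ici]
      intro t ht
      have ht0 : 0 < t := one_pos.trans ht
      rw [(hd t ht0).deriv]
      refine mul_nonpos_of_nonpos_of_nonneg ?_ (Real.exp_pos _).le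
      rw [← sub_div]
      refine div_nonpos_of_nonpos_of_nonneg (sub_nonpos.mpr ?_) (by positivity)
      refine (le_abs_self _).trans ?_
      rw [abs_mul, ← hc]
      refine mul_le_mul_of_nonneg_left ?_ (abs_nonneg _)
      rw [besselEnergy, abs_le]
      set J := besselJ a t
      set w := besselEuler a t + J / 2
      have h1 : t * (J + w / t) ^ 2 = t * J ^ 2 + 2 * J * w + w ^ 2 / t := by field_simp; ring
      have h2 : t * (J - w / t) ^ 2 = t * J ^ 2 - 2 * J * w + w ^ 2 / t := by field_simp; ring
      have h3 := mul_nonneg ht0.le (sq_nonneg (J + w / t))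
      have h4 := mul_nonneg ht0.le (sq_nonneg (J - w / t))
      constructor <;> linarith
  have h1 := hanti (Set.mem_Ici.mpr le_rfl) (Set.mem_Ici.mpr hs) hs
  simp only [div_one] at h1
  refine le_trans ?_ h1
  have hs0 : 0 < s := by linarith
  have h2 : 0 ≤ besselEnergy a s := by unfold besselEnergy; positivity
  have h3 : 1 ≤ Real.exp (c / s) := Real.one_le_exp (by positivity)
  nlinarith

lemma exists_besselJ_bound (ha : -1 < a) : ∃ M : ℝ, 0 ≤ M ∧ ∀ s : ℝ, 1 ≤ s →
    |besselJ a s| ≤ M * √s / s ∧ |besselEuler a s| ≤ M * √s := by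
  set K := besselEnergy a 1 * Real.exp |a ^ 2 - 1 / 4| with hK
  have hK0 : 0 ≤ K := by
    rw [hK, besselEnergy]; positivity
  refine ⟨2 * √K, by positivity, fun s hs => ?_⟩
  have hs0 : 0 < s := by linarith
  have h := besselEnergy_le ha hs
  rw [← hK, besselEnergy] at h
  set J := besselJ a s
  set e := besselEuler a s
  have h1 : 0 ≤ s * J ^ 2 := by positivity
  have h2 : 0 ≤ (e + J / 2) ^ 2 / s := by positivity
  have hJ : |J| ≤ √K * √s / s := by
    rw [← Real.sqrt_mul hK0, le_div_iff₀ hs0]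
    refine Real.le_sqrt_of_sq_le ?_
    rw [mul_pow, sq_abs]
    nlinarith
  have hw : |e + J / 2| ≤ √K * √s := by
    rw [← Real.sqrt_mul hK0]
    refine Real.le_sqrt_of_sq_le ?_
    rw [sq_abs]
    rw [← div_le_iff₀ hs0]
    linarith
  have h3 : √K * √s / s ≤ √K * √s := div_le_self (by positivity) hs
  have h4 : 0 ≤ √K * √s / s := by positivity
  constructor
  · calc |J| ≤ √K * √s / s := hJ
      _ ≤ 2 * (√K * √s / s) := by linarith
      _ = _ := by ring
  · have h5 : |e| ≤ |e + J / 2| + |J / 2| := by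
      have := abs_sub (e + J / 2) (J / 2)
      rwa [add_sub_cancel_right] at this
    rw [abs_div, abs_two] at h5
    linarith

/-- The integral of the Bessel function from the origin. -/
noncomputable def besselPrimitive (a s : ℝ) : ℝ :=
  ∫ t in (0 : ℝ)..s, frobSeries a (besselCoeff a 0) t

lemma continuous_besselPrimitive (ha : -1 < a) : Continuous (besselPrimitive a) :=
  intervalIntegral.continuous_primitive
    (intervalIntegrable_frobSeries ha (entireCoeff_besselCoeff_zero ha)) 0

lemma besselPrimitive_eq (ha : -1 < a) {s : ℝ} (hs : 0 ≤ s) :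
    besselPrimitive a s = ∫ t in (0 : ℝ)..s, besselJ a t := by
  refine intervalIntegral.integral_congr_ae (ae_of_all _ fun t ht => ?_)
  rw [Set.uIoc_of_le hs] at ht
  exact (besselJ_eq ha ht.1).symm

lemma hasDerivAt_besselPrimitive (ha : -1 < a) {s : ℝ} (hs : 0 < s) :
    HasDerivAt (besselPrimitive a) (besselJ a s) s := by
  have hc := entireCoeff_besselCoeff_zero ha
  rw [besselJ_eq ha hs]
  refine intervalIntegral.integral_hasDerivAt_right (intervalIntegrable_frobSeries ha hc 0 s) ?_
    (hasDerivAt_frobSeries hc hs).continuousAt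
  refine ContinuousOn.stronglyMeasurableAtFilter (s := Set.Ioi 0) isOpen_Ioi ?_ s hs
  exact fun t ht => (hasDerivAt_frobSeries hc ht).continuousAt.continuousWithinAt

/-- The Bessel function need not be absolutely integrable. Adding J' to its primitive cancels the
slow part by Bessel's equation: the derivative is (a² J - s J')/s² = O(s^(-3/2)), and J' itself
tends to 0. -/
lemma exists_tendsto_besselPrimitive (ha : -1 < a) :
    ∃ L : ℝ, Tendsto (besselPrimitive a) atTop (𝓝 L) := by
  obtain ⟨M, hM, hb⟩ := exists_besselJ_bound ha
  set F : ℝ → ℝ := fun s => besselPrimitive a s + besselEuler a s / s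
  set F' : ℝ → ℝ := fun s => (a ^ 2 * besselJ a s - besselEuler a s) / s ^ 2
  have hd : ∀ s ∈ Set.Ioi (1 : ℝ), HasDerivAt F (F' s) s := by
    intro s hs
    have hs0 : 0 < s := one_pos.trans hs
    refine ((hasDerivAt_besselPrimitive ha hs0).add
      ((hasDerivAt_besselEuler ha hs0).div (hasDerivAt_id s) hs0.ne')).congr_deriv ?_
    simp only [F', id]
    field_simp
    ring
  have hintg : IntegrableOn F' (Set.Ioi 1) := by
    have h1 := (integrableOn_Ioi_rpow_of_lt (a := -(3 / 2)) (by norm_num) one_pos).const_mul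
      ((a ^ 2 + 1) * M)
    refine h1.mono' ?_ ?_
    · refine ContinuousOn.aestronglyMeasurable ?_ measurableSet_Ioi
      intro s hs
      have hs0 : 0 < s := one_pos.trans hs
      have hJ := (hasDerivAt_besselJ ha hs0).continuousAt
      have hE := (hasDerivAt_besselEuler ha hs0).continuousAt
      exact (((hJ.const_mul _).sub hE).div (continuousAt_id.pow 2)
        (pow_pos hs0 2).ne').continuousWithinAt
    · refine (ae_restrict_mem measurableSet_Ioi).mono fun s hs => ?_
      have hs1 : 1 ≤ s := le_of_lt hs
      have hs0 : 0 < s := one_pos.trans hs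
      obtain ⟨h2, h3⟩ := hb s hs1
      have e : s ^ (-(3 / 2) : ℝ) = √s / s ^ 2 := by
        rw [Real.sqrt_eq_rpow, ← Real.rpow_natCast, ← Real.rpow_sub hs0]
        norm_num
      rw [e, Real.norm_eq_abs, abs_div, abs_of_pos (by positivity : 0 < s ^ 2), ← mul_div_assoc]
      refine div_le_div_of_nonneg_right ?_ (by positivity)
      have h4 : M * √s / s ≤ M * √s := div_le_self (by positivity) hs1
      calc |a ^ 2 * besselJ a s - besselEuler a s|
          ≤ |a ^ 2 * besselJ a s| + |besselEuler a s| := abs_sub _ _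
        _ ≤ a ^ 2 * (M * √s) + M * √s := by
          rw [abs_mul, abs_of_nonneg (sq_nonneg a)]
          gcongr
          exact h2.trans h4
        _ = _ := by ring
  have h1 := tendsto_limUnder_of_hasDerivAt_of_integrableOn_Ioi hd hintg
  have h2 : Tendsto (fun s => besselEuler a s / s) atTop (𝓝 0) := by
    refine squeeze_zero_norm' (a := fun s => M / √s) ?_ ?_
    · filter_upwards [eventually_ge_atTop 1] with s hs
      have hs0 : 0 < s := by linarith
      rw [Real.norm_eq_abs, abs_div, abs_of_pos hs0, div_le_div_iff₀ hs0 (Real.sqrt_pos.mpr hs0)]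
      calc |besselEuler a s| * √s ≤ M * √s * √s := by gcongr; exact (hb s hs).2
        _ = M * s := by rw [mul_assoc, Real.mul_self_sqrt hs0.le]
    · exact tendsto_const_nhds.div_atTop Real.tendsto_sqrt_atTop
  exact ⟨_, (h1.sub h2).congr fun s => by simp [F]⟩

/-- Termwise integration of a generalised power series. -/
lemma hasSum_integral_rpow_mul_entireSum {c : ℕ → ℝ} (hc : EntireCoeff c) {α : ℝ} (hα : -1 < α)
    (m : ℕ) {x : ℝ} (hx : 0 < x) :
    HasSum (fun j : ℕ => c j * (x ^ (α + 1 + m * j) / (α + 1 + m * j)))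
      (∫ t in (0 : ℝ)..x, t ^ α * entireSum c (t ^ m)) := by
  have hmj : ∀ j : ℕ, (0 : ℝ) ≤ m * j := fun j => by positivity
  have hintg : ∀ (j : ℕ) (d : ℝ), IntervalIntegrable (fun t : ℝ => d * t ^ (α + m * j)) volume 0 x :=
    fun j d => (intervalIntegral.intervalIntegrable_rpow' (by linarith [hmj j])).const_mul d
  have hval : ∀ (j : ℕ) (d : ℝ), ∫ t in (0 : ℝ)..x, d * t ^ (α + m * j) =
      d * (x ^ (α + 1 + m * j) / (α + 1 + m * j)) := by
    intro j d
    have h0 := hmj j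
    rw [intervalIntegral.integral_const_mul, integral_rpow (Or.inl (by linarith)),
      Real.zero_rpow (by linarith), sub_zero]
    ring_nf
  have h1 : ∀ j : ℕ, ∫ t in Set.Ioc 0 x, ‖c j * t ^ (α + m * j)‖ =
      |c j| * (x ^ (α + 1 + m * j) / (α + 1 + m * j)) := by
    intro j
    rw [← hval, intervalIntegral.integral_of_le hx.le]
    refine setIntegral_congr_fun measurableSet_Ioc fun t ht => ?_
    rw [norm_mul, Real.norm_eq_abs, Real.norm_eq_abs, abs_of_nonneg (Real.rpow_nonneg ht.1.le _)]
  have hsum : Summable fun j : ℕ => ∫ t in Set.Ioc 0 x, ‖c j * t ^ (α + m * j)‖ := by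
    simp only [h1]
    refine Summable.of_nonneg_of_le (fun j => ?_) (fun j => ?_)
      ((hc (x ^ m)).mul_left (x ^ (α + 1) / (α + 1)))
    · have := hmj j
      have : 0 < α + 1 + m * j := by linarith
      positivity
    · have h0 := hmj j
      rw [Real.rpow_add hx, show (m : ℝ) * j = ((m * j : ℕ) : ℝ) by push_cast; ring,
        Real.rpow_natCast, pow_mul]
      rw [show x ^ (α + 1) / (α + 1) * (|c j| * (x ^ m) ^ j) =
        |c j| * (x ^ (α + 1) * (x ^ m) ^ j / (α + 1)) by ring]
      have h5 : (0 : ℝ) ≤ (m * j : ℕ) := Nat.cast_nonneg _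
      refine mul_le_mul_of_nonneg_left ?_ (abs_nonneg _)
      exact div_le_div_of_nonneg_left (by positivity) (by linarith) (by linarith)
  have h2 := hasSum_integral_of_summable_integral_norm
    (fun j => (intervalIntegrable_iff_integrableOn_Ioc_of_le hx.le).mp (hintg j (c j))) hsum
  rw [intervalIntegral.integral_of_le hx.le]
  have h3 : ∀ j : ℕ, ∫ t in Set.Ioc 0 x, c j * t ^ (α + m * j) =
      c j * (x ^ (α + 1 + m * j) / (α + 1 + m * j)) := fun j => by
    rw [← hval, intervalIntegral.integral_of_le hx.le]
  simp only [h3] at h2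
  have h4 : ∫ t in Set.Ioc 0 x, t ^ α * entireSum c (t ^ m) =
      ∫ t in Set.Ioc 0 x, ∑' j : ℕ, c j * t ^ (α + m * j) := by
    refine setIntegral_congr_fun measurableSet_Ioc fun t ht => ?_
    rw [entireSum, ← tsum_mul_left]
    refine tsum_congr fun j => ?_
    rw [Real.rpow_add ht.1, show (m : ℝ) * j = ((m * j : ℕ) : ℝ) by push_cast; ring,
      Real.rpow_natCast, pow_mul]
    ring
  rwa [h4]

lemma entireCoeff_exp_neg : EntireCoeff fun j : ℕ => (-1 : ℝ) ^ j / j.factorial := by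
  refine EntireCoeff.of_bound (C := 1) (B := 1) fun j => ?_
  rw [abs_div, abs_pow, abs_neg, abs_one, Nat.abs_cast, one_mul]

lemma entireSum_exp_neg (q : ℝ) :
    entireSum (fun j : ℕ => (-1 : ℝ) ^ j / j.factorial) q = Real.exp (-q) := by
  rw [Real.exp_eq_exp_ℝ, NormedSpace.exp_eq_tsum_div, entireSum]
  refine tsum_congr fun k => ?_
  rw [neg_pow q]
  ring

/-- The integral of the Bessel function averaged against a Gamma density. -/
lemma integral_Gamma_mul_besselPrimitive (ha : -1 < a) {x : ℝ} (hx : 0 < x) :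
    ∫ v in Set.Ioi (0 : ℝ), Real.exp (-v) * v ^ ((a + 1) / 2 - 1) * besselPrimitive a (√(4 * x * v)) =
      ∫ q in (0 : ℝ)..x, Real.exp (-q) * q ^ ((a + 1) / 2 - 1) := by
  have hb : 0 < (a + 1) / 2 := by linarith
  have ha2 : a = 2 * ((a + 1) / 2) - 1 := by ring
  set b := (a + 1) / 2 with hbdef
  have hR := hasSum_integral_rpow_mul_entireSum entireCoeff_exp_neg (α := b - 1) (by linarith) 1 hx
  set K : ℕ → ℝ := fun j => besselCoeff a 0 j * (4 * x) ^ (b + j) / (2 * (b + j)) with hK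
  -- Integrating v^(2b+j-1) against e^(-v) produces Γ(j+a+1), which cancels the Gamma factor of the
  -- Bessel coefficient and leaves the series of the incomplete Gamma integral.
  have hKG : ∀ j : ℕ, K j * Real.Gamma (2 * b + j) =
      (-1 : ℝ) ^ j / j.factorial * (x ^ (b - 1 + 1 + (1 : ℕ) * j) / (b - 1 + 1 + (1 : ℕ) * j)) := by
    intro j
    have hG := Gamma_nat_add_ne_zero ha j
    have hbj : b + j ≠ 0 := by positivity
    have hf : (j.factorial : ℝ) ≠ 0 := by positivity
    have e1 : 2 * b + j = j + a + 1 := by rw [hbdef]; ring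
    have e2 : b - 1 + 1 + (1 : ℕ) * j = b + j := by push_cast; ring
    have e3 : (4 : ℝ) ^ (b + j) = 2 ^ (2 * j) * 2 ^ a * 2 := by
      rw [show (4 : ℝ) = 2 ^ (2 : ℝ) by norm_num, ← Real.rpow_mul two_pos.le, ← Real.rpow_natCast,
        ← Real.rpow_add two_pos, ← Real.rpow_add_one two_ne_zero]
      congr 1
      push_cast
      rw [hbdef]
      ring
    have h2 : (0 : ℝ) < 2 ^ (2 * j) * 2 ^ a := by positivity
    simp only [hK]
    rw [e1, e2, besselCoeff_zero_eq ha, Real.mul_rpow (by norm_num) hx.le, e3]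
    field_simp
  have hgam : ∀ j : ℕ, IntegrableOn (fun v : ℝ => Real.exp (-v) * v ^ (2 * b + j - 1)) (Set.Ioi 0) :=
    fun j => Real.GammaIntegral_convergent (by positivity)
  have hval : ∀ (j : ℕ) (k : ℝ),
      ∫ v in Set.Ioi (0 : ℝ), k * (Real.exp (-v) * v ^ (2 * b + j - 1)) =
        k * Real.Gamma (2 * b + j) := by
    intro j k
    rw [integral_const_mul, Real.Gamma_eq_integral (by positivity)]
  have hnorm : ∀ j : ℕ, ∫ v in Set.Ioi (0 : ℝ), ‖K j * (Real.exp (-v) * v ^ (2 * b + j - 1))‖ =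
      |K j * Real.Gamma (2 * b + j)| := by
    intro j
    have hG : 0 < Real.Gamma (2 * b + j) := Real.Gamma_pos_of_pos (by positivity)
    rw [abs_mul, abs_of_pos hG, ← hval]
    refine setIntegral_congr_fun measurableSet_Ioi fun v hv => ?_
    have : 0 ≤ v ^ (2 * b + j - 1) := Real.rpow_nonneg (le_of_lt hv) _
    have h0 : 0 ≤ Real.exp (-v) * v ^ (2 * b + j - 1) := by positivity
    rw [norm_mul, Real.norm_eq_abs, Real.norm_eq_abs, abs_of_nonneg h0]
  have hsum : Summable fun j : ℕ =>
      ∫ v in Set.Ioi (0 : ℝ), ‖K j * (Real.exp (-v) * v ^ (2 * b + j - 1))‖ := by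
    simp only [hnorm, hKG]
    exact hR.summable.abs
  have h := hasSum_integral_of_summable_integral_norm (fun j => (hgam j).const_mul (K j)) hsum
  simp only [hval, hKG] at h
  have hL : ∫ v in Set.Ioi (0 : ℝ), Real.exp (-v) * v ^ (b - 1) * besselPrimitive a (√(4 * x * v)) =
      ∫ v in Set.Ioi (0 : ℝ), ∑' j : ℕ, K j * (Real.exp (-v) * v ^ (2 * b + j - 1)) := by
    refine setIntegral_congr_fun measurableSet_Ioi fun v hv => ?_
    have hv0 : 0 < v := hv
    have hs : 0 < √(4 * x * v) := Real.sqrt_pos.mpr (by positivity)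
    have hP := hasSum_integral_rpow_mul_entireSum (entireCoeff_besselCoeff_zero ha) ha 2 hs
    have hP' : besselPrimitive a (√(4 * x * v)) = _ := hP.tsum_eq.symm
    rw [hP', ← tsum_mul_left]
    refine tsum_congr fun j => ?_
    have e1 : a + 1 + (2 : ℕ) * (j : ℝ) = 2 * (b + j) := by rw [hbdef]; push_cast; ring
    have e2 : √(4 * x * v) ^ (2 * (b + j)) = (4 * x) ^ (b + j) * v ^ (b + j) := by
      rw [Real.sqrt_eq_rpow, ← Real.rpow_mul (by positivity),
        ← Real.mul_rpow (by positivity) hv0.le]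
      congr 1; ring
    have e3 : v ^ (2 * b + j - 1) = v ^ (b - 1) * v ^ (b + j) := by
      rw [← Real.rpow_add hv0]; congr 1; ring
    rw [e1, e2, e3]
    simp only [hK]
    ring
  rw [hL, h.unique hR]
  refine intervalIntegral.integral_congr fun q _ => ?_
  rw [pow_one, entireSum_exp_neg, mul_comm]

/-- The total integral of the Bessel function. -/
theorem tendsto_besselPrimitive (ha : -1 < a) : Tendsto (besselPrimitive a) atTop (𝓝 1) := by
  obtain ⟨L, hL⟩ := exists_tendsto_besselPrimitive ha
  have hb : 0 < (a + 1) / 2 := by linarith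
  set b := (a + 1) / 2 with hbdef
  have hcont := continuous_besselPrimitive ha
  have hgam := Real.GammaIntegral_convergent hb
  obtain ⟨M, hM⟩ : ∃ M : ℝ, ∀ s : ℝ, 0 ≤ s → |besselPrimitive a s| ≤ M := by
    have h1 := hL.abs.eventually (gt_mem_nhds (lt_add_one |L|))
    obtain ⟨R, hR⟩ := (h1.and (eventually_ge_atTop 0)).exists_forall_of_atTop
    obtain ⟨K, hK⟩ := (isCompact_Icc (a := (0 : ℝ)) (b := R)).exists_bound_of_continuousOn
      hcont.continuousOn
    refine ⟨max K (|L| + 1), fun s hs => ?_⟩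
    rcases le_total s R with h | h
    · exact (hK s ⟨hs, h⟩).trans (le_max_left _ _)
    · exact (hR s h).1.le.trans (le_max_right _ _)
  -- As x grows, the average against the Gamma weight tends to Γ(b) times the limit `L`, by
  -- dominated convergence, and also to Γ(b), by the incomplete Gamma formula. Hence `L` is 1.
  have h1 : Tendsto (fun x : ℝ => ∫ v in Set.Ioi (0 : ℝ),
      Real.exp (-v) * v ^ (b - 1) * besselPrimitive a (√(4 * x * v))) atTop
      (𝓝 (∫ v in Set.Ioi (0 : ℝ), Real.exp (-v) * v ^ (b - 1) * L)) := by
    refine tendsto_integral_filter_of_dominated_convergence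
      (fun v => Real.exp (-v) * v ^ (b - 1) * M) ?_ ?_ (hgam.mul_const M) ?_
    · refine Eventually.of_forall fun x => hgam.aestronglyMeasurable.mul ?_
      have : Continuous fun v => besselPrimitive a (√(4 * x * v)) := by fun_prop
      exact this.aestronglyMeasurable
    · refine Eventually.of_forall fun x => ?_
      refine (ae_restrict_mem measurableSet_Ioi).mono fun v hv => ?_
      have : 0 ≤ v ^ (b - 1) := Real.rpow_nonneg (le_of_lt hv) _
      rw [norm_mul, Real.norm_eq_abs, Real.norm_eq_abs, abs_of_nonneg (by positivity)]
      exact mul_le_mul_of_nonneg_left (hM _ (Real.sqrt_nonneg _)) (by positivity)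
    · refine (ae_restrict_mem measurableSet_Ioi).mono fun v hv => ?_
      have hv0 : 0 < v := hv
      refine (hL.comp (Real.tendsto_sqrt_atTop.comp ?_)).const_mul _
      exact (tendsto_id.const_mul_atTop (four_pos : (0 : ℝ) < 4)).atTop_mul_const hv0
  have h2 : Tendsto (fun x : ℝ => ∫ v in Set.Ioi (0 : ℝ),
      Real.exp (-v) * v ^ (b - 1) * besselPrimitive a (√(4 * x * v))) atTop
      (𝓝 (∫ v in Set.Ioi (0 : ℝ), Real.exp (-v) * v ^ (b - 1))) := by
    refine (intervalIntegral_tendsto_integral_Ioi 0 hgam tendsto_id).congr' ?_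
    filter_upwards [eventually_gt_atTop 0] with x hx
    exact (integral_Gamma_mul_besselPrimitive ha hx).symm
  have h3 := tendsto_nhds_unique h1 h2
  rw [integral_mul_const, ← Real.Gamma_eq_integral hb] at h3
  have h4 : L = 1 := mul_left_cancel₀ (Real.Gamma_pos_of_pos hb).ne' (h3.trans (mul_one _).symm)
  rwa [h4] at hL

theorem tendsto_integral_besselJ (ha : -1 < a) {x : ℝ} (hx : 0 ≤ x) :
    Tendsto (fun R : ℝ => ∫ t in x..R, besselJ a t) atTop (𝓝 (1 - besselPrimitive a x)) := by
  refine ((tendsto_besselPrimitive ha).sub_const (besselPrimitive a x)).congr' ?_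
  filter_upwards [eventually_ge_atTop 0] with R hR
  rw [besselPrimitive_eq ha hR, besselPrimitive_eq ha hx,
    intervalIntegral.integral_interval_sub_left (intervalIntegrable_besselJ ha le_rfl hR)
      (intervalIntegrable_besselJ ha le_rfl hx)]

lemma besselJI_eq (ha : -1 < a) {x : ℝ} (hx : 0 ≤ x) :
    besselJI a x = 1 - besselPrimitive a x := (tendsto_integral_besselJ ha hx).limUnder_eq

end BesselDecay

/-! ### Arithmetic of first-order expansions -/

section FirstOrder

/-- `f` agrees with `f₀ + ε f₁` up to `O(ε²)`. -/
def HasFirstOrder (ε f : ℕ → ℝ) (f₀ f₁ : ℝ) : Prop :=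
  (fun n => f n - (f₀ + ε n * f₁)) =O[atTop] fun n => ε n ^ 2

namespace HasFirstOrder

variable {ε f g : ℕ → ℝ} {f₀ f₁ g₀ g₁ : ℝ}

lemma congr (hf : HasFirstOrder ε f f₀ f₁) {h₀ h₁ : ℝ} (e0 : f₀ = h₀) (e1 : f₁ = h₁) :
    HasFirstOrder ε f h₀ h₁ := by rwa [← e0, ← e1]

lemma const (c : ℝ) : HasFirstOrder ε (fun _ => c) c 0 := by
  simpa [HasFirstOrder] using isBigO_zero (fun n => ε n ^ 2) atTop

lemma self : HasFirstOrder ε ε 0 1 := by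
  simpa [HasFirstOrder] using isBigO_zero (fun n => ε n ^ 2) atTop

lemma add (hf : HasFirstOrder ε f f₀ f₁) (hg : HasFirstOrder ε g g₀ g₁) :
    HasFirstOrder ε (fun n => f n + g n) (f₀ + g₀) (f₁ + g₁) :=
  (IsBigO.add hf hg).congr_left fun n => by ring

lemma sub (hf : HasFirstOrder ε f f₀ f₁) (hg : HasFirstOrder ε g g₀ g₁) :
    HasFirstOrder ε (fun n => f n - g n) (f₀ - g₀) (f₁ - g₁) :=
  (IsBigO.sub hf hg).congr_left fun n => by ring

lemma mul (hε : Tendsto ε atTop (𝓝 0)) (hf : HasFirstOrder ε f f₀ f₁)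
    (hg : HasFirstOrder ε g g₀ g₁) :
    HasFirstOrder ε (fun n => f n * g n) (f₀ * g₀) (f₀ * g₁ + f₁ * g₀) := by
  have hb : ∀ c d : ℝ, (fun n => c + ε n * d) =O[atTop] fun _ => (1 : ℝ) := fun c d =>
    ((hε.mul_const d).const_add c).isBigO_one ℝ
  have hε2 : (fun n => ε n ^ 2) =O[atTop] fun _ => (1 : ℝ) := (hε.pow 2).isBigO_one ℝ
  have h1 : (fun n => (f n - (f₀ + ε n * f₁)) * (g₀ + ε n * g₁)) =O[atTop] fun n => ε n ^ 2 := by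
    simpa using IsBigO.mul hf (hb g₀ g₁)
  have hfb : f =O[atTop] fun _ => (1 : ℝ) := by
    simpa using (IsBigO.trans hf hε2).add (hb f₀ f₁)
  have h2 : (fun n => f n * (g n - (g₀ + ε n * g₁))) =O[atTop] fun n => ε n ^ 2 := by
    simpa using IsBigO.mul hfb hg
  have h3 : (fun n => ε n ^ 2 * (f₁ * g₁)) =O[atTop] fun n => ε n ^ 2 := by
    simpa using (isBigO_refl (fun n => ε n ^ 2) atTop).const_mul_left (f₁ * g₁) |>.congr_left
      fun n => mul_comm _ _
  refine ((h1.add h2).add h3).congr_left fun n => ?_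
  ring

lemma const_mul (c : ℝ) (hf : HasFirstOrder ε f f₀ f₁) :
    HasFirstOrder ε (fun n => c * f n) (c * f₀) (c * f₁) :=
  (IsBigO.const_mul_left hf c).congr_left fun n => by ring

lemma of_bound {K : ℝ} (h : ∀ᶠ n in atTop, |f n - (f₀ + ε n * f₁)| ≤ K * ε n ^ 2) :
    HasFirstOrder ε f f₀ f₁ := by
  refine IsBigO.of_bound K (h.mono fun n hn => ?_)
  rwa [Real.norm_eq_abs, Real.norm_eq_abs, abs_of_nonneg (sq_nonneg (ε n))]

end HasFirstOrder

end FirstOrder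

/-! ### Expansion of the density to first order in ε -/

section HardEdgeExpansion

variable {a : ℝ}

/-- Multiplying out leaves, beyond first order, the explicit term -(ε²/8) ∫ t²·`besselOne` and the
series remainder. The latter is dominated by ε² t^a, which is integrable at 0. -/
lemma exists_integral_expand_bound (ha : -1 < a) {s : ℝ} (hs : 0 < s) : ∃ K : ℝ, ∀ ε : ℝ, |ε| ≤ 1 →
    |(∫ t in (0 : ℝ)..s, frobSeries a (besselCoeff a ε) t * (1 - ε * t ^ 2 / 8)) -
      (besselPrimitive a s +
        ε * ∫ t in (0 : ℝ)..s, (besselOne a t - t ^ 2 / 8 * besselJ a t))| ≤ K * ε ^ 2 := by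
  obtain ⟨K, hK, hb⟩ := exists_bound_frobSeries_rem ha s
  set A := ∫ t in (0 : ℝ)..s, t ^ a with hA
  set B := ∫ t in (0 : ℝ)..s, t ^ 2 * besselOne a t with hB
  refine ⟨K * (1 + s ^ 2 / 8) * A + |B| / 8, fun ε hε => ?_⟩
  have hi1 := intervalIntegrable_besselJ ha le_rfl hs.le
  have hi2 : IntervalIntegrable (fun t => besselOne a t - t ^ 2 / 8 * besselJ a t) volume 0 s := by
    refine (intervalIntegrable_besselOne ha le_rfl hs.le).sub ?_
    exact hi1.continuousOn_mul (by fun_prop)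
  have hi3 : IntervalIntegrable (fun t => t ^ 2 * besselOne a t) volume 0 s :=
    (intervalIntegrable_besselOne ha le_rfl hs.le).continuousOn_mul (by fun_prop)
  have hi4 : IntervalIntegrable (fun t => frobSeries a (besselCoeffRem a ε) t *
      (1 - ε * t ^ 2 / 8)) volume 0 s :=
    (intervalIntegrable_frobSeries ha (entireCoeff_besselCoeffRem ha hε) 0 s).mul_continuousOn
      (by fun_prop)
  have e : ∫ t in (0 : ℝ)..s, frobSeries a (besselCoeff a ε) t * (1 - ε * t ^ 2 / 8) =
      ∫ t in (0 : ℝ)..s, (((besselJ a t + ε * (besselOne a t - t ^ 2 / 8 * besselJ a t)) +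
        (-(ε ^ 2 / 8)) * (t ^ 2 * besselOne a t)) +
        frobSeries a (besselCoeffRem a ε) t * (1 - ε * t ^ 2 / 8)) := by
    refine intervalIntegral.integral_congr_ae (ae_of_all _ fun t ht => ?_)
    rw [Set.uIoc_of_le hs.le] at ht
    rw [frobSeries_expand ha hε ht.1]
    ring
  rw [e, intervalIntegral.integral_add ((hi1.add (hi2.const_mul ε)).add (hi3.const_mul _)) hi4,
    intervalIntegral.integral_add (hi1.add (hi2.const_mul ε)) (hi3.const_mul _),
    intervalIntegral.integral_add hi1 (hi2.const_mul ε), intervalIntegral.integral_const_mul,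
    intervalIntegral.integral_const_mul, besselPrimitive_eq ha hs.le, ← hB]
  have hrem : |∫ t in (0 : ℝ)..s, frobSeries a (besselCoeffRem a ε) t * (1 - ε * t ^ 2 / 8)| ≤
      K * (1 + s ^ 2 / 8) * A * ε ^ 2 := by
    have h1 : ∀ᵐ t, t ∈ Set.Ioc 0 s → ‖frobSeries a (besselCoeffRem a ε) t *
        (1 - ε * t ^ 2 / 8)‖ ≤ K * (1 + s ^ 2 / 8) * ε ^ 2 * t ^ a := by
      refine ae_of_all _ fun t ht => ?_
      have h2 := (hb ε t hε ht.1.le ht.2).1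
      have hta : 0 ≤ t ^ a := Real.rpow_nonneg ht.1.le a
      have h3 : |1 - ε * t ^ 2 / 8| ≤ 1 + s ^ 2 / 8 := by
        have h4 : |ε * t ^ 2 / 8| ≤ s ^ 2 / 8 := by
          rw [abs_div, abs_mul, abs_of_nonneg (sq_nonneg t), abs_of_pos (by norm_num : (0 : ℝ) < 8)]
          have : t ^ 2 ≤ s ^ 2 := pow_le_pow_left₀ ht.1.le ht.2 2
          have : |ε| * t ^ 2 ≤ 1 * s ^ 2 := by gcongr
          linarith
        have h5 := abs_sub (1 : ℝ) (ε * t ^ 2 / 8)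
        rw [abs_one] at h5
        linarith
      rw [norm_mul, Real.norm_eq_abs, Real.norm_eq_abs]
      calc _ ≤ K * ε ^ 2 * t ^ a * (1 + s ^ 2 / 8) := by gcongr
        _ = _ := by ring
    have h2 := intervalIntegral.norm_integral_le_of_norm_le hs.le h1
      ((intervalIntegral.intervalIntegrable_rpow' ha).const_mul _)
    rw [intervalIntegral.integral_const_mul, Real.norm_eq_abs, ← hA] at h2
    linarith
  set Q := ∫ t in (0 : ℝ)..s, frobSeries a (besselCoeffRem a ε) t * (1 - ε * t ^ 2 / 8)
  have h6 : |-(ε ^ 2 / 8) * B| = |B| / 8 * ε ^ 2 := by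
    rw [abs_mul, abs_neg, abs_of_nonneg (by positivity)]; ring
  have h7 := abs_add_le (-(ε ^ 2 / 8) * B) Q
  rw [show ∀ u v : ℝ, u + ε * v + -(ε ^ 2 / 8) * B + Q - (u + ε * v) = -(ε ^ 2 / 8) * B + Q from
    fun u v => by ring]
  linarith

lemma tendsto_Nhat_succ (a : ℝ) : Tendsto (fun n : ℕ => Nhat a (n + 1)) atTop atTop := by
  unfold Nhat
  exact tendsto_atTop_add_const_right _ _
    (tendsto_natCast_atTop_atTop.comp (tendsto_add_atTop_nat 1))

lemma Nhat_succ (a : ℝ) (n : ℕ) : Nhat a (n + 1) = n + (a + 1) / 2 := by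
  rw [Nhat]; push_cast; ring

lemma tendsto_inv_sq_Nhat_succ (a : ℝ) :
    Tendsto (fun n : ℕ => 1 / Nhat a (n + 1) ^ 2) atTop (𝓝 0) :=
  tendsto_const_nhds.div_atTop ((tendsto_pow_atTop two_ne_zero).comp (tendsto_Nhat_succ a))

/-- The ratio theorem with b = a and z = N̂: the arguments n + a + 1 and n + 1 are N̂ + (1 ± a)/2,
so the shift in N̂ is precisely what removes the odd powers. -/
lemma hardPrefactor_firstOrder (a : ℝ) :
    HasFirstOrder (fun n => 1 / Nhat a (n + 1) ^ 2) (fun n => hardPrefactor a n (Nhat a (n + 1)))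
      1 (a * (1 - a ^ 2) / 24) := by
  have h := (isBigO_gammaRatio a).comp_tendsto (tendsto_Nhat_succ a)
  refine (h.congr_left fun n => ?_).congr_right fun n => ?_
  · simp only [Function.comp_apply, hardPrefactor]
    rw [← Real.Gamma_nat_eq_factorial, Nhat_succ,
      show (n : ℝ) + (a + 1) / 2 + (1 + a) / 2 = n + a + 1 by ring,
      show (n : ℝ) + (a + 1) / 2 + (1 - a) / 2 = n + 1 by ring]
    ring
  · simp only [Function.comp_apply]
    rw [one_div_pow, ← pow_mul]

/-- The ratio theorem with b = (1 - a)/2 and z = N̂/2; halving the argument multiplies the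
first-order coefficient by 4 and the error bound by 16. -/
lemma hardConst_firstOrder (ha : -1 < a) :
    HasFirstOrder (fun n => 1 / Nhat a (n + 1) ^ 2) (fun n => hardConst a n (Nhat a (n + 1)))
      1 ((1 - a ^ 2) * (3 - a) / 48) := by
  have h := (isBigO_gammaRatio ((1 - a) / 2)).comp_tendsto
    ((tendsto_Nhat_succ a).atTop_div_const two_pos)
  have h2 : (fun n : ℕ => 16 * (1 / Nhat a (n + 1) ^ 2) ^ 2) =O[atTop]
      fun n : ℕ => (1 / Nhat a (n + 1) ^ 2) ^ 2 := (isBigO_refl _ _).const_mul_left 16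
  refine ((h.congr_left fun n => ?_).congr_right fun n => ?_).trans h2
  · simp only [Function.comp_apply, hardConst, loeConst]
    have hk : 0 < Nhat a (n + 1) := by
      have : (0 : ℝ) ≤ n := n.cast_nonneg
      rw [Nhat_succ]; linarith
    rw [show (a - 1) / 2 = -((1 - a) / 2) by ring, Real.rpow_neg (by positivity)]
    have e1 : Nhat a (n + 1) / 2 + (1 + (1 - a) / 2) / 2 = n / 2 + 1 := by rw [Nhat_succ]; ring
    have e2 : Nhat a (n + 1) / 2 + (1 - (1 - a) / 2) / 2 = (n + 1 + a) / 2 := by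
      rw [Nhat_succ]; ring
    rw [e1, e2]
    field_simp
    ring
  · simp only [Function.comp_apply]
    ring

lemma eventually_one_le_Nhat_succ (a : ℝ) : ∀ᶠ n : ℕ in atTop, 1 ≤ Nhat a (n + 1) :=
  (tendsto_Nhat_succ a).eventually_ge_atTop 1

lemma abs_inv_sq_le_one {κ : ℝ} (hκ : 1 ≤ κ) : |1 / κ ^ 2| ≤ 1 := by
  rw [abs_of_pos (by positivity), div_le_one (by positivity)]
  nlinarith

/-- The limiting hard edge density at `s ^ 2 / 2`. -/
noncomputable def hardLimit (a s : ℝ) : ℝ :=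
  (1 / 2 - a ^ 2 / (2 * s ^ 2)) * besselJ a s ^ 2 + 1 / (2 * s ^ 2) * besselEuler a s ^ 2 +
    1 / 2 * (besselJ a s / s) * besselJI a s

/-- The first correction to the hard edge density at `s ^ 2 / 2`. -/
noncomputable def hardCorrection (a s : ℝ) : ℝ :=
  1 / s ^ 2 * ((2 * s ^ 2 - s ^ 4) / 16 * besselJ a s ^ 2 - s ^ 2 / 24 * besselEuler a s ^ 2 -
    s ^ 2 / 12 * (besselJ a s * besselEuler a s)) +
  1 / s * ((s ^ 2 - 6 * a ^ 2 + 6) / 48 * besselJ a s - (s ^ 2 + 2 * a ^ 2 - 2) / 48 *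
    besselEuler a s) * besselJI a s

/-- The quarter in the correction converts ε = 1/N̂² to the stated parameter 1/(2N̂)² = ε/4. -/
theorem loeHardDensity_firstOrder (ha : -1 < a) {s : ℝ} (hs : 0 < s) :
    HasFirstOrder (fun n => 1 / Nhat a (n + 1) ^ 2)
      (fun n => loeHardDensity a (n + 1) (s ^ 2 / 2)) (hardLimit a s) (hardCorrection a s / 4) := by
  have hε := tendsto_inv_sq_Nhat_succ a
  have hκ := eventually_one_le_Nhat_succ a
  set ε : ℕ → ℝ := fun n => 1 / Nhat a (n + 1) ^ 2 with hεdef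
  obtain ⟨K, hK, hb⟩ := exists_bound_frobSeries_rem ha s
  have hV : HasFirstOrder ε (fun n => frobSeries a (besselCoeff a (ε n)) s)
      (besselJ a s) (besselOne a s) := by
    refine .of_bound (K := K * s ^ a) (hκ.mono fun n hn => ?_)
    rw [frobSeries_expand ha (abs_inv_sq_le_one hn) hs, add_sub_cancel_left]
    exact (hb _ s (abs_inv_sq_le_one hn) hs.le le_rfl).1.trans_eq (by ring)
  have hW : HasFirstOrder ε (fun n => frobSeriesEuler a (besselCoeff a (ε n)) s)
      (besselEuler a s) (besselOneEuler a s) := by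
    refine .of_bound (K := K * s ^ a) (hκ.mono fun n hn => ?_)
    rw [frobSeriesEuler_expand ha (abs_inv_sq_le_one hn) hs, add_sub_cancel_left]
    exact (hb _ s (abs_inv_sq_le_one hn) hs.le le_rfl).2.trans_eq (by ring)
  obtain ⟨K', hK'⟩ := exists_integral_expand_bound ha hs
  have hI : HasFirstOrder ε (fun n => ∫ t in (0 : ℝ)..s, frobSeries a (besselCoeff a (ε n)) t *
      (1 - ε n * t ^ 2 / 8)) (besselPrimitive a s)
      (∫ t in (0 : ℝ)..s, (besselOne a t - t ^ 2 / 8 * besselJ a t)) :=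
    .of_bound (hκ.mono fun n hn => hK' _ (abs_inv_sq_le_one hn))
  have hg := hardPrefactor_firstOrder a
  have hk := hardConst_firstOrder ha
  have hc : HasFirstOrder ε (fun n => 1 / 2 - a ^ 2 / (2 * s ^ 2) - ε n * (s ^ 2 / 32)) _ _ :=
    (HasFirstOrder.const (1 / 2 - a ^ 2 / (2 * s ^ 2))).sub
      (HasFirstOrder.self.mul hε (HasFirstOrder.const (s ^ 2 / 32)))
  have hmain := hg.mul hε (((hc.mul hε (hV.mul hε hV)).add
    ((hW.mul hε hW).const_mul (1 / (2 * s ^ 2)))).add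
      ((hV.const_mul (1 / (2 * s))).mul hε (hk.sub hI)))
  have hcong : (fun n => loeHardDensity a (n + 1) (s ^ 2 / 2)) =ᶠ[atTop] _ :=
    hκ.mono fun n hn => loeHardDensity_succ ha n (Nhat_succ a n) hn hs
  refine IsBigO.congr' (hmain.congr (h₀ := hardLimit a s) (h₁ := hardCorrection a s / 4) ?_ ?_) ?_
    EventuallyEq.rfl
  · rw [hardLimit, besselJI_eq ha hs.le]
    field_simp
    ring
  -- The multiples of ∫₀ˢ J combine with the first-order constant into `besselJI`, and the terms
  -- proportional to a(1 - a²) from the prefactor, from `besselOne` and from the constant cancel.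
  · rw [integral_besselOne_sub ha hs, hardCorrection, besselJI_eq ha hs.le, besselPrimitive_eq ha hs.le,
      besselOne, besselOneEuler]
    field_simp
    ring
  · filter_upwards [hcong] with n hn
    rw [hn]
    simp only [hεdef]
    ring

end HardEdgeExpansion

/-! ### Differentiation in the five-function basis -/

section HardEdgeOde

variable {a : ℝ}

lemma basis₁_sq (a : ℝ) {s : ℝ} (hs : 0 < s) : basis₁ a (s ^ 2) = besselJ a s ^ 2 / s ^ 2 := by
  rw [basis₁, Real.sqrt_sq hs.le]; ring

lemma basis₂_sq (ha : -1 < a) {s : ℝ} (hs : 0 < s) :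
    basis₂ a (s ^ 2) = besselEuler a s ^ 2 / s ^ 2 := by
  rw [basis₂, Real.sqrt_sq hs.le, deriv_besselJ ha hs]; ring

lemma basis₃_sq (ha : -1 < a) {s : ℝ} (hs : 0 < s) :
    basis₃ a (s ^ 2) = besselJ a s * besselEuler a s / s ^ 2 := by
  rw [basis₃, Real.sqrt_sq hs.le, deriv_besselJ ha hs]; ring

lemma basis₄_sq (ha : -1 < a) {s : ℝ} (hs : 0 < s) :
    basis₄ a (s ^ 2) = besselJ a s * (1 - besselPrimitive a s) / s := by
  rw [basis₄, Real.sqrt_sq hs.le, besselJI_eq ha hs.le]; ring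

lemma basis₅_sq (ha : -1 < a) {s : ℝ} (hs : 0 < s) :
    basis₅ a (s ^ 2) = besselEuler a s * (1 - besselPrimitive a s) / s := by
  rw [basis₅, Real.sqrt_sq hs.le, deriv_besselJ ha hs, besselJI_eq ha hs.le]; ring

/-- Passing from derivatives in `s` to derivatives in `Y = s ^ 2`. -/
lemma hasDerivAt_of_comp_sq {f g : ℝ → ℝ} (hfg : ∀ s : ℝ, 0 < s → f (s ^ 2) = g s) {s d : ℝ}
    (hs : 0 < s) (hg : HasDerivAt g (2 * d / s) s) : HasDerivAt f (d / s ^ 2) (s ^ 2) := by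
  have h1 : HasDerivAt Real.sqrt (1 / (2 * s)) (s ^ 2) := by
    have := Real.hasDerivAt_sqrt (pow_pos hs 2).ne'
    rwa [Real.sqrt_sq hs.le] at this
  have h2 : HasDerivAt g (2 * d / s) (√(s ^ 2)) := by rwa [Real.sqrt_sq hs.le]
  have h3 := h2.comp (s ^ 2) h1
  have h4 : f =ᶠ[𝓝 (s ^ 2)] g ∘ Real.sqrt := by
    filter_upwards [lt_mem_nhds (pow_pos hs 2)] with Y hY
    rw [Function.comp_apply, ← hfg _ (Real.sqrt_pos.mpr hY), Real.sq_sqrt hY.le]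
  refine (h3.congr_of_eventuallyEq h4).congr_deriv ?_
  field_simp

/-- Bessel's equation and JI' = -J make the five functions stable under Y d/dY with coefficients of
degree at most one in Y. Higher derivatives are therefore polynomial combinations of the same
functions. -/
lemma hasDerivAt_basis (ha : -1 < a) {Y : ℝ} (hY : 0 < Y) :
    HasDerivAt (basis₁ a) ((basis₃ a Y - basis₁ a Y) / Y) Y ∧
    HasDerivAt (basis₂ a) (((a ^ 2 - Y) * basis₃ a Y - basis₂ a Y) / Y) Y ∧
    HasDerivAt (basis₃ a)
      (((basis₂ a Y + (a ^ 2 - Y) * basis₁ a Y) / 2 - basis₃ a Y) / Y) Y ∧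
    HasDerivAt (basis₄ a) ((basis₅ a Y / 2 - Y * basis₁ a Y / 2 - basis₄ a Y / 2) / Y) Y ∧
    HasDerivAt (basis₅ a)
      (((a ^ 2 - Y) * basis₄ a Y / 2 - Y * basis₃ a Y / 2 - basis₅ a Y / 2) / Y) Y := by
  obtain ⟨s, hs, rfl⟩ : ∃ s : ℝ, 0 < s ∧ s ^ 2 = Y :=
    ⟨√Y, Real.sqrt_pos.mpr hY, Real.sq_sqrt hY.le⟩
  have hJ := hasDerivAt_besselJ ha hs
  have hE := hasDerivAt_besselEuler ha hs
  have hI := (hasDerivAt_besselPrimitive ha hs).const_sub 1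
  have h2 : HasDerivAt (fun s : ℝ => s ^ 2) (2 * s) s := by simpa using hasDerivAt_pow 2 s
  have h2' : s ^ 2 ≠ 0 := by positivity
  have h1 := hasDerivAt_id s
  rw [basis₁_sq a hs, basis₂_sq ha hs, basis₃_sq ha hs, basis₄_sq ha hs, basis₅_sq ha hs]
  refine ⟨hasDerivAt_of_comp_sq (fun s hs => basis₁_sq a hs) hs (((hJ.pow 2).div h2 h2').congr_deriv ?_),
    hasDerivAt_of_comp_sq (fun s hs => basis₂_sq ha hs) hs (((hE.pow 2).div h2 h2').congr_deriv ?_),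
    hasDerivAt_of_comp_sq (fun s hs => basis₃_sq ha hs) hs (((hJ.mul hE).div h2 h2').congr_deriv ?_),
    hasDerivAt_of_comp_sq (fun s hs => basis₄_sq ha hs) hs
      (((hJ.mul hI).div h1 hs.ne').congr_deriv ?_),
    hasDerivAt_of_comp_sq (fun s hs => basis₅_sq ha hs) hs
      (((hE.mul hI).div h1 hs.ne').congr_deriv ?_)⟩ <;>
  · simp only [Pi.pow_apply, Pi.mul_apply, id]
    field_simp
    try ring

/-- The combination of the basis functions with a vector of polynomial coefficients. -/
noncomputable def basisForm (a : ℝ) (p : Fin 5 → ℝ[X]) (y : ℝ) : ℝ :=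
  besselForm a (p 0) (p 1) (p 2) (p 3) (p 4) y

/-- `q` is the vector of coefficients of `(y d/dy - k)` applied to the combination `p`. -/
def IsEulerStep (a : ℝ) (k : ℕ) (p q : Fin 5 → ℝ[X]) : Prop := ∀ Y : ℝ,
  (q 0).eval Y = Y * (derivative (p 0)).eval Y - (k + 1) * (p 0).eval Y +
    (a ^ 2 - Y) / 2 * (p 2).eval Y - Y / 2 * (p 3).eval Y ∧
  (q 1).eval Y = Y * (derivative (p 1)).eval Y - (k + 1) * (p 1).eval Y + (p 2).eval Y / 2 ∧
  (q 2).eval Y = Y * (derivative (p 2)).eval Y - (k + 1) * (p 2).eval Y + (p 0).eval Y +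
    (a ^ 2 - Y) * (p 1).eval Y - Y / 2 * (p 4).eval Y ∧
  (q 3).eval Y = Y * (derivative (p 3)).eval Y - (k + 1 / 2) * (p 3).eval Y +
    (a ^ 2 - Y) / 2 * (p 4).eval Y ∧
  (q 4).eval Y = Y * (derivative (p 4)).eval Y - (k + 1 / 2) * (p 4).eval Y + (p 3).eval Y / 2

/-- The Euler operator commutes with the dilation Y = 2y, and the shift by `k` accounts for
differentiating the denominator y^k. -/
lemma IsEulerStep.hasDerivAt (ha : -1 < a) {k : ℕ} {p q : Fin 5 → ℝ[X]} (h : IsEulerStep a k p q)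
    {y : ℝ} (hy : 0 < y) : HasDerivAt (fun y => basisForm a p (2 * y) / y ^ k)
      (basisForm a q (2 * y) / y ^ (k + 1)) y := by
  obtain ⟨d1, d2, d3, d4, d5⟩ := hasDerivAt_basis ha (show 0 < 2 * y by positivity)
  obtain ⟨e1, e2, e3, e4, e5⟩ := h (2 * y)
  have hF : HasDerivAt (basisForm a p) _ (2 * y) :=
    ((((((p 0).hasDerivAt (2 * y)).mul d1).add (((p 1).hasDerivAt (2 * y)).mul d2)).add
      (((p 2).hasDerivAt (2 * y)).mul d3)).add (((p 3).hasDerivAt (2 * y)).mul d4)).add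
      (((p 4).hasDerivAt (2 * y)).mul d5)
  have h2 : HasDerivAt (fun y : ℝ => 2 * y) 2 y := by simpa using (hasDerivAt_id y).const_mul 2
  have h3 : HasDerivAt (fun y : ℝ => y ^ k) (k * y ^ k / y) y := by
    refine (hasDerivAt_pow k y).congr_deriv ?_
    rcases k with _ | k
    · simp
    · rw [Nat.add_sub_cancel, pow_succ]; field_simp
  have h4 := (hF.comp y h2).div h3 (pow_pos hy k).ne'
  refine h4.congr_deriv ?_
  simp only [Function.comp_apply, basisForm, besselForm, e1, e2, e3, e4, e5]
  field_simp
  ring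

lemma iteratedDeriv_eq_of_hasDerivAt {g : ℕ → ℝ → ℝ} {m : ℕ}
    (h : ∀ k < m, ∀ y : ℝ, 0 < y → HasDerivAt (g k) (g (k + 1) y) y) :
    ∀ k ≤ m, ∀ y : ℝ, 0 < y → iteratedDeriv k (g 0) y = g k y := by
  intro k
  induction k with
  | zero => intro _ y _; rw [iteratedDeriv_zero]
  | succ k ih =>
    intro hk y hy
    rw [iteratedDeriv_succ]
    have h1 : iteratedDeriv k (g 0) =ᶠ[𝓝 y] g k := by
      filter_upwards [lt_mem_nhds hy] with z hz
      exact ih (by omega) z hz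
    rw [h1.deriv_eq, (h k (by omega) y hy).deriv]

/-- The polynomial with the given coefficients, in increasing order. -/
noncomputable def quartic (c₀ c₁ c₂ c₃ c₄ : ℝ) : ℝ[X] :=
  C c₀ + C c₁ * X + C c₂ * X ^ 2 + C c₃ * X ^ 3 + C c₄ * X ^ 4

lemma eval_quartic (c₀ c₁ c₂ c₃ c₄ Y : ℝ) :
    (quartic c₀ c₁ c₂ c₃ c₄).eval Y = c₀ + c₁ * Y + c₂ * Y ^ 2 + c₃ * Y ^ 3 + c₄ * Y ^ 4 := by
  simp only [quartic, eval_add, eval_mul, eval_C, eval_X, eval_pow]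

lemma eval_derivative_quartic (c₀ c₁ c₂ c₃ c₄ Y : ℝ) : (derivative (quartic c₀ c₁ c₂ c₃ c₄)).eval Y =
    c₁ + 2 * c₂ * Y + 3 * c₃ * Y ^ 2 + 4 * c₄ * Y ^ 3 := by
  simp only [quartic, derivative_add, derivative_C, derivative_C_mul_X, derivative_C_mul_X_pow,
    eval_add, eval_mul, eval_C, eval_X, eval_pow, eval_zero]
  push_cast
  ring

/-- Coefficients, in `2 y`, of `y ^ k` times the `k`-th derivative of the limiting density. -/
noncomputable def limitCoeff (a : ℝ) : ℕ → Fin 5 → ℝ[X]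
  | 0 => ![quartic (-a ^ 2 / 2) (1 / 2) 0 0 0,
      quartic (1 / 2) 0 0 0 0,
      0,
      quartic (1 / 2) 0 0 0 0,
      0]
  | 1 => ![quartic (a ^ 2 / 2) (-1 / 4) 0 0 0,
      quartic (-1 / 2) 0 0 0 0,
      0,
      quartic (-1 / 4) 0 0 0 0,
      quartic (1 / 4) 0 0 0 0]
  | 2 => ![quartic (-a ^ 2) (3 / 8) 0 0 0,
      quartic 1 0 0 0 0,
      quartic 0 (1 / 8) 0 0 0,
      quartic ((a ^ 2 + 3) / 8) (-1 / 8) 0 0 0,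
      quartic (-1 / 2) 0 0 0 0]
  | 3 => ![quartic (3 * a ^ 2) (-15 / 16) 0 0 0,
      quartic (-3) (1 / 16) 0 0 0,
      quartic 0 (-5 / 8) 0 0 0,
      quartic ((-9 * a ^ 2 - 15) / 16) (7 / 16) 0 0 0,
      quartic ((a ^ 2 + 23) / 16) (-1 / 16) 0 0 0]
  | 4 => ![quartic (-12 * a ^ 2) ((-a ^ 2 + 105) / 32) (3 / 32) 0 0,
      quartic 12 (-1 / 2) 0 0 0,
      quartic 0 ((a ^ 2 + 103) / 32) (-1 / 32) 0 0,
      quartic ((a ^ 4 + 86 * a ^ 2 + 105) / 32) ((-a ^ 2 - 29) / 16) (1 / 32) 0 0,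
      quartic ((-a ^ 2 - 11) / 2) (3 / 8) 0 0 0]
  | 5 => ![quartic (60 * a ^ 2) ((25 * a ^ 2 - 945) / 64) (-63 / 64) 0 0,
      quartic (-60) ((a ^ 2 + 231) / 64) (-1 / 64) 0 0,
      quartic 0 ((-13 * a ^ 2 - 603) / 32) (1 / 2) 0 0,
      quartic ((-25 * a ^ 4 - 950 * a ^ 2 - 945) / 64) ((21 * a ^ 2 + 291) / 32) (-17 / 64) 0 0,
      quartic ((a ^ 4 + 230 * a ^ 2 + 1689) / 64) ((-a ^ 2 - 71) / 32) (1 / 64) 0 0]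
  | _ => 0

/-- Coefficients, in `2 y`, of `y ^ k` times the `k`-th derivative of the particular solution. -/
noncomputable def particularCoeff (a : ℝ) : ℕ → Fin 5 → ℝ[X]
  | 0 => ![quartic ((-a ^ 4 + a ^ 2) / 8) (a ^ 2 / 8) (-1 / 16) 0 0,
      quartic ((a ^ 2 - 1) / 8) (-1 / 24) 0 0 0,
      quartic 0 (-1 / 12) 0 0 0,
      quartic 0 (1 / 48) 0 0 0,
      quartic ((-a ^ 2 + 1) / 24) (-1 / 48) 0 0 0]
  | 1 => ![quartic ((a ^ 4 - a ^ 2) / 8) (-a ^ 2 / 24) (-1 / 32) 0 0,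
      quartic ((-a ^ 2 + 1) / 8) (-1 / 24) 0 0 0,
      quartic 0 ((-a ^ 2 + 5) / 48) (-1 / 96) 0 0,
      quartic ((-a ^ 4 + a ^ 2) / 48) ((a ^ 2 - 1) / 96) (1 / 96) 0 0,
      quartic ((a ^ 2 - 1) / 48) 0 0 0 0]
  | 2 => ![quartic ((-a ^ 4 + a ^ 2) / 4) (a ^ 2 / 12) (-3 / 64) 0 0,
      quartic ((a ^ 2 - 1) / 4) ((-a ^ 2 + 9) / 96) (-1 / 192) 0 0,
      quartic 0 ((5 * a ^ 2 - 21) / 96) (1 / 96) 0 0,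
      quartic ((a ^ 4 - a ^ 2) / 24) ((-a ^ 2 + 1) / 64) (1 / 192) 0 0,
      quartic ((-a ^ 4 - 2 * a ^ 2 + 3) / 96) ((a ^ 2 - 1) / 192) (1 / 192) 0 0]
  | 3 => ![quartic ((3 * a ^ 4 - 3 * a ^ 2) / 4) ((a ^ 4 - 49 * a ^ 2) / 192)
        ((-5 * a ^ 2 + 57) / 384) (-1 / 128) 0,
      quartic ((-3 * a ^ 2 + 3) / 4) ((3 * a ^ 2 - 19) / 64) (1 / 96) 0 0,
      quartic 0 ((-a ^ 4 - 32 * a ^ 2 + 129) / 192) ((a ^ 2 - 57) / 384) (1 / 384) 0,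
      quartic ((-a ^ 6 - 22 * a ^ 4 + 23 * a ^ 2) / 192) ((a ^ 4 + 4 * a ^ 2 - 5) / 128) 0
        (-1 / 384) 0,
      quartic ((3 * a ^ 4 + 2 * a ^ 2 - 5) / 64) ((-a ^ 2 + 1) / 64) 0 0 0]
  | 4 => ![quartic (-3 * a ^ 4 + 3 * a ^ 2) ((-a ^ 4 + 25 * a ^ 2) / 24) ((5 * a ^ 2 - 157) / 256)
        (21 / 256) 0,
      quartic (3 * a ^ 2 - 3) ((-a ^ 4 - 86 * a ^ 2 + 471) / 384) ((a ^ 2 - 73) / 768) (1 / 768) 0,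
      quartic 0 ((17 * a ^ 4 + 262 * a ^ 2 - 1047) / 384) ((-3 * a ^ 2 + 47) / 64) (-1 / 48) 0,
      quartic ((a ^ 6 + 10 * a ^ 4 - 11 * a ^ 2) / 24) ((-13 * a ^ 4 - 22 * a ^ 2 + 35) / 256)
        ((a ^ 2 - 1) / 128) (1 / 768) 0,
      quartic ((-a ^ 6 - 85 * a ^ 4 - 19 * a ^ 2 + 105) / 384) ((a ^ 4 + 14 * a ^ 2 - 15) / 256) 0
        (-1 / 768) 0]
  | 5 => ![quartic (15 * a ^ 4 - 15 * a ^ 2) ((a ^ 6 + 230 * a ^ 4 - 4071 * a ^ 2) / 768)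
        ((-31 * a ^ 4 + 16 * a ^ 2 + 4815) / 1536) ((7 * a ^ 2 - 405) / 768) (5 / 512),
      quartic (-15 * a ^ 2 + 15) ((25 * a ^ 4 + 950 * a ^ 2 - 4815) / 768)
        ((-7 * a ^ 2 + 167) / 256) (-5 / 384) 0,
      quartic 0 ((-a ^ 6 - 255 * a ^ 4 - 2639 * a ^ 2 + 10575) / 768)
        ((a ^ 4 + 134 * a ^ 2 - 2055) / 512) (7 / 32) (-1 / 1536),
      quartic ((-a ^ 8 - 229 * a ^ 6 - 1459 * a ^ 4 + 1689 * a ^ 2) / 768)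
        ((5 * a ^ 6 + 485 * a ^ 4 + 455 * a ^ 2 - 945) / 1536) ((-a ^ 4 - 24 * a ^ 2 + 25) / 512)
        ((-a ^ 2 - 3) / 1536) (1 / 1536),
      quartic ((25 * a ^ 6 + 925 * a ^ 4 - 5 * a ^ 2 - 945) / 768)
        ((-5 * a ^ 4 - 30 * a ^ 2 + 35) / 128) ((a ^ 2 - 1) / 256) (1 / 384) 0]
  | _ => 0

/-- Only polynomial identities in Y and `a` need checking, since the coefficients of each derivative
are tabulated. -/
lemma isEulerStep_limitCoeff (a : ℝ) (k : ℕ) (hk : k < 5) :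
    IsEulerStep a k (limitCoeff a k) (limitCoeff a (k + 1)) := by
  intro Y
  interval_cases k <;> refine ⟨?_, ?_, ?_, ?_, ?_⟩ <;>
  · simp only [limitCoeff, Matrix.cons_val, eval_quartic, eval_derivative_quartic, eval_zero,
      derivative_zero, zero_add, Nat.reduceAdd]
    push_cast
    ring

lemma isEulerStep_particularCoeff (a : ℝ) (k : ℕ) (hk : k < 5) :
    IsEulerStep a k (particularCoeff a k) (particularCoeff a (k + 1)) := by
  intro Y
  interval_cases k <;> refine ⟨?_, ?_, ?_, ?_, ?_⟩ <;>
  · simp only [particularCoeff, Matrix.cons_val, eval_quartic, eval_derivative_quartic, zero_add,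
      Nat.reduceAdd]
    push_cast
    ring

end HardEdgeOde

/-! ### The coefficients r₀ and r₁, their equations and uniqueness -/

section HardEdgeCoefficients

variable {a : ℝ}

/-- The leading coefficient of the hard edge expansion. -/
noncomputable def hardR₀ (a y : ℝ) : ℝ := basisForm a (limitCoeff a 0) (2 * y)

/-- The particular solution of the inhomogeneous equation. -/
noncomputable def hardP (a y : ℝ) : ℝ := basisForm a (particularCoeff a 0) (2 * y)

/-- The first correction in the hard edge expansion. -/
noncomputable def hardR₁ (a y : ℝ) : ℝ := (1 - a ^ 2) / 4 * hardR₀ a y + hardP a y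

lemma iteratedDeriv_hardR₀ (ha : -1 < a) {k : ℕ} (hk : k ≤ 5) {y : ℝ} (hy : 0 < y) :
    iteratedDeriv k (hardR₀ a) y = basisForm a (limitCoeff a k) (2 * y) / y ^ k := by
  have h := iteratedDeriv_eq_of_hasDerivAt
    (g := fun k y => basisForm a (limitCoeff a k) (2 * y) / y ^ k)
    (fun k hk y hy => (isEulerStep_limitCoeff a k hk).hasDerivAt ha hy) k hk y hy
  simp only [pow_zero, div_one] at h
  exact h

lemma iteratedDeriv_hardP (ha : -1 < a) {k : ℕ} (hk : k ≤ 5) {y : ℝ} (hy : 0 < y) :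
    iteratedDeriv k (hardP a) y = basisForm a (particularCoeff a k) (2 * y) / y ^ k := by
  have h := iteratedDeriv_eq_of_hasDerivAt
    (g := fun k y => basisForm a (particularCoeff a k) (2 * y) / y ^ k)
    (fun k hk y hy => (isEulerStep_particularCoeff a k hk).hasDerivAt ha hy) k hk y hy
  simp only [pow_zero, div_one] at h
  exact h

lemma iteratedDeriv_hardR₁ (ha : -1 < a) {k : ℕ} (hk : k ≤ 5) {y : ℝ} (hy : 0 < y) :
    iteratedDeriv k (hardR₁ a) y =
      (1 - a ^ 2) / 4 * iteratedDeriv k (hardR₀ a) y + iteratedDeriv k (hardP a) y := by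
  have h := iteratedDeriv_eq_of_hasDerivAt
    (g := fun k y => (1 - a ^ 2) / 4 * (basisForm a (limitCoeff a k) (2 * y) / y ^ k) +
      basisForm a (particularCoeff a k) (2 * y) / y ^ k)
    (fun k hk y hy => (((isEulerStep_limitCoeff a k hk).hasDerivAt ha hy).const_mul _).add
      ((isEulerStep_particularCoeff a k hk).hasDerivAt ha hy)) k hk y hy
  rw [iteratedDeriv_hardR₀ ha hk hy, iteratedDeriv_hardP ha hk hy, ← h]
  simp only [pow_zero, div_one]
  rfl

/-- Each y^k times a k-th derivative is a tabulated combination, and the coefficients of the basis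
values cancel identically. Linear independence of the basis is not involved. -/
theorem hardD₀_hardR₀ (ha : -1 < a) {y : ℝ} (hy : 0 < y) : hardD₀ a (hardR₀ a) y = 0 := by
  simp only [hardD₀]
  rw [iteratedDeriv_hardR₀ ha (k := 1) (by norm_num) hy,
    iteratedDeriv_hardR₀ ha (k := 2) (by norm_num) hy,
    iteratedDeriv_hardR₀ ha (k := 3) (by norm_num) hy,
    iteratedDeriv_hardR₀ ha (k := 4) (by norm_num) hy,
    iteratedDeriv_hardR₀ ha (k := 5) (by norm_num) hy]
  simp only [hardR₀, basisForm, besselForm, limitCoeff, Matrix.cons_val, eval_quartic, eval_zero]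
  field_simp
  ring

theorem hardD₀_hardP (ha : -1 < a) {y : ℝ} (hy : 0 < y) :
    hardD₀ a (hardP a) y = -hardD₁ a (hardR₀ a) y := by
  simp only [hardD₀, hardD₁]
  rw [iteratedDeriv_hardR₀ ha (k := 1) (by norm_num) hy,
    iteratedDeriv_hardR₀ ha (k := 2) (by norm_num) hy,
    iteratedDeriv_hardR₀ ha (k := 3) (by norm_num) hy,
    iteratedDeriv_hardP ha (k := 1) (by norm_num) hy,
    iteratedDeriv_hardP ha (k := 2) (by norm_num) hy,
    iteratedDeriv_hardP ha (k := 3) (by norm_num) hy,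
    iteratedDeriv_hardP ha (k := 4) (by norm_num) hy,
    iteratedDeriv_hardP ha (k := 5) (by norm_num) hy]
  simp only [hardR₀, hardP, basisForm, besselForm, limitCoeff, particularCoeff, Matrix.cons_val,
    eval_quartic, eval_zero]
  field_simp
  ring

theorem hardD₀_hardR₁ (ha : -1 < a) {y : ℝ} (hy : 0 < y) :
    hardD₀ a (hardR₁ a) y = -hardD₁ a (hardR₀ a) y := by
  have h : hardD₀ a (hardR₁ a) y =
      (1 - a ^ 2) / 4 * hardD₀ a (hardR₀ a) y + hardD₀ a (hardP a) y := by
    simp only [hardD₀]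
    rw [iteratedDeriv_hardR₁ ha (k := 1) (by norm_num) hy,
      iteratedDeriv_hardR₁ ha (k := 2) (by norm_num) hy,
      iteratedDeriv_hardR₁ ha (k := 3) (by norm_num) hy,
      iteratedDeriv_hardR₁ ha (k := 4) (by norm_num) hy,
      iteratedDeriv_hardR₁ ha (k := 5) (by norm_num) hy, hardR₁]
    ring
  rw [h, hardD₀_hardR₀ ha hy, hardD₀_hardP ha hy, mul_zero, zero_add]

lemma hardR₀_sq (ha : -1 < a) {s : ℝ} (hs : 0 < s) : hardR₀ a (s ^ 2 / 2) = hardLimit a s := by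
  rw [hardR₀, mul_div_cancel₀ _ two_ne_zero, hardLimit, besselJI_eq ha hs.le]
  simp only [basisForm, besselForm, limitCoeff, Matrix.cons_val, eval_quartic, eval_zero,
    basis₁_sq a hs, basis₂_sq ha hs, basis₃_sq ha hs, basis₄_sq ha hs, basis₅_sq ha hs]
  field_simp
  ring

lemma hardR₁_sq (ha : -1 < a) {s : ℝ} (hs : 0 < s) :
    hardR₁ a (s ^ 2 / 2) = hardCorrection a s := by
  rw [hardR₁, hardR₀, hardP, mul_div_cancel₀ _ two_ne_zero, hardCorrection, besselJI_eq ha hs.le]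
  simp only [basisForm, besselForm, limitCoeff, particularCoeff, Matrix.cons_val, eval_quartic,
    eval_zero, basis₁_sq a hs, basis₂_sq ha hs, basis₃_sq ha hs, basis₄_sq ha hs, basis₅_sq ha hs]
  field_simp
  ring

theorem hasHardEdgeExpansion_hardR (ha : -1 < a) :
    HasHardEdgeExpansion a (hardR₀ a) (hardR₁ a) := by
  intro y hy
  obtain ⟨s, hs, rfl⟩ : ∃ s : ℝ, 0 < s ∧ s ^ 2 / 2 = y :=
    ⟨√(2 * y), Real.sqrt_pos.mpr (by positivity), by rw [Real.sq_sqrt (by positivity)]; ring⟩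
  -- The closed form concerns `n + 1` eigenvalues, so the asymptotic statement is shifted by one.
  rw [← map_add_atTop_eq_nat 1, isBigO_map, hardR₀_sq ha hs, hardR₁_sq ha hs]
  have h := loeHardDensity_firstOrder ha hs
  have h2 : (fun n : ℕ => (1 / Nhat a (n + 1) ^ 2) ^ 2) =O[atTop]
      fun n : ℕ => 1 / (2 * Nhat a (n + 1)) ^ 4 :=
    ((isBigO_refl (fun n : ℕ => 1 / (2 * Nhat a (n + 1)) ^ 4) atTop).const_mul_left 16).congr_left
      fun n => by ring
  refine (h.congr_left fun n => ?_).trans h2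
  simp only [Function.comp_apply]
  ring

/-- The coefficients of the expansion are determined by the density. -/
theorem HasHardEdgeExpansion.unique {r₀ r₁ s₀ s₁ : ℝ → ℝ} (hr : HasHardEdgeExpansion a r₀ r₁)
    (hs : HasHardEdgeExpansion a s₀ s₁) {y : ℝ} (hy : 0 < y) : s₀ y = r₀ y ∧ s₁ y = r₁ y := by
  have hN : Tendsto (fun N : ℕ => 2 * Nhat a N) atTop atTop := by
    refine Tendsto.const_mul_atTop two_pos ?_
    exact tendsto_atTop_add_const_right _ _ tendsto_natCast_atTop_atTop
  set δ : ℕ → ℝ := fun N => 1 / (2 * Nhat a N) ^ 2 with hδ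
  have hδ0 : Tendsto δ atTop (𝓝 0) :=
    tendsto_const_nhds.div_atTop ((tendsto_pow_atTop two_ne_zero).comp hN)
  have hδpos : ∀ᶠ N in atTop, δ N ≠ 0 := by
    filter_upwards [hN.eventually_gt_atTop 0] with N h
    simp only [hδ]
    positivity
  have h1 : (fun N => (r₀ y - s₀ y) + δ N * (r₁ y - s₁ y)) =O[atTop] fun N => δ N * δ N := by
    refine (((hs y hy).sub (hr y hy)).congr_left fun N => ?_).congr_right fun N => ?_
    · simp only [hδ]; ring
    · simp only [hδ]; ring
  have e0 : r₀ y - s₀ y = 0 := by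
    have h2 : Tendsto (fun N => (r₀ y - s₀ y) + δ N * (r₁ y - s₁ y)) atTop (𝓝 0) :=
      h1.trans_tendsto (by simpa using hδ0.mul hδ0)
    have h3 : Tendsto (fun N => (r₀ y - s₀ y) + δ N * (r₁ y - s₁ y)) atTop (𝓝 (r₀ y - s₀ y)) := by
      simpa using (hδ0.mul_const (r₁ y - s₁ y)).const_add (r₀ y - s₀ y)
    exact tendsto_nhds_unique h3 h2
  have e1 : r₁ y - s₁ y = 0 := by
    simp only [e0, zero_add] at h1
    -- Once the leading coefficients agree, one factor δ, eventually nonzero, can be cancelled, so a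
    -- constant is bounded by a null sequence.
    have h2 : (fun _ : ℕ => r₁ y - s₁ y) =O[atTop] δ := by
      obtain ⟨K, hK⟩ := h1.bound
      refine IsBigO.of_bound K ?_
      filter_upwards [hK, hδpos] with N h hN
      rw [norm_mul, norm_mul, mul_left_comm] at h
      exact le_of_mul_le_mul_left h (norm_pos_iff.mpr hN)
    exact tendsto_nhds_unique tendsto_const_nhds (h2.trans_tendsto hδ0)
  exact ⟨by linarith, by linarith⟩

/-- The limiting density does not vanish near the origin. -/
lemma exists_hardR₀_ne_zero (ha : -1 < a) : ∃ y : ℝ, 0 < y ∧ hardR₀ a y ≠ 0 := by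
  have hc := entireCoeff_besselCoeff_zero ha
  set u : ℝ → ℝ := fun s => entireSum (besselCoeff a 0) (s ^ 2) with hu
  set d : ℝ → ℝ := fun s => entireSum (derivCoeff (besselCoeff a 0)) (s ^ 2) with hd
  -- This is s^(1-a) r₀(s²/2), rewritten to be continuous at 0. All terms but the one with
  -- `besselJI` vanish there, and that one gives half the leading Bessel coefficient.
  set F : ℝ → ℝ := fun s => s ^ (a + 1) * (u s ^ 2 / 2 + 2 * a * u s * d s + 2 * s ^ 2 * d s ^ 2) +
    u s / 2 * (1 - besselPrimitive a s) with hF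
  have hcont : Continuous F := by
    have h1 := hc.continuous
    have h2 := hc.derivCoeff.continuous
    have h3 := continuous_besselPrimitive ha
    have h4 : Continuous fun s : ℝ => s ^ (a + 1) := Real.continuous_rpow_const (by linarith)
    fun_prop
  have hF0 : F 0 ≠ 0 := by
    have h1 : u 0 = besselCoeff a 0 0 := by
      simp only [hu, entireSum]
      rw [tsum_eq_single 0 (fun j hj => by simp [hj])]
      simp
    simp only [hF, h1, besselPrimitive, intervalIntegral.integral_same]
    rw [Real.zero_rpow (by linarith)]
    have := besselCoeffZero_pos ha 0
    simp [this.ne']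
  have hev : ∀ᶠ s in 𝓝[>] (0 : ℝ), F s ≠ 0 :=
    (hcont.continuousAt.eventually_ne hF0).filter_mono nhdsWithin_le_nhds
  obtain ⟨s, hFs, hs⟩ := (hev.and self_mem_nhdsWithin).exists
  have hs0 : 0 < s := hs
  refine ⟨s ^ 2 / 2, by positivity, fun h => hFs ?_⟩
  rw [hardR₀_sq ha hs0, hardLimit, besselJ_eq ha hs0, besselJI_eq ha hs0.le, besselEuler,
    frobSeriesEuler, frobSeries, hc.sum_euler] at h
  have hsa : 0 < s ^ a := by positivity
  have e : F s * s ^ a = 0 * s := by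
    rw [← h]
    simp only [hF, hu, hd]
    rw [Real.rpow_add_one hs0.ne']
    field_simp
    ring
  rw [zero_mul] at e
  exact (mul_eq_zero.mp e).resolve_right hsa.ne'

end HardEdgeCoefficients
-- The main theorem
theorem mainTheorem2 (a : ℝ) (ha : -1 < a) :
    -- the improper integral in the basis functions converges
    (∀ x : ℝ, 0 < x →
      Tendsto (fun R : ℝ => ∫ t in x..R, besselJ a t) atTop (𝓝 (besselJI a x))) ∧
    ∃ r₀ r₁ P : ℝ → ℝ,
      -- the expansion exists and its first two coefficients are `r₀`, `r₁`
      HasHardEdgeExpansion a r₀ r₁ ∧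
      (∀ s₀ s₁ : ℝ → ℝ, HasHardEdgeExpansion a s₀ s₁ →
        ∀ y : ℝ, 0 < y → s₀ y = r₀ y ∧ s₁ y = r₁ y) ∧
      -- explicit forms in the five-function basis
      (∀ y : ℝ, 0 < y →
        r₀ (y / 2) = besselForm a (C (1 / 2) * (X - C (a ^ 2))) (C (1 / 2)) 0 (C (1 / 2)) 0 y) ∧
      (∀ y : ℝ, 0 < y →
        P (y / 2) = besselForm a
          (-(C (1 / 16) * ((X - C (a ^ 2)) ^ 2 + C (a ^ 4 - 2 * a ^ 2))))
          (-(C (1 / 24) * (X - C (3 * a ^ 2) + 3)))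
          (-(C (1 / 12) * X))
          (C (1 / 48) * X)
          (-(C (1 / 48) * (X + C (2 * a ^ 2) - 2))) y) ∧
      (∀ y : ℝ, 0 < y →
        r₁ (y / 2) = besselForm a
          (C (1 / 16) * (2 * X - X ^ 2))
          (-(C (1 / 24) * X))
          (-(C (1 / 12) * X))
          (C (1 / 48) * (X - C (6 * a ^ 2) + 6))
          (-(C (1 / 48) * (X + C (2 * a ^ 2) - 2))) y) ∧
      (∀ y : ℝ, 0 < y → r₁ (y / 2) = (1 - a ^ 2) / 4 * r₀ (y / 2) + P (y / 2)) ∧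
      -- `r₀` solves the homogeneous equation, `P` and `r₁` the inhomogeneous one
      (∀ y : ℝ, 0 < y → hardD₀ a r₀ y = 0) ∧
      (∀ y : ℝ, 0 < y → hardD₀ a P y = -hardD₁ a r₀ y) ∧
      (∀ y : ℝ, 0 < y → hardD₀ a r₁ y = -hardD₁ a r₀ y) ∧
      -- the contribution of the homogeneous solution to `r₁` does not vanish
      (a ≠ 1 → (1 - a ^ 2) / 4 ≠ 0 ∧ ∃ y : ℝ, 0 < y ∧ (1 - a ^ 2) / 4 * r₀ y ≠ 0) := by
  have h2 : ∀ y : ℝ, 2 * (y / 2) = y := fun y => by ring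
  refine ⟨fun x hx => ?_, hardR₀ a, hardR₁ a, hardP a, hasHardEdgeExpansion_hardR ha,
    fun s₀ s₁ hs y hy => (hasHardEdgeExpansion_hardR ha).unique hs hy, fun y hy => ?_,
    fun y hy => ?_, fun y hy => ?_, fun y _ => rfl, fun y hy => hardD₀_hardR₀ ha hy,
    fun y hy => hardD₀_hardP ha hy, fun y hy => hardD₀_hardR₁ ha hy, fun ha1 => ?_⟩
  · rw [besselJI_eq ha hx.le]
    exact tendsto_integral_besselJ ha hx.le
  · simp only [hardR₀, h2, basisForm, besselForm, limitCoeff, Matrix.cons_val, eval_quartic,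
      eval_zero, eval_mul, eval_C, eval_sub, eval_X]
    ring
  · simp only [hardP, h2, basisForm, besselForm, particularCoeff, Matrix.cons_val, eval_quartic,
      eval_mul, eval_C, eval_sub, eval_X, eval_neg, eval_add, eval_pow, eval_ofNat]
    ring
  · simp only [hardR₁, hardR₀, hardP, h2, basisForm, besselForm, limitCoeff, particularCoeff,
      Matrix.cons_val, eval_quartic, eval_zero, eval_mul, eval_C, eval_sub, eval_X, eval_neg,
      eval_add, eval_pow, eval_ofNat]
    ring
  · have hne : (1 - a ^ 2) / 4 ≠ 0 := by
      have h1 : 1 - a ≠ 0 := sub_ne_zero.mpr ha1.symm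
      have h3 : 1 + a ≠ 0 := by linarith
      rw [show (1 - a ^ 2) / 4 = (1 - a) * (1 + a) / 4 by ring]
      positivity
    obtain ⟨y, hy, h⟩ := exists_hardR₀_ne_zero ha
    exact ⟨hne, y, hy, mul_ne_zero hne h⟩
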